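/- **Setting.** Let $\mathbb F_q$ be a finite field with $q$ elements and let $n\ge 2$. Let $c_1,\dots,c_{n+1}\in\mathbb F_q^\times$, and let $A=(a_{ji})$ be an $(n+1)\times(n+1)$ matrix of non-negative integers with columns $a_i=(a_{1i},\dots,a_{n+1,i})$ such that $\sum_j a_{ji}=n+1$ and $a_i\neq(1,\dots,1)$ for all $i$. For $\lambda\in\mathbb F_q$ let $X_\lambda\subset\mathbb P^n_{\mathbb F_q}$ be the hypersurface $\sum_i c_iT^{a_i}-\lambda T_1\cdots T_{n+1}=0$, where $T^{a_i}=\prod_jT_j^{a_{ji}}$. Assume that $X_0$ is smooth. Then the kernel of $A'=(a_{ji}-1)$ on $\mathbb Z^{n+1}$ is generated by a unique vector $(\alpha_1,\dots,\alpha_{n+1})$ with positive entries; put $\alpha=\sum_i\alpha_i$. Assume that $\alpha$ and all $\alpha_i$ divide $q-1$, and put $C=\alpha^\alpha\prod_i c_i^{\alpha_i}/\alpha_i^{\alpha_i}\in\mathbb F_q^\times$. For $J\subset\{1,\dots,n+1\}$ let $I_J$ be the set of $i$ with $a_{ji}=0$ for all $j\notin J$, let $s_J=\#I_J$, and let $\widetilde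 A_J$ be the matrix $(a_{ji})_{j\in J,\,i\in I_J}$ enlarged by a last row $(1,\dots,1)$. Assume that for all $J$ with $\#J\ge (n+1)/2$ all elementary divisors of $\widetilde A_J$ divide $q-1$. Let $s_0=0,s_1,\dots,s_{d-1}\in\{0,\dots,q-2\}^{n+1}$, $s_j=(s_{1j},\dots,s_{n+1,j})$, represent each element exactly once of the kernel of the homomorphism $(\mathbb Z/(q-1))^{n+1}/\langle(\alpha_1,\dots,\alpha_{n+1})\rangle\to(\mathbb Z/(q-1))^{n+1}$ induced by $A'$. Put $|s_j|=\sum_i s_{ij}$, and assume that $\alpha_i\mid s_{ij}$ and $\alpha\mid|s_j|$ for all $i,j$; put $t_{ij}=s_{ij}/\alpha_i$ and $t_j=|s_j|/\alpha$. **Characters.** All characters have values in $\overline{\mathbb Q}$. Fix a non-trivial additive character $\theta$ of $\mathbb F_q$ and a generator $\rho$ of $\widehat{\mathbb F_q^\times}$; put $\varphi_\beta=\rho^{(q-1)/\beta}$ for $\beta\mid q-1$, and $\psi[\varphi_\beta]=(\psi,\psi\varphi_\beta,\dots,\psi\varphi_\beta^{\beta-1})$. For $r\ge1$ put $\theta_r=\theta\circ\mathrm{Tr}_{\mathbb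 F_{q^r}/\mathbb F_q}$, $\chi_r=\chi\circ\mathrm N_{\mathbb F_{q^r}/\mathbb F_q}$ for $\chi\in\widehat{\mathbb F_q^\times}$, and $G(\mu)=\sum_{x\in\mathbb F_{q^r}^\times}\theta_r(x)\mu(x)$ for $\mu\in\widehat{\mathbb F_{q^r}^\times}$. For finite sequences $(A_1,\dots,A_m)$, $(B_1,\dots,B_m)$ in $\widehat{\mathbb F_q^\times}$ and $x\in\mathbb F_{q^r}$ put $$\widetilde F\left(\begin{matrix}A_1,\dots,A_m\\B_1,\dots,B_m\end{matrix};x\right)_{\mathbb F_{q^r}}=\frac1{q^r-1}\sum_{\chi\in\widehat{\mathbb F_{q^r}^\times}}\prod_{i=1}^m\frac{G(A_{i,r}\chi)}{G(A_{i,r})}\frac{G(\overline{B_{i,r}\chi})}{G(\overline{B_{i,r}})}\,\chi(-1)^m\chi(x),$$ and let $\widetilde F^{\mathrm{red}}$ be the same function after the common parameters of the two sequences have been removed (with multiplicity). For $\lambda\in\mathbb F_q^\times$ and $0\le j\le d-1$ put $$F(j)_r=q^{r(\delta_j-1)}\,\widetilde F^{\mathrm{red}}\left(\begin{matrix}\rho^{t_j}[\varphi_\alpha]\\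 \rho^{t_{1j}}[\varphi_{\alpha_1}],\dots,\rho^{t_{n+1,j}}[\varphi_{\alpha_{n+1}}]\end{matrix};C\lambda^{-\alpha}\right)_{\mathbb F_{q^r}},$$ where $\delta_j=1$ if $|s_j|\equiv0\pmod{q-1}$ and $s_{ij}=0$ for some $i$, and $\delta_j=0$ otherwise (so $\delta_0=1$); $$\gamma(j)_r=\prod_{i=1}^{n+1}\rho_r^{s_{ij}}(\alpha_i^{-1}c_i)\cdot\rho_r^{|s_j|}\big((-\lambda)^{-1}\alpha\big)\prod_{i=1}^{n+1}\Big\{G(\rho_r^{-t_{ij}})\prod_{b=1}^{\alpha_i-1}\frac{G(\rho_r^{-t_{ij}}\varphi_{\alpha_i,r}^b)}{G(\varphi_{\alpha_i,r}^b)}\Big\}\,G(\rho_r^{t_j})\prod_{b=1}^{\alpha-1}\frac{G(\rho_r^{t_j}\varphi_{\alpha,r}^b)}{G(\varphi_{\alpha,r}^b)};$$ $$u_r=\sum_J\ \sum_{i=0}^{\#J-s_J}(-1)^{\#J-s_J-i}q^{r(i-1)}\sum_{\chi}\ \prod_{l\in I_J}G(\chi_{l,r}^{-1})\chi_{l,r}(c_l),$$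 where $J$ runs through the proper subsets of $\{1,\dots,n+1\}$ with $\#J\ge(n+1)/2$ and $s_J\ge1$, and $\chi=(\chi_l)_{l\in I_J}$ runs through the families in $\widehat{\mathbb F_q^\times}$ that lie in the kernel of the homomorphism $(\chi_l)_l\mapsto(\prod_l\chi_l^{m_{kl}})_k$ defined by $\widetilde A_J=(m_{kl})$ and have exactly $n-2i+1$ non-trivial components. Let $D$ be the number of subsets $J$ with $\#J=(n+1)/2$ such that for every $i$ there is $j\notin J$ with $a_{ji}\ge1$ (so $D=0$ if $n$ is even). **Weil functions.** A $q$-Weil number of weight $k\in\mathbb Z$ is an algebraic number all of whose complex absolute values are $q^{k/2}$. A pure $q$-Weil function of weight $k$ is a function on $\mathbb Z_{>0}$ of the form $r\mapsto\sum_{i=1}^m a_i^r$ with $q$-Weil numbers $a_i$ of weight $k$. A $q$-Weil function of weight $\neq k$ is a finite sum $\sum_i\pm f_i$ of pure $q$-Weil functions $f_i$ of weights $k_i\neq k$. **Proposition.** Let $\lambda\in\mathbb F_q^\times$ be such that $X_\lambda$ is smooth and $C\neq\lambda^\alpha$. Then the function $r\mapsto\#X_\lambda(\mathbb F_{q^r})$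 on the positive integers is the sum of the function $$r\mapsto\sum_{i=0}^{n-1}(q^r)^i+u_r+D\,(q^r)^{(n-1)/2}+\sum_{j=0}^{d-1}\gamma(j)_rF(j)_r$$ and a $q$-Weil function of weight $\neq n-1$. -/

import Mathlib

universe u

noncomputable section

namespace MonomialDeformation

open scoped Matrix

/-- The field of algebraic numbers, in which all characters take their values. -/
abbrev Qbar : Type := AlgebraicClosure ℚ

section WeilFunctions

/-- `a` is a `q`-Weil number of weight `k`: every complex embedding of the field of algebraic
numbers sends `a` to a number of absolute value `q ^ (k / 2)`. -/
def IsWeilNumber (q : ℕ) (k : ℤ) (a : Qbar) : Prop :=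
  ∀ ι : Qbar →+* ℂ, ‖ι a‖ = (q : ℝ) ^ ((k : ℝ) / 2)

/-- Pure `q`-Weil functions of weight `k`. Functions on the positive integers are represented by
functions on `ℕ` whose value at `0` is irrelevant. -/
def IsPureWeilFunction (q : ℕ) (k : ℤ) (f : ℕ → Qbar) : Prop :=
  ∃ (m : ℕ) (a : Fin m → Qbar), (∀ i, IsWeilNumber q k (a i)) ∧
    ∀ r : ℕ, 1 ≤ r → f r = ∑ i, a i ^ r

/-- Mixed `q`-Weil functions of weight `≠ k`: signed finite sums of pure `q`-Weil functions
all of whose weights are different from `k`. -/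
def IsWeilFunctionOfWeightNe (q : ℕ) (k : ℤ) (f : ℕ → Qbar) : Prop :=
  ∃ (m : ℕ) (wt : Fin m → ℤ) (g : Fin m → ℕ → Qbar) (ε : Fin m → Qbar),
    (∀ i, IsPureWeilFunction q (wt i) (g i)) ∧ (∀ i, wt i ≠ k) ∧
    (∀ i, ε i = 1 ∨ ε i = -1) ∧
    ∀ r : ℕ, 1 ≤ r → f r = ∑ i, ε i * g i r

end WeilFunctions

section Hypersurface

variable {F : Type u} [Field F] {n : ℕ}

/-- The polynomial `∑ᵢ cᵢ T ^ aᵢ - lam * T₁ ⋯ Tₙ₊₁`, where `aᵢ` is the `i`-th column of `A`. -/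
def deformedPoly (c : Fin (n + 1) → Fˣ) (A : Matrix (Fin (n + 1)) (Fin (n + 1)) ℕ) (lam : F) :
    MvPolynomial (Fin (n + 1)) F :=
  ∑ i, MvPolynomial.C (c i : F) * ∏ j, MvPolynomial.X j ^ A j i
    - MvPolynomial.C lam * ∏ j, MvPolynomial.X j

/-- The projective hypersurface defined by `P` (homogeneous) is smooth: Jacobian criterion at all
geometric points. -/
def IsSmoothHypersurface (P : MvPolynomial (Fin (n + 1)) F) : Prop :=
  ∀ x : Fin (n + 1) → AlgebraicClosure F, x ≠ 0 → MvPolynomial.aeval x P = 0 →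
    ∃ k, MvPolynomial.aeval x (MvPolynomial.pderiv k P) ≠ 0

/-- The number of `K`-rational points of the projective hypersurface defined by `P`
(homogeneous). -/
def pointCount (P : MvPolynomial (Fin (n + 1)) F) (K : Type u) [Field K] [Algebra F K] : ℕ :=
  Nat.card {x : Projectivization K (Fin (n + 1) → K) // MvPolynomial.aeval x.rep P = 0}

end Hypersurface

section Combinatorics

variable {n : ℕ} (A : Matrix (Fin (n + 1)) (Fin (n + 1)) ℕ)

/-- The matrix `A' = (aᵢⱼ - 1)`. -/
def shiftedMatrix : Matrix (Fin (n + 1)) (Fin (n + 1)) ℤ := fun j i => (A j i : ℤ) - 1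

/-- `α` has positive entries and generates the kernel of `A' : ℤⁿ⁺¹ → ℤⁿ⁺¹`. -/
def IsPosGenerator (α : Fin (n + 1) → ℕ) : Prop :=
  (∀ i, 0 < α i) ∧
    ∀ v : Fin (n + 1) → ℤ, shiftedMatrix A *ᵥ v = 0 ↔ ∃ k : ℤ, ∀ i, v i = k * (α i : ℤ)

/-- The positive generator of the kernel of `A'` is unique. -/
theorem IsPosGenerator.unique {A : Matrix (Fin (n + 1)) (Fin (n + 1)) ℕ}
    {α β : Fin (n + 1) → ℕ} (hα : IsPosGenerator A α) (hβ : IsPosGenerator A β) : α = β := by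
  obtain ⟨k, hk⟩ := (hβ.2 (fun i => (α i : ℤ))).1 ((hα.2 _).2 ⟨1, by simp⟩)
  obtain ⟨l, hl⟩ := (hα.2 (fun i => (β i : ℤ))).1 ((hβ.2 _).2 ⟨1, by simp⟩)
  have key : ∀ i, (β i : ℤ) ∣ α i ∧ (α i : ℤ) ∣ β i := fun i =>
    ⟨⟨k, by rw [hk i, mul_comm]⟩, ⟨l, by rw [hl i, mul_comm]⟩⟩
  funext i
  exact Nat.dvd_antisymm (Int.natCast_dvd_natCast.1 (key i).2) (Int.natCast_dvd_natCast.1 (key i).1)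

/-- The vector `(α₁, …, αₙ₊₁)`: the unique vector with positive entries that generates the kernel
of `A'`. -/
def alphaVec : Fin (n + 1) → ℕ := Classical.epsilon (IsPosGenerator A)

/-- `α = α₁ + ⋯ + αₙ₊₁`. -/
def alphaSum : ℕ := ∑ i, alphaVec A i

/-- The kernel of the homomorphism `f_N : (ℤ/N)ⁿ⁺¹ / (α₁, …, αₙ₊₁) → (ℤ/N)ⁿ⁺¹` induced by `A'`,
that is, the image of the kernel of `A' mod N` in the quotient. -/
def kerF (N : ℕ) : Submodule (ZMod N)
    ((Fin (n + 1) → ZMod N) ⧸ Submodule.span (ZMod N) {fun i => ((alphaVec A i : ℕ) : ZMod N)}) :=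
  (LinearMap.ker ((shiftedMatrix A).map (Int.cast : ℤ → ZMod N)).mulVecLin).map
    (Submodule.mkQ (Submodule.span (ZMod N) {fun i => ((alphaVec A i : ℕ) : ZMod N)}))

/-- The vectors `s₀, …, s_{d-1}` have entries in `{0, …, N - 1}` and represent each element of
the kernel of `f_N` exactly once. -/
structure IsKernelReps (N : ℕ) {d : ℕ} (s : Fin d → Fin (n + 1) → ℕ) : Prop where
  lt : ∀ j i, s j i < N
  injective : Function.Injective fun j =>
    (Submodule.mkQ (Submodule.span (ZMod N) {fun i => ((alphaVec A i : ℕ) : ZMod N)}))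
      (fun i => ((s j i : ℕ) : ZMod N))
  range_eq : (Set.range fun j =>
    (Submodule.mkQ (Submodule.span (ZMod N) {fun i => ((alphaVec A i : ℕ) : ZMod N)}))
      (fun i => ((s j i : ℕ) : ZMod N))) = (kerF A N : Set _)

/-- The set of indices `i` such that the monomial `T ^ aᵢ` involves only the variables `T_j`
with `j ∈ J`. -/
def monomialsIn (J : Finset (Fin (n + 1))) : Finset (Fin (n + 1)) :=
  Finset.univ.filter fun i => ∀ j, j ∉ J → A j i = 0

/-- The submatrix of `A` with rows in `J` and columns in `monomialsIn A J`, enlarged by a last row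
of ones. -/
def extMatrix (J : Finset (Fin (n + 1))) : Matrix (J ⊕ Unit) (monomialsIn A J) ℤ :=
  Matrix.fromRows (fun j i => (A j i : ℤ)) (fun _ _ => 1)

/-- All non-zero elementary divisors of the integer matrix `M` divide `N`: they are the
coefficients of a Smith normal form of the lattice spanned by the columns of `M`. -/
def ElementaryDivisorsDvd {ι κ : Type} [Finite ι] [Fintype κ] (M : Matrix ι κ ℤ) (N : ℕ) : Prop :=
  ∀ (k : ℕ) (S : Module.Basis.SmithNormalForm (LinearMap.range M.mulVecLin) ι k) (t : Fin k),
    S.a t ∣ (N : ℤ)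

/-- The number of subsets `J` with `(n + 1) / 2` elements such that every monomial `T ^ aᵢ`
involves a variable `T_j` with `j ∉ J`; it is zero if `n` is even. -/
def numD : ℕ :=
  (Finset.univ.filter fun J : Finset (Fin (n + 1)) =>
    2 * J.card = n + 1 ∧ ∀ i, ∃ j, j ∉ J ∧ 1 ≤ A j i).card

end Combinatorics

section Characters

variable {F : Type u} [Field F] (K : Type u) [Field K] [Fintype K] [Algebra F K]

/-- `χ ∘ Norm_{K/F}`. -/
def normLift (χ : MulChar F Qbar) : MulChar K Qbar :=
  MulChar.ofUnitHom (χ.toUnitHom.comp (Units.map (Algebra.norm F : K →* F)))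

/-- `θ ∘ Tr_{K/F}`. -/
def traceLift (θ : AddChar F Qbar) : AddChar K Qbar :=
  θ.compAddMonoidHom (Algebra.trace F K).toAddMonoidHom

/-- The Gauss sum over `K` with respect to `θ ∘ Tr_{K/F}`; the trivial character has value `0`
at `0`, so that its Gauss sum is `-1`. -/
def G (θ : AddChar F Qbar) (μ : MulChar K Qbar) : Qbar := gaussSum μ (traceLift K θ)

/-- The hypergeometric function over `K` whose upper and lower parameters are the characters of
`F` in the multisets `A` and `B` (of the same cardinality). -/
def hyp (θ : AddChar F Qbar) (A B : Multiset (MulChar F Qbar)) (x : K) : Qbar :=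
  1 / ((Fintype.card K : Qbar) - 1) * ∑ᶠ χ : MulChar K Qbar,
    (A.map fun a => G K θ (normLift K a * χ) / G K θ (normLift K a)).prod *
    (B.map fun b => G K θ (normLift K b * χ)⁻¹ / G K θ (normLift K b)⁻¹).prod *
    χ (-1) ^ Multiset.card A * χ x

open Classical in
/-- The hypergeometric function with reduced parameters: common parameters are removed, with
multiplicity. -/
def redHyp (θ : AddChar F Qbar) (A B : Multiset (MulChar F Qbar)) (x : K) : Qbar :=
  hyp K θ (A - B) (B - A) x

/-- `φ_β = ρ ^ ((q - 1) / β)`. -/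
def phi [Fintype F] (ρ : MulChar F Qbar) (β : ℕ) : MulChar F Qbar := ρ ^ ((Fintype.card F - 1) / β)

/-- The sequence `ψ[φ_β] = (ψ, ψ φ_β, …, ψ φ_β ^ (β - 1))`. -/
def phiSeq [Fintype F] (ρ ψ : MulChar F Qbar) (β : ℕ) : Multiset (MulChar F Qbar) :=
  (Multiset.range β).map fun b => ψ * phi ρ β ^ b

end Characters

section Terms

variable {F : Type u} [Field F] {n : ℕ}

/-- `C = α ^ α ∏ᵢ cᵢ ^ αᵢ / αᵢ ^ αᵢ`. -/
def constC (c : Fin (n + 1) → Fˣ) (A : Matrix (Fin (n + 1)) (Fin (n + 1)) ℕ) : F :=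
  (alphaSum A : F) ^ alphaSum A *
    ∏ i, (c i : F) ^ alphaVec A i / (alphaVec A i : F) ^ alphaVec A i

open Classical in
/-- `1` if `|σ| ≡ 0 mod N` and some entry of `σ` is zero, and `0` otherwise. For `N = q - 1` it is
`1` exactly when the trivial character is among both the upper and the lower parameters
occurring in `valF`. -/
def delta (N : ℕ) (σ : Fin (n + 1) → ℕ) : ℤ := if N ∣ ∑ i, σ i ∧ ∃ i, σ i = 0 then 1 else 0

variable [Fintype F] (K : Type u) [Field K] [Fintype K] [Algebra F K]

/-- The function `F(j)_r` for `σ = s_j` and `K` of degree `r` over `F`; here `tᵢ = σᵢ / αᵢ` and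
`t = |σ| / α`. -/
def valF (θ : AddChar F Qbar) (ρ : MulChar F Qbar) (c : Fin (n + 1) → Fˣ)
    (A : Matrix (Fin (n + 1)) (Fin (n + 1)) ℕ) (lam : Fˣ) (σ : Fin (n + 1) → ℕ) : Qbar :=
  (Fintype.card K : Qbar) ^ (delta (Fintype.card F - 1) σ - 1) *
    redHyp K θ (phiSeq ρ (ρ ^ ((∑ i, σ i) / alphaSum A)) (alphaSum A))
      (∑ i, phiSeq ρ (ρ ^ (σ i / alphaVec A i)) (alphaVec A i))
      (algebraMap F K (constC c A * ((lam : F) ^ alphaSum A)⁻¹))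

/-- The element `γ(j)_r` for `σ = s_j` and `K` of degree `r` over `F`. -/
def valGamma (θ : AddChar F Qbar) (ρ : MulChar F Qbar) (c : Fin (n + 1) → Fˣ)
    (A : Matrix (Fin (n + 1)) (Fin (n + 1)) ℕ) (lam : Fˣ) (σ : Fin (n + 1) → ℕ) : Qbar :=
  (∏ i, (normLift K ρ ^ σ i) (algebraMap F K ((alphaVec A i : F)⁻¹ * (c i : F)))) *
  (normLift K ρ ^ (∑ i, σ i)) (algebraMap F K ((-(lam : F))⁻¹ * (alphaSum A : F))) *
  (∏ i, (G K θ (normLift K ρ ^ (σ i / alphaVec A i))⁻¹ *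
    ∏ b ∈ Finset.Ico 1 (alphaVec A i),
      G K θ ((normLift K ρ ^ (σ i / alphaVec A i))⁻¹ * normLift K (phi ρ (alphaVec A i)) ^ b) /
        G K θ (normLift K (phi ρ (alphaVec A i)) ^ b))) *
  (G K θ (normLift K ρ ^ ((∑ i, σ i) / alphaSum A)) *
    ∏ b ∈ Finset.Ico 1 (alphaSum A),
      G K θ (normLift K ρ ^ ((∑ i, σ i) / alphaSum A) * normLift K (phi ρ (alphaSum A)) ^ b) /
        G K θ (normLift K (phi ρ (alphaSum A)) ^ b))

/-- The kernel of the homomorphism between powers of the character group of `Fˣ` defined by an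
integer matrix `M`. -/
def kerPhi {ι κ : Type} [Fintype κ] (M : Matrix ι κ ℤ) : Set (κ → MulChar F Qbar) :=
  {χ | ∀ j, ∏ i, χ i ^ M j i = 1}

open Classical in
/-- The element `u_r` for `K` of degree `r` over `F`. The outer sum is over the proper subsets `J`
with at least `(n + 1) / 2` elements for which the number `s` of elements of `monomialsIn A J` is
positive; in the innermost sum, exactly `n - 2 * i + 1` components are non-trivial. -/
def valU (θ : AddChar F Qbar) (c : Fin (n + 1) → Fˣ)
    (A : Matrix (Fin (n + 1)) (Fin (n + 1)) ℕ) : Qbar :=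
  ∑ J ∈ Finset.univ.filter (fun J : Finset (Fin (n + 1)) =>
      J ≠ Finset.univ ∧ n + 1 ≤ 2 * J.card ∧ (monomialsIn A J).Nonempty),
    ∑ i ∈ Finset.range (J.card - (monomialsIn A J).card + 1),
      (-1 : Qbar) ^ (J.card - (monomialsIn A J).card - i) *
      (Fintype.card K : Qbar) ^ ((i : ℤ) - 1) *
      ∑ᶠ χ ∈ {χ : monomialsIn A J → MulChar F Qbar | χ ∈ kerPhi (extMatrix A J) ∧
          (Finset.univ.filter fun j => χ j ≠ 1).card + 2 * i = n + 1},
        ∏ j, G K θ (normLift K (χ j))⁻¹ * normLift K (χ j) (algebraMap F K (c j))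

end Terms

end MonomialDeformation

end

open MonomialDeformation

/-! Write K for the extension of F of degree r and Q for its cardinality. Detecting zeros on the
affine cone over X_λ by additive characters, and splitting affine space by the support J of a point,
expresses #X_λ(K) as Q⁻¹ + Σ Q^i plus, for each nonempty J, an exponential sum over a torus divided
by Q (Q - 1) (`pointCount_eq_sum_torusSum`). Fourier expansion on the torus (`sum_torus_eq`) turns
each of them into a sum of products of Gauss sums over families of characters in the kernel of an
integer matrix. For a family lifted from F, the Hasse–Davenport lifting relation makes the product,
up to a fixed sign, the r-th power of a Weil number whose weight is the number of non-trivial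
characters.

Smoothness of X_0 forces the defining polynomial to have, up to coefficients, the shape Σ T_j^n
T_{f(j)} with f injective outside its fixed points (`exists_isChainLoop`). This gives the
invertibility of A, the positive generator of the kernel of A', and the inequalities s_J ≤ #J and 2
#J ≤ n + 1 + s_J.

For a proper subset J the term with λ vanishes, all families come from F, and the contribution is
Q⁻¹ (Q - 1)^(#J - s_J) times the sum of the Gauss sum terms. After binomial expansion a term Q^(i-1)
with k non-trivial characters has weight 2 (i - 1) + k. By the second inequality this is n - 1 only
for i = #J - s_J, where the binomial coefficient is 1. These terms form u_r, and for s_J = 0 the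
summand with D; everything else is error.

For the full torus, the kernel of A' over K is the disjoint union of d families ψ ↦ (ρ^{s_ij}
ψ^{α_i}) (`sum_kerPhi_shiftedMatrix`). The Hasse–Davenport product relation, obtained here from
L-series of polynomials, converts the j-th family into γ(j) times a hypergeometric sum with
unreduced parameters. Cancelling common parameters changes individual summands by powers of Q. With
the normalisation q^{r(δ_j - 1)} the discrepancy is Q⁻¹ times Gauss sum terms with ∏ χ_i = 1 and
some χ_i = 1; they have weight at most n - 2 (`valGamma_mul_valF`). -/

noncomputable section
namespace MonomialDeformation
open Polynomial

/-! ### Euler products: L-series of multiplicative functions on monic polynomials. -/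

section EulerProduct

section

variable {k E : Type*} [Field k] [Field E]

/-- A function on polynomials that is completely multiplicative on monic polynomials. -/
structure IsMonicMul (w : k[X] → E) : Prop where
  map_one : w 1 = 1
  map_mul : ∀ f g : k[X], f.Monic → g.Monic → w (f * g) = w f * w g

theorem IsMonicMul.map_pow {w : k[X] → E} (hw : IsMonicMul w) {f : k[X]} (hf : f.Monic) (n : ℕ) :
    w (f ^ n) = w f ^ n := by
  induction n with
  | zero => simp [hw.map_one]
  | succ n ih => rw [pow_succ, hw.map_mul _ _ (hf.pow n) hf, ih, pow_succ]

end

theorem finite_setOf_monic_natDegree_eq (k : Type*) [Field k] [Finite k] (m : ℕ) :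
    {g : k[X] | g.Monic ∧ g.natDegree = m}.Finite :=
  Set.finite_coe_iff.1 (Finite.of_equiv _
    ((monicEquivDegreeLT (R := k) m).trans (degreeLTEquiv k m).toEquiv).symm)

/-- The monic polynomials of degree `m` over a finite field. -/
def monics (k : Type*) [Field k] [Finite k] (m : ℕ) : Finset k[X] :=
  (finite_setOf_monic_natDegree_eq k m).toFinset

variable {k : Type*} [Field k] [Finite k]

@[simp] theorem mem_monics {m : ℕ} {g : k[X]} : g ∈ monics k m ↔ g.Monic ∧ g.natDegree = m := by
  simp [monics]

open Classical in
variable (k) in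
/-- The monic irreducible polynomials of degree at most `m` over a finite field. -/
def irreds (m : ℕ) : Finset k[X] :=
  ((Finset.range (m + 1)).biUnion (monics k)).filter Irreducible

theorem mem_irreds {m : ℕ} {P : k[X]} :
    P ∈ irreds k m ↔ P.Monic ∧ P.natDegree ≤ m ∧ Irreducible P := by
  simp only [irreds, Finset.mem_filter, Finset.mem_biUnion, Finset.mem_range, mem_monics]
  constructor
  · rintro ⟨⟨d, hd, h1, h2⟩, h3⟩
    exact ⟨h1, by omega, h3⟩
  · rintro ⟨h1, h2, h3⟩
    exact ⟨⟨_, by omega, h1, rfl⟩, h3⟩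

open Classical in
-- An irreducible factor P of multiplicity e is counted once for each of P, ..., P^e, hence
-- contributes e * deg P. This is the analogue of writing log as the convolution of the von Mangoldt
-- function with 1.
theorem natDegree_eq_sum_irreds {m : ℕ} {g : k[X]} (hg : g ∈ monics k m) :
    m = ∑ P ∈ irreds k m, ∑ i ∈ Finset.Icc 1 m, if P ^ i ∣ g then P.natDegree else 0 := by
  obtain ⟨hmon, rfl⟩ := mem_monics.1 hg
  have hg0 : g ≠ 0 := hmon.ne_zero
  set s := UniqueFactorizationMonoid.normalizedFactors g with hs
  have hprod : s.prod = g := by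
    rw [hs, UniqueFactorizationMonoid.prod_normalizedFactors_eq hg0, hmon.normalize_eq_self]
  have hmonic : ∀ P ∈ s, P.Monic := fun P hP =>
    (Polynomial.normalize_eq_self_iff_monic
      (UniqueFactorizationMonoid.irreducible_of_normalized_factor P hP).ne_zero).1
      (UniqueFactorizationMonoid.normalize_normalized_factor P hP)
  have hdeg : g.natDegree = (s.map natDegree).sum := by
    rw [← natDegree_multiset_prod_of_monic s hmonic, hprod]
  have hcount : ∀ P : k[X], P.Monic → Irreducible P →
      (∑ i ∈ Finset.Icc 1 g.natDegree, if P ^ i ∣ g then P.natDegree else 0) =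
        s.count P * P.natDegree := by
    intro P hP hirr
    have hdvd : ∀ i, P ^ i ∣ g ↔ i ≤ s.count P := by
      intro i
      rw [pow_dvd_iff_le_emultiplicity,
        UniqueFactorizationMonoid.emultiplicity_eq_count_normalizedFactors hirr hg0,
        hP.normalize_eq_self, ENat.natCast_le_natCast]
    have hle : s.count P ≤ g.natDegree := by
      have h1 := natDegree_le_of_dvd ((hdvd (s.count P)).2 le_rfl) hg0
      rw [natDegree_pow] at h1
      have := hirr.natDegree_pos
      nlinarith
    rw [← Finset.sum_filter, Finset.sum_const, smul_eq_mul]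
    congr 1
    have : (Finset.Icc 1 g.natDegree).filter (fun i => P ^ i ∣ g) = Finset.Icc 1 (s.count P) := by
      ext i
      simp only [Finset.mem_filter, Finset.mem_Icc, hdvd]
      omega
    rw [this]
    simp
  rw [Finset.sum_congr rfl fun P hP => hcount P (mem_irreds.1 hP).1 (mem_irreds.1 hP).2.2]
  conv_lhs => rw [hdeg, Finset.sum_multiset_map_count]
  refine Finset.sum_subset (fun P hP => ?_) (fun P _ hP => ?_)
  · rw [Multiset.mem_toFinset] at hP
    exact mem_irreds.2 ⟨hmonic P hP, natDegree_le_of_dvd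
      (UniqueFactorizationMonoid.dvd_of_mem_normalizedFactors hP) hg0,
      UniqueFactorizationMonoid.irreducible_of_normalized_factor P hP⟩
  · rw [Multiset.mem_toFinset] at hP
    simp [Multiset.count_eq_zero_of_notMem hP]

variable {E : Type*} [Field E]

/-- The sum of the values of `w` at the monic polynomials of degree `m`. -/
def monicSum (w : k[X] → E) (m : ℕ) : E := ∑ g ∈ monics k m, w g

open Classical in
/-- The coefficient of index `j` of the logarithmic derivative of the `L`-series of `w`. -/
def mangoldtSum (w : k[X] → E) (j : ℕ) : E :=
  ∑ P ∈ irreds k j, if P.natDegree ∣ j then (P.natDegree : E) * w P ^ (j / P.natDegree) else 0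

open Classical in
theorem sum_monics_of_dvd {w : k[X] → E} (hw : IsMonicMul w) {f : k[X]} (hf : f.Monic) (m : ℕ) :
    (∑ g ∈ monics k m, if f ∣ g then w g else 0) =
      if f.natDegree ≤ m then w f * monicSum w (m - f.natDegree) else 0 := by
  split_ifs with hle
  · rw [← Finset.sum_filter, monicSum, Finset.mul_sum]
    symm
    refine Finset.sum_bij (fun h _ => f * h) ?_ ?_ ?_ ?_
    · intro h hh
      rw [mem_monics] at hh
      rw [Finset.mem_filter, mem_monics, hf.natDegree_mul hh.1]
      exact ⟨⟨hf.mul hh.1, by omega⟩, dvd_mul_right _ _⟩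
    · intro a _ b _ hab
      exact mul_left_cancel₀ hf.ne_zero hab
    · intro g hg
      rw [Finset.mem_filter, mem_monics] at hg
      obtain ⟨⟨h1, h2⟩, h, rfl⟩ := hg
      have hh := hf.of_mul_monic_left h1
      refine ⟨h, ?_, rfl⟩
      rw [hf.natDegree_mul hh] at h2
      rw [mem_monics]
      exact ⟨hh, by omega⟩
    · intro h hh
      rw [mem_monics] at hh
      rw [hw.map_mul _ _ hf hh.1]
  · refine Finset.sum_eq_zero fun g hg => ?_
    rw [mem_monics] at hg
    rw [if_neg]
    intro hd
    have := natDegree_le_of_dvd hd hg.1.ne_zero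
    omega

open Classical in
-- Coefficient form of T L' = L Λ for the L-series L of `w`: insert `natDegree_eq_sum_irreds` into
-- the left side and sum first over the multiples of each P^i.
theorem natCast_mul_monicSum {w : k[X] → E} (hw : IsMonicMul w) (m : ℕ) :
    (m : E) * monicSum w m =
      ∑ j ∈ Finset.Icc 1 m, mangoldtSum w j * monicSum w (m - j) := by
  have h1 : (m : E) * monicSum w m = ∑ P ∈ irreds k m, ∑ i ∈ Finset.Icc 1 m,
      if i * P.natDegree ≤ m then
        (P.natDegree : E) * w P ^ i * monicSum w (m - i * P.natDegree) else 0 := by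
    have : (m : E) * monicSum w m = ∑ g ∈ monics k m, ∑ P ∈ irreds k m, ∑ i ∈ Finset.Icc 1 m,
        (P.natDegree : E) * (if P ^ i ∣ g then w g else 0) := by
      rw [monicSum, Finset.mul_sum]
      refine Finset.sum_congr rfl fun g hg => ?_
      conv_lhs => rw [natDegree_eq_sum_irreds hg]
      push_cast
      rw [Finset.sum_mul]
      refine Finset.sum_congr rfl fun P _ => ?_
      rw [Finset.sum_mul]
      refine Finset.sum_congr rfl fun i _ => ?_
      split_ifs <;> simp
    rw [this, Finset.sum_comm]
    refine Finset.sum_congr rfl fun P hP => ?_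
    rw [Finset.sum_comm]
    refine Finset.sum_congr rfl fun i _ => ?_
    have hP' := (mem_irreds.1 hP).1
    rw [← Finset.mul_sum, sum_monics_of_dvd hw (hP'.pow i), hw.map_pow hP', hP'.natDegree_pow]
    split_ifs <;> ring
  have h2 : ∀ j ∈ Finset.Icc 1 m, mangoldtSum w j * monicSum w (m - j) =
      ∑ P ∈ irreds k m, if P.natDegree ∣ j then
        (P.natDegree : E) * w P ^ (j / P.natDegree) * monicSum w (m - j) else 0 := by
    intro j hj
    rw [Finset.mem_Icc] at hj
    rw [mangoldtSum, Finset.sum_mul]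
    refine Finset.sum_subset_zero_on_sdiff (fun P hP => ?_) (fun P hP => ?_) (fun P _ => ?_)
    · rw [mem_irreds] at hP ⊢
      exact ⟨hP.1, by omega, hP.2.2⟩
    · rw [Finset.mem_sdiff, mem_irreds, mem_irreds] at hP
      rw [if_neg]
      intro hd
      exact hP.2 ⟨hP.1.1, Nat.le_of_dvd (by omega) hd, hP.1.2.2⟩
    · split_ifs <;> simp
  rw [h1, Finset.sum_congr rfl h2]
  conv_rhs => rw [Finset.sum_comm]
  refine Finset.sum_congr rfl fun P hP => ?_
  have hd : 0 < P.natDegree := (mem_irreds.1 hP).2.2.natDegree_pos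
  rw [← Finset.sum_filter, ← Finset.sum_filter]
  refine Finset.sum_bij (fun i _ => i * P.natDegree) ?_ ?_ ?_ ?_
  · intro i hi
    simp only [Finset.mem_filter, Finset.mem_Icc] at hi ⊢
    exact ⟨⟨Nat.mul_pos (by omega) hd, hi.2⟩, dvd_mul_left _ _⟩
  · intro a _ b _ hab
    exact Nat.eq_of_mul_eq_mul_right hd hab
  · intro j hj
    simp only [Finset.mem_filter, Finset.mem_Icc] at hj
    obtain ⟨⟨hj1, hj2⟩, i, rfl⟩ := hj
    refine ⟨i, ?_, mul_comm _ _⟩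
    simp only [Finset.mem_filter, Finset.mem_Icc]
    refine ⟨⟨Nat.pos_of_mul_pos_left hj1, ?_⟩, by rwa [mul_comm]⟩
    nlinarith
  · intro i _
    rw [Nat.mul_div_cancel _ hd]

/-- The function `w ∘ charpoly` on a finite extension of a finite field. -/
theorem mangoldtSum_eq_sum (w : k[X] → E) (L : Type*) [Field L] [Fintype L] [Algebra k L] :
    mangoldtSum w (Module.finrank k L) =
      ∑ x : L, w (minpoly k x) ^ (Module.finrank k L / (minpoly k x).natDegree) := by
  classical
  have hint : ∀ x : L, IsIntegral k x := fun x => .of_finite k x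
  have hdvd : ∀ x : L, (minpoly k x).natDegree ∣ Module.finrank k L := fun x =>
    minpoly.degree_dvd (hint x)
  have hmem : ∀ x : L, minpoly k x ∈ irreds k (Module.finrank k L) := fun x =>
    mem_irreds.2 ⟨minpoly.monic (hint x), Nat.le_of_dvd Module.finrank_pos (hdvd x),
      minpoly.irreducible (hint x)⟩
  rw [mangoldtSum, ← Finset.sum_fiberwise_of_maps_to (g := fun x : L => minpoly k x)
    (t := irreds k (Module.finrank k L)) (fun x _ => hmem x)]
  refine Finset.sum_congr rfl fun P hP => ?_
  rw [mem_irreds] at hP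
  have hfib : ∀ x : L, minpoly k x = P ↔ x ∈ P.rootSet L := by
    intro x
    rw [mem_rootSet_of_ne hP.1.ne_zero]
    constructor
    · rintro rfl
      exact minpoly.aeval _ _
    · intro h
      exact (minpoly.eq_of_irreducible_of_monic hP.2.2 h hP.1).symm
  rw [Finset.sum_congr rfl (g := fun _ => w P ^ (Module.finrank k L / P.natDegree))
    (fun x hx => by rw [(Finset.mem_filter.1 hx).2]), Finset.sum_const, nsmul_eq_mul]
  have hcard : (Finset.univ.filter fun x : L => minpoly k x = P).card =
      if P.natDegree ∣ Module.finrank k L then P.natDegree else 0 := by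
    split_ifs with hd
    -- If deg P divides [L : k], then k[X]/(P) embeds into L; normality and separability then give
    -- exactly deg P roots of P in L.
    · have := Fact.mk hP.2.2
      have hfr : Module.finrank k (AdjoinRoot P) = P.natDegree := by
        rw [(AdjoinRoot.powerBasis hP.1.ne_zero).finrank, AdjoinRoot.powerBasis_dim]
      obtain ⟨φ⟩ := FiniteField.nonempty_algHom_of_finrank_dvd (F := k) (K := AdjoinRoot P) (L := L)
        (by rwa [hfr])
      have hroot : minpoly k (φ (AdjoinRoot.root P)) = P := by
        rw [hfib, mem_rootSet_of_ne hP.1.ne_zero, aeval_algHom_apply, AdjoinRoot.aeval_eq]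
        simp
      have hsplit : (P.map (algebraMap k L)).Splits := by
        rw [← hroot]
        exact Normal.splits inferInstance _
      have hsep : P.Separable := PerfectField.separable_of_irreducible hP.2.2
      rw [← card_rootSet_eq_natDegree hsep hsplit, Fintype.card_subtype]
      congr 1
      ext x
      simp [hfib]
    · rw [Finset.card_eq_zero, Finset.filter_eq_empty_iff]
      rintro x - rfl
      exact hd (hdvd x)
  rw [hcard]
  split_ifs <;> simp

end EulerProduct

/-! ### Power sums of the roots of a monic polynomial, norms and traces. -/

section PowerSums

variable {k : Type*} [Field k]

/-- The sum of the `b`-th powers of the roots of a monic polynomial, for `b ≥ 1`. -/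
def powSum (b : ℕ) (g : k[X]) : k :=
  -PowerSeries.coeff b (PowerSeries.X * PowerSeries.derivative k (g.reverse : PowerSeries k) *
    (g.reverse : PowerSeries k)⁻¹)

theorem constantCoeff_coe_reverse {g : k[X]} (hg : g.Monic) :
    PowerSeries.constantCoeff (g.reverse : PowerSeries k) = 1 := by
  rw [← PowerSeries.coeff_zero_eq_constantCoeff_apply, Polynomial.coeff_coe, coeff_zero_reverse]
  exact hg

theorem coe_reverse_mul_inv {g : k[X]} (hg : g.Monic) :
    (g.reverse : PowerSeries k) * (g.reverse : PowerSeries k)⁻¹ = 1 :=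
  PowerSeries.mul_inv_cancel _ (by rw [constantCoeff_coe_reverse hg]; exact one_ne_zero)

theorem powSum_one (b : ℕ) : powSum b (1 : k[X]) = 0 := by
  have : (1 : k[X]).reverse = 1 := by rw [← C_1, reverse_C]
  simp [powSum, this]

/-- Reversal turns ∏ (X - r) into R = ∏ (1 - r X), and -X R'/R is the generating series of the power
sums. It is additive because reversal is multiplicative, and no splitting field is needed. -/
theorem powSum_mul (b : ℕ) {f g : k[X]} (hf : f.Monic) (hg : g.Monic) :
    powSum b (f * g) = powSum b f + powSum b g := by
  rw [powSum, powSum, powSum, ← neg_add, ← map_add, reverse_mul_of_domain, Polynomial.coe_mul]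
  congr 2
  set R : PowerSeries k := (f.reverse : PowerSeries k)
  set S : PowerSeries k := (g.reverse : PowerSeries k)
  have hR : R * R⁻¹ = 1 := coe_reverse_mul_inv hf
  have hS : S * S⁻¹ = 1 := coe_reverse_mul_inv hg
  rw [Derivation.leibniz, PowerSeries.mul_inv_rev, smul_eq_mul, smul_eq_mul]
  linear_combination PowerSeries.X * S⁻¹ * PowerSeries.derivative k S * hR +
    PowerSeries.X * R⁻¹ * PowerSeries.derivative k R * hS

theorem powSum_X_sub_C {b : ℕ} (hb : b ≠ 0) (r : k) : powSum b (X - C r) = r ^ b := by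
  have hrev : (X - C r : k[X]).reverse = 1 - C r * X := by
    ext n
    rw [coeff_reverse, natDegree_X_sub_C]
    rcases n with _ | _ | n
    · simp [revAt_le]
    · simp [revAt_le, coeff_one]
    · rw [revAt_eq_self_of_lt (by omega)]
      simp [coeff_X, coeff_one]
  have hmon := constantCoeff_coe_reverse (monic_X_sub_C r)
  have hgeom : ((X - C r : k[X]).reverse : PowerSeries k)⁻¹ = PowerSeries.mk fun n => r ^ n := by
    rw [PowerSeries.inv_eq_iff_mul_eq_one (by rw [hmon]; exact one_ne_zero), hrev]
    ext n
    rw [Polynomial.coe_sub, Polynomial.coe_mul, Polynomial.coe_C, Polynomial.coe_X,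
      Polynomial.coe_one, mul_sub, mul_one, mul_left_comm, map_sub, PowerSeries.coeff_C_mul]
    rcases n with _ | n
    · simp
    · rw [PowerSeries.coeff_succ_mul_X]
      simp [PowerSeries.coeff_one, pow_succ, mul_comm]
  obtain ⟨b, rfl⟩ := Nat.exists_eq_succ_of_ne_zero hb
  rw [powSum, hgeom, PowerSeries.derivative_coe, hrev]
  simp only [derivative_sub, derivative_one, derivative_mul, derivative_C, derivative_X, zero_sub,
    zero_mul, zero_add, mul_one, Polynomial.coe_neg, Polynomial.coe_C]
  rw [mul_assoc, Nat.succ_eq_add_one, PowerSeries.coeff_succ_X_mul, neg_mul, map_neg,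
    PowerSeries.coeff_C_mul, PowerSeries.coeff_mk, neg_neg, pow_succ']

theorem powSum_multiset_prod {b : ℕ} (hb : b ≠ 0) (s : Multiset k) :
    powSum b (s.map fun r => X - C r).prod = (s.map fun r => r ^ b).sum := by
  induction s using Multiset.induction with
  | empty => simp [powSum_one]
  | cons r s ih =>
    rw [Multiset.map_cons, Multiset.prod_cons, powSum_mul b (monic_X_sub_C r)
      (monic_multisetProd_X_sub_C s), ih, powSum_X_sub_C hb, Multiset.map_cons, Multiset.sum_cons]

theorem powSum_map {K : Type*} [Field K] (φ : k →+* K) (b : ℕ) {g : k[X]} (hg : g.Monic) :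
    powSum b (g.map φ) = φ (powSum b g) := by
  have hrev : ((g.map φ).reverse : PowerSeries K) =
      PowerSeries.map φ (g.reverse : PowerSeries k) := by
    rw [reverse, hg.natDegree_map, reflect_map, ← reverse, Polynomial.polynomial_map_coe]
  have hinv : ((g.map φ).reverse : PowerSeries K)⁻¹ =
      PowerSeries.map φ (g.reverse : PowerSeries k)⁻¹ := by
    rw [PowerSeries.inv_eq_iff_mul_eq_one, hrev, ← map_mul, mul_comm, coe_reverse_mul_inv hg,
      map_one]
    rw [constantCoeff_coe_reverse (hg.map φ)]
    exact one_ne_zero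
  have hder : PowerSeries.derivative K ((g.map φ).reverse : PowerSeries K) =
      PowerSeries.map φ (PowerSeries.derivative k (g.reverse : PowerSeries k)) := by
    rw [hrev]
    ext n
    simp [PowerSeries.coeff_derivative]
  rw [powSum, hinv, hder, powSum, map_neg, ← PowerSeries.coeff_map,
    (PowerSeries.map φ).map_mul, (PowerSeries.map φ).map_mul, PowerSeries.map_X]

theorem powSum_eq_neg_nextCoeff {g : k[X]} (hg : g.Monic) : powSum 1 g = -g.nextCoeff := by
  have h := PowerSeries.coeff_succ_X_mul 0
    (PowerSeries.derivative k (g.reverse : PowerSeries k) * (g.reverse : PowerSeries k)⁻¹)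
  rw [zero_add] at h
  rw [powSum, mul_assoc, h]
  simp only [PowerSeries.coeff_zero_eq_constantCoeff, map_mul, PowerSeries.constantCoeff_inv,
    constantCoeff_coe_reverse hg]
  rw [← PowerSeries.coeff_zero_eq_constantCoeff_apply, PowerSeries.coeff_derivative,
    Polynomial.coeff_coe, zero_add, coeff_one_reverse]
  simp

/-- Newton's identity in degree b: the constant coefficient of g becomes the coefficient of X^b in
the reverse, so it first affects the logarithmic derivative at index b, and does so linearly. -/
theorem powSum_add_C {b : ℕ} (hb : b ≠ 0) {g : k[X]} (hg : g.Monic) (hdeg : g.natDegree = b)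
    (c : k) : powSum b (g + C c) = powSum b g - b * c := by
  have hg' : (g + C c).Monic := hg.add_of_left (lt_of_le_of_lt degree_C_le
    (by rw [degree_eq_natDegree hg.ne_zero, hdeg]; exact_mod_cast Nat.pos_of_ne_zero hb))
  have hrev : (g + C c).reverse = g.reverse + C c * X ^ b := by rw [reverse_add_C, hdeg]
  have hcoe : ((g + C c).reverse : PowerSeries k) =
      (g.reverse : PowerSeries k) + PowerSeries.C c * PowerSeries.X ^ b := by
    rw [hrev]; simp
  set R : PowerSeries k := (g.reverse : PowerSeries k) with hR
  set S : PowerSeries k := ((g + C c).reverse : PowerSeries k) with hS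
  set U := PowerSeries.X * PowerSeries.derivative k R * R⁻¹ with hU
  have hRR : R * R⁻¹ = 1 := coe_reverse_mul_inv hg
  have hSS : S * S⁻¹ = 1 := coe_reverse_mul_inv hg'
  have hXb : PowerSeries.X * PowerSeries.derivative k (PowerSeries.X ^ b : PowerSeries k) =
      (b : PowerSeries k) * PowerSeries.X ^ b := by
    obtain ⟨b, rfl⟩ := Nat.exists_eq_succ_of_ne_zero hb
    rw [PowerSeries.derivative_pow, PowerSeries.derivative_X, Nat.succ_sub_one,
      Nat.succ_eq_add_one]
    ring
  have hder : PowerSeries.X * PowerSeries.derivative k S =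
      PowerSeries.X * PowerSeries.derivative k R +
        PowerSeries.C c * ((b : PowerSeries k) * PowerSeries.X ^ b) := by
    rw [← hXb, hcoe, map_add, Derivation.leibniz, PowerSeries.derivative_C]
    simp only [smul_eq_mul, mul_zero, add_zero]
    ring
  have key : PowerSeries.X * PowerSeries.derivative k S * S⁻¹ =
      U + PowerSeries.X ^ b * (PowerSeries.C c * ((b : PowerSeries k) - U) * S⁻¹) := by
    have h1 : U * R = PowerSeries.X * PowerSeries.derivative k R := by
      rw [hU]; linear_combination PowerSeries.X * PowerSeries.derivative k R * hRR
    have h2 : U = U * S * S⁻¹ := by rw [mul_assoc, hSS, mul_one]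
    rw [hder, ← h1]
    conv_rhs => enter [1]; rw [h2]
    rw [show U * S = U * R + U * PowerSeries.C c * PowerSeries.X ^ b by rw [hcoe]; ring]
    ring
  have hU0 : PowerSeries.constantCoeff U = 0 := by simp [hU]
  have hb0 : PowerSeries.constantCoeff (b : PowerSeries k) = b := by simp
  rw [powSum, powSum, ← hS, ← hR, key, map_add, ← hU]
  have : PowerSeries.coeff b (PowerSeries.X ^ b *
      (PowerSeries.C c * ((b : PowerSeries k) - U) * S⁻¹)) = c * b := by
    have := PowerSeries.coeff_X_pow_mul (PowerSeries.C c * ((b : PowerSeries k) - U) * S⁻¹) b 0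
    rw [zero_add] at this
    rw [this]
    simp only [PowerSeries.coeff_zero_eq_constantCoeff, map_mul, map_sub,
      PowerSeries.constantCoeff_inv, hS, constantCoeff_coe_reverse hg', hU0]
    simp
  rw [this]
  ring

/-- The trace factors through k(x). There it is the sum over the embeddings, which correspond to the
roots of the minimal polynomial; passing from k(x) to L multiplies by the degree. -/
theorem finrank_mul_powSum_minpoly {L : Type*} [Field L] [Algebra k L] [FiniteDimensional k L]
    [Algebra.IsSeparable k L] {b : ℕ} (hb : b ≠ 0) (x : L) :
    (Module.finrank (IntermediateField.adjoin k {x}) L : k) * powSum b (minpoly k x) =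
      Algebra.trace k L (x ^ b) := by
  classical
  have hx : IsIntegral k x := .of_finite k x
  set M := IntermediateField.adjoin k {x}
  let pb := IntermediateField.adjoin.powerBasis hx
  have hgen : algebraMap M L pb.gen = x := by
    rw [IntermediateField.adjoin.powerBasis_gen, IntermediateField.AdjoinSimple.algebraMap_gen]
  have hmin : minpoly k pb.gen = minpoly k x := by
    rw [IntermediateField.adjoin.powerBasis_gen, IntermediateField.minpoly_gen]
  have hsep : IsSeparable k pb.gen := Algebra.IsSeparable.isSeparable k _
  have h1 : Algebra.trace k L (x ^ b) =
      (Module.finrank M L : k) * Algebra.trace k M (pb.gen ^ b) := by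
    rw [← Algebra.trace_trace (S := M),
      show x ^ b = algebraMap M L (pb.gen ^ b) by rw [map_pow, hgen],
      Algebra.trace_algebraMap, map_nsmul, nsmul_eq_mul]
  rw [h1]
  congr 1
  apply (algebraMap k (AlgebraicClosure k)).injective
  have hmap : (minpoly k x).map (algebraMap k (AlgebraicClosure k)) =
      (((minpoly k x).aroots (AlgebraicClosure k)).map fun r => X - C r).prod :=
    (IsAlgClosed.splits _).eq_prod_roots_of_monic ((minpoly.monic hx).map _)
  rw [← powSum_map _ _ (minpoly.monic hx), hmap, powSum_multiset_prod hb,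
    trace_eq_sum_embeddings (AlgebraicClosure k)]
  have hnd : ((minpoly k pb.gen).aroots (AlgebraicClosure k)).Nodup :=
    nodup_roots ((separable_map _).mpr hsep)
  rw [Fintype.sum_equiv pb.liftEquiv' (fun σ => σ (pb.gen ^ b)) (fun y => (y : AlgebraicClosure k) ^ b)
    (fun σ => by rw [PowerBasis.liftEquiv'_apply_coe, map_pow]), ← hmin]
  rw [Finset.sum_mem_multiset (g := fun y => y ^ b) _ _ (fun _ => rfl),
    Finset.sum_eq_multiset_sum, Multiset.toFinset_val, Multiset.dedup_eq_self.mpr hnd]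

theorem minpoly_coeff_zero_pow {L : Type*} [Field L] [Algebra k L] [FiniteDimensional k L]
    (x : L) : ((-1) ^ (minpoly k x).natDegree * (minpoly k x).coeff 0) ^
      Module.finrank (IntermediateField.adjoin k {x}) L = Algebra.norm k x := by
  have hx : IsIntegral k x := .of_finite k x
  have := Algebra.PowerBasis.norm_gen_eq_coeff_zero_minpoly
    (IntermediateField.adjoin.powerBasis hx)
  rw [IntermediateField.adjoin.powerBasis_gen, IntermediateField.minpoly_gen,
    IntermediateField.adjoin.powerBasis_dim] at this
  rw [Algebra.norm_eq_norm_adjoin k x, this]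

theorem finrank_div_natDegree_minpoly {L : Type*} [Field L] [Algebra k L] [FiniteDimensional k L]
    (x : L) : Module.finrank k L / (minpoly k x).natDegree =
      Module.finrank (IntermediateField.adjoin k {x}) L := by
  have hx : IsIntegral k x := .of_finite k x
  rw [← IntermediateField.adjoin.finrank hx,
    ← Module.finrank_mul_finrank k (IntermediateField.adjoin k {x}) L,
    Nat.mul_div_cancel_left _ Module.finrank_pos]

end PowerSums

/-! ### The Hasse–Davenport lifting and product relations via L-series. -/

section HasseDavenport

variable {k : Type*} [Field k] {E : Type*} [Field E]

/-- The function `χ (e_d) θ (p_b)` of the roots of a monic polynomial of degree `d`, where `e_d`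
is their product and `p_b` the sum of their `b`-th powers. -/
def charWeight (χ : MulChar k E) (θ : AddChar k E) (b : ℕ) (g : k[X]) : E :=
  χ ((-1) ^ g.natDegree * g.coeff 0) * θ (powSum b g)

theorem isMonicMul_charWeight (χ : MulChar k E) (θ : AddChar k E) (b : ℕ) :
    IsMonicMul (charWeight χ θ b) where
  map_one := by simp [charWeight, powSum_one]
  map_mul f g hf hg := by
    rw [charWeight, charWeight, charWeight, powSum_mul b hf hg, hf.natDegree_mul hg,
      mul_coeff_zero, AddChar.map_add_eq_mul, pow_add,
      show (-1 : k) ^ f.natDegree * (-1) ^ g.natDegree * (f.coeff 0 * g.coeff 0) =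
        ((-1) ^ f.natDegree * f.coeff 0) * ((-1) ^ g.natDegree * g.coeff 0) by ring, map_mul]
    ring

theorem sum_eq_sum_units [Fintype k] [Fintype kˣ] {M : Type*} [AddCommMonoid M] {f : k → M}
    (h0 : f 0 = 0) : ∑ x, f x = ∑ u : kˣ, f u := by
  symm
  refine Finset.sum_of_injOn (fun u : kˣ => (u : k)) Units.val_injective.injOn
    (fun _ _ => Finset.mem_univ _) (fun x _ hx => ?_) (fun _ _ => rfl)
  by_cases h : x = 0
  · rw [h, h0]
  · exact absurd ⟨Units.mk0 x h, by simp⟩ hx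

/-- Summation over the fibres of the `b`-th power map of a finite cyclic group, detected by a
character whose order is `b`. -/
theorem sum_comp_pow_eq {H : Type*} [CommGroup H] [Fintype H] [IsCyclic H] {b : ℕ}
    (ψ : H →* Eˣ) (hψ : orderOf ψ = b) (f : H → E) :
    ∑ y : H, f (y ^ b) = ∑ x : H, f x * ∑ i ∈ Finset.range b, (ψ x : E) ^ i := by
  classical
  obtain ⟨g, hg⟩ := IsCyclic.exists_generator (α := H)
  have hψpow : ∀ x, ψ x ^ b = 1 := fun x => by
    rw [← MonoidHom.pow_apply, ← hψ, pow_orderOf_eq_one, MonoidHom.one_apply]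
  have hord : ∀ j : ℕ, ψ g ^ j = 1 → b ∣ j := by
    intro j hj
    rw [← hψ]
    apply orderOf_dvd_of_pow_eq_one
    ext x
    obtain ⟨a, rfl⟩ := Subgroup.mem_zpowers_iff.1 (hg x)
    have : ψ (g ^ a) ^ j = 1 := by rw [map_zpow, ← zpow_natCast, zpow_comm, zpow_natCast, hj, one_zpow]
    rw [MonoidHom.pow_apply, this, MonoidHom.one_apply]
  have hbc : b ∣ Fintype.card H := hord _ (by rw [← map_pow, pow_card_eq_one, map_one])
  have hrange : ∀ x, ψ x = 1 ↔ ∃ y : H, y ^ b = x := by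
    intro x
    constructor
    · intro hx
      obtain ⟨a, rfl⟩ := (mem_powers_iff_mem_zpowers.2 (hg x))
      obtain ⟨c, rfl⟩ := hord a (by rw [← map_pow]; exact hx)
      exact ⟨g ^ c, by rw [← pow_mul, mul_comm]⟩
    · rintro ⟨y, rfl⟩
      rw [map_pow, hψpow]
  have hfib : ∀ x : H, ((Finset.univ.filter fun y : H => y ^ b = x).card : E) =
      ∑ i ∈ Finset.range b, (ψ x : E) ^ i := by
    intro x
    by_cases hx : ψ x = 1
    -- A non-empty fibre of y ↦ y ^ b is a coset of the b-torsion, which has b elements since b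
    -- divides the order of the cyclic group.
    · obtain ⟨y, hy⟩ := (hrange x).1 hx
      have h1 := MonoidHom.card_fiber_eq_of_mem_range (powMonoidHom b : H →* H)
        (x := x) (y := 1) ⟨y, hy⟩ ⟨1, one_pow _⟩
      have h2 : (Finset.univ.filter fun y : H => y ^ b = 1).card = b := by
        have := IsCyclic.card_powMonoidHom_ker (G := H) b
        rw [Nat.card_eq_fintype_card (α := H), Nat.gcd_eq_right hbc] at this
        refine Eq.trans ?_ this
        rw [Nat.card_eq_fintype_card, Fintype.card_subtype]
        congr 1
        ext y
        simp [MonoidHom.mem_ker]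
      simp only [powMonoidHom_apply] at h1
      rw [h1, h2, hx]
      simp
    · rw [Finset.filter_eq_empty_iff.2 (fun y _ hy => hx ((hrange x).2 ⟨y, hy⟩))]
      have h1 : (ψ x : E) ≠ 1 := fun h => hx (Units.ext h)
      rw [geom_sum_eq h1, ← Units.val_pow_eq_pow_val, hψpow]
      simp
  rw [← Finset.sum_fiberwise (s := Finset.univ) (g := fun y : H => y ^ b)]
  refine Finset.sum_congr rfl fun x _ => ?_
  rw [Finset.sum_congr rfl (g := fun _ => f x) (fun y hy => by rw [(Finset.mem_filter.1 hy).2]),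
    Finset.sum_const, nsmul_eq_mul, hfib, mul_comm]

/-- The norm on units is surjective, so φ composed with the norm still has order b and its powers
count the b-th roots of a unit of L. -/
theorem sum_norm_trace_pow_eq (χ φ : MulChar k E) (θ : AddChar k E) {b : ℕ} (hb : b ≠ 0)
    (hφ : orderOf φ = b) (L : Type*) [Field L] [Fintype L] [Algebra k L] :
    ∑ x : L, (χ ^ b) (Algebra.norm k x) * θ (Algebra.trace k L (x ^ b)) =
      ∑ i ∈ Finset.range b, ∑ x : L,
        (χ * φ ^ i) (Algebra.norm k x) * θ (Algebra.trace k L x) := by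
  classical
  have hn0 : Algebra.norm k (0 : L) = 0 := Algebra.norm_zero
  rw [sum_eq_sum_units (by rw [hn0, MulChar.map_zero, zero_mul])]
  rw [Finset.sum_congr rfl (fun i _ => sum_eq_sum_units
    (f := fun x : L => (χ * φ ^ i) (Algebra.norm k x) * θ (Algebra.trace k L x))
    (by rw [hn0, MulChar.map_zero, zero_mul]))]
  set N : Lˣ →* kˣ := Units.map (Algebra.norm k)
  set ψ : Lˣ →* Eˣ := φ.toUnitHom.comp N
  have hN : Function.Surjective N := FiniteField.unitsMap_norm_surjective k L
  have hψ : orderOf ψ = b := by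
    have hinj : Function.Injective (fun h : kˣ →* Eˣ => h.comp N) := fun h h' hh =>
      (MonoidHom.cancel_right hN).1 hh
    have h1 : orderOf ψ = orderOf φ.toUnitHom := by
      rw [orderOf_eq_orderOf_iff]
      intro n
      rw [← hinj.eq_iff (a := φ.toUnitHom ^ n)]
      rfl
    rw [h1, ← hφ]
    exact orderOf_injective (MulChar.mulEquivToUnitHom (R := k) (R' := E)).toMonoidHom
      (MulChar.mulEquivToUnitHom (R := k) (R' := E)).injective φ
  have key := sum_comp_pow_eq ψ hψ
    (fun x => χ (Algebra.norm k (x : L)) * θ (Algebra.trace k L (x : L)))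
  have e1 : ∀ x : Lˣ, (χ ^ b) (Algebra.norm k (x : L)) = χ (Algebra.norm k ((x ^ b : Lˣ) : L)) := by
    intro x
    rw [MulChar.pow_apply' _ hb, Units.val_pow_eq_pow_val, map_pow, map_pow]
  simp only [e1, ← Units.val_pow_eq_pow_val]
  rw [key, Finset.sum_comm]
  refine Finset.sum_congr rfl fun x _ => ?_
  rw [Finset.mul_sum]
  refine Finset.sum_congr rfl fun i _ => ?_
  have e2 : (ψ x : E) = φ (Algebra.norm k (x : L)) := by
    simp [ψ, N]
  have e3 : (φ ^ i) (Algebra.norm k (x : L)) = φ (Algebra.norm k (x : L)) ^ i := by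
    have := MulChar.pow_apply_coe φ i (N x)
    simpa [N] using this
  rw [e2, MulChar.mul_apply, e3]
  ring

variable [Finite k]

/-- The exponent [L : k(x)] turns the constant coefficient and the power sum of the minimal
polynomial into the norm and the trace. This links the L-series with character sums over extensions.
-/
theorem mangoldtSum_charWeight (χ : MulChar k E) (θ : AddChar k E) {b : ℕ} (hb : b ≠ 0)
    (L : Type*) [Field L] [Fintype L] [Algebra k L] :
    mangoldtSum (charWeight χ θ b) (Module.finrank k L) =
      ∑ x : L, χ (Algebra.norm k x) * θ (Algebra.trace k L (x ^ b)) := by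
  rw [mangoldtSum_eq_sum]
  refine Finset.sum_congr rfl fun x _ => ?_
  rw [finrank_div_natDegree_minpoly, charWeight, mul_pow, ← map_pow, minpoly_coeff_zero_pow,
    ← AddChar.map_nsmul_eq_pow, nsmul_eq_mul, finrank_mul_powSum_minpoly hb]

theorem mangoldtSum_zero (w : k[X] → E) : mangoldtSum w 0 = 0 := by
  refine Finset.sum_eq_zero fun P hP => ?_
  rw [mem_irreds] at hP
  have := hP.2.2.natDegree_pos
  omega

theorem monicSum_zero {w : k[X] → E} (hw : IsMonicMul w) : monicSum w 0 = 1 := by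
  have : monics k 0 = {1} := by
    ext g
    rw [mem_monics, Finset.mem_singleton]
    exact ⟨fun h => eq_one_of_monic_natDegree_zero h.1 h.2, by rintro rfl; simp⟩
  rw [monicSum, this, Finset.sum_singleton, hw.map_one]

theorem monicSum_charWeight_one_one [Fintype k] (χ : MulChar k E) (θ : AddChar k E) :
    monicSum (charWeight χ θ 1) 1 = gaussSum χ θ := by
  rw [monicSum, gaussSum]
  symm
  refine Finset.sum_bij (fun a _ => X - C a) ?_ ?_ ?_ ?_
  · intro a _
    simp [monic_X_sub_C]
  · intro a _ b _ h
    simpa using h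
  · intro g hg
    rw [mem_monics] at hg
    refine ⟨-g.coeff 0, Finset.mem_univ _, ?_⟩
    conv_rhs => rw [hg.1.eq_X_add_C hg.2]
    simp
  · intro a _
    rw [charWeight, powSum_X_sub_C one_ne_zero]
    simp

/-- Adding c X^(m-1) permutes the monic polynomials of degree m, leaves the constant coefficient
alone because m ≥ 2, and multiplies every weight by θ(-c) ≠ 1. -/
theorem monicSum_charWeight_one_eq_zero (χ : MulChar k E) {θ : AddChar k E} (hθ : θ ≠ 1) {m : ℕ}
    (hm : 2 ≤ m) : monicSum (charWeight χ θ 1) m = 0 := by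
  obtain ⟨c, hc⟩ := AddChar.ne_one_iff.1 hθ
  have key : monicSum (charWeight χ θ 1) m = monicSum (charWeight χ θ 1) m * θ c := by
    rw [monicSum, Finset.sum_mul]
    have hlt : ∀ a : k, (C a * X ^ (m - 1) : k[X]).degree < m := fun a =>
      (degree_C_mul_X_pow_le _ _).trans_lt (by exact_mod_cast (by omega : m - 1 < m))
    have hmem : ∀ (a : k) (g : k[X]), g ∈ monics k m → g + C a * X ^ (m - 1) ∈ monics k m := by
      intro a g hg
      rw [mem_monics] at hg ⊢
      have h1 : (C a * X ^ (m - 1) : k[X]).degree < g.degree := by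
        rw [degree_eq_natDegree hg.1.ne_zero, hg.2]
        exact hlt a
      exact ⟨hg.1.add_of_left h1, by rw [natDegree_add_eq_left_of_degree_lt h1, hg.2]⟩
    refine Finset.sum_bij' (fun g _ => g + C c * X ^ (m - 1))
      (fun g _ => g + C (-c) * X ^ (m - 1)) (fun g hg => hmem c g hg)
      (fun g hg => hmem (-c) g hg) (fun g _ => by simp) (fun g _ => by simp) ?_
    intro g hg
    have hg' := hmem c g hg
    rw [mem_monics] at hg hg'
    rw [charWeight, charWeight, powSum_eq_neg_nextCoeff hg.1, powSum_eq_neg_nextCoeff hg'.1, hg.2,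
      hg'.2, nextCoeff_of_natDegree_pos (by omega), nextCoeff_of_natDegree_pos (by omega), hg.2,
      hg'.2, coeff_add, coeff_add, coeff_C_mul, coeff_C_mul, coeff_X_pow_self, coeff_X_pow,
      if_neg (by omega), mul_assoc, ← AddChar.map_add_eq_mul]
    congr 2 <;> ring_nf
  have : monicSum (charWeight χ θ 1) m * (θ c - 1) = 0 := by linear_combination -key
  exact (mul_eq_zero.1 this).resolve_right (sub_ne_zero.2 hc)

/-- The Hasse–Davenport lifting relation. -/
theorem neg_sum_norm_trace_eq [Fintype k] (χ : MulChar k E) {θ : AddChar k E} (hθ : θ ≠ 1)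
    (L : Type*) [Field L] [Fintype L] [Algebra k L] :
    -∑ x : L, χ (Algebra.norm k x) * θ (Algebra.trace k L x) =
      (-gaussSum χ θ) ^ Module.finrank k L := by
  have hw := isMonicMul_charWeight χ θ 1
  -- The L-series is 1 + gT with g the Gauss sum, so the recursion `natCast_mul_monicSum` reduces to
  -- Λ_{m+2} = -g Λ_{m+1}.
  have key : ∀ m, -mangoldtSum (charWeight χ θ 1) (m + 1) = (-gaussSum χ θ) ^ (m + 1) := by
    intro m
    induction m with
    | zero =>
      have := natCast_mul_monicSum hw 1
      rw [monicSum_charWeight_one_one] at this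
      simp only [Nat.cast_one, one_mul, Finset.Icc_self, Finset.sum_singleton, Nat.sub_self,
        monicSum_zero hw, mul_one] at this
      simp [← this]
    | succ m ih =>
      have := natCast_mul_monicSum hw (m + 2)
      rw [monicSum_charWeight_one_eq_zero χ hθ (by omega), mul_zero,
        Finset.sum_Icc_succ_top (by omega), Finset.sum_Icc_succ_top (by omega),
        Finset.sum_eq_zero (fun j hj => by
          rw [Finset.mem_Icc] at hj
          rw [monicSum_charWeight_one_eq_zero χ hθ (by omega), mul_zero]),
        Nat.sub_self, monicSum_zero hw, show m + 1 + 1 - (m + 1) = 1 by omega,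
        monicSum_charWeight_one_one] at this
      rw [pow_succ, ← ih]
      linear_combination this
  obtain ⟨m, hm⟩ := Nat.exists_eq_succ_of_ne_zero (Module.finrank_pos (R := k) (M := L)).ne'
  have := mangoldtSum_charWeight χ θ one_ne_zero L
  simp only [pow_one] at this
  rw [← this, hm]
  exact key m

/-- The generating series of `monicSum w`. -/
def monicSeries (w : k[X] → E) : PowerSeries E := PowerSeries.mk (monicSum w)

theorem X_mul_derivative_monicSeries {w : k[X] → E} (hw : IsMonicMul w) :
    PowerSeries.X * PowerSeries.derivative E (monicSeries w) =
      monicSeries w * PowerSeries.mk (mangoldtSum w) := by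
  ext n
  have h1 : PowerSeries.coeff n (PowerSeries.X * PowerSeries.derivative E (monicSeries w)) =
      n * monicSum w n := by
    rcases n with _ | n
    · simp
    · rw [PowerSeries.coeff_succ_X_mul, PowerSeries.coeff_derivative, monicSeries,
        PowerSeries.coeff_mk]
      push_cast
      ring
  rw [h1, natCast_mul_monicSum hw, mul_comm, PowerSeries.coeff_mul,
    Finset.Nat.sum_antidiagonal_eq_sum_range_succ_mk, Finset.sum_range_eq_add_Ico _ (by omega)]
  simp only [PowerSeries.coeff_mk, mangoldtSum_zero, zero_mul, zero_add, monicSeries]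
  rfl

/-- With equal logarithmic derivatives, P/Q has derivative zero, hence is constant in characteristic
zero. -/
theorem eq_of_X_mul_derivative_eq [CharZero E] {P Q S : PowerSeries E}
    (hP : PowerSeries.X * PowerSeries.derivative E P = P * S)
    (hQ : PowerSeries.X * PowerSeries.derivative E Q = Q * S)
    (hP0 : PowerSeries.constantCoeff P = 1) (hQ0 : PowerSeries.constantCoeff Q = 1) : P = Q := by
  have hQQ : Q * Q⁻¹ = 1 := PowerSeries.mul_inv_cancel _ (by rw [hQ0]; exact one_ne_zero)
  have h : PowerSeries.derivative E (P * Q⁻¹) = PowerSeries.derivative E 1 := by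
    have hX : (PowerSeries.X : PowerSeries E) ≠ 0 := PowerSeries.X_ne_zero
    apply mul_left_cancel₀ hX
    rw [Derivation.leibniz, PowerSeries.derivative_inv', PowerSeries.derivative_one, smul_eq_mul,
      smul_eq_mul]
    linear_combination (-P * Q⁻¹ ^ 2) * hQ + Q⁻¹ * hP - P * S * Q⁻¹ * hQQ
  have h2 : P * Q⁻¹ = 1 := PowerSeries.derivative.ext h (by simp [hP0, hQ0])
  calc P = P * Q⁻¹ * Q := by rw [mul_assoc, mul_comm Q⁻¹, hQQ, mul_one]
    _ = Q := by rw [h2, one_mul]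

theorem monicSeries_charWeight_one [Fintype k] (χ : MulChar k E) {θ : AddChar k E} (hθ : θ ≠ 1) :
    monicSeries (charWeight χ θ 1) = 1 + PowerSeries.C (gaussSum χ θ) * PowerSeries.X := by
  ext n
  rw [monicSeries, PowerSeries.coeff_mk, map_add, PowerSeries.coeff_C_mul]
  rcases n with _ | _ | n
  · simp [monicSum_zero (isMonicMul_charWeight χ θ 1)]
  · simp [monicSum_charWeight_one_one, PowerSeries.coeff_one]
  · rw [monicSum_charWeight_one_eq_zero χ hθ (by omega)]
    simp [PowerSeries.coeff_one, PowerSeries.coeff_X]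

theorem X_mul_derivative_prod {ι : Type*} (s : Finset ι) (P S : ι → PowerSeries E)
    (h : ∀ i ∈ s, PowerSeries.X * PowerSeries.derivative E (P i) = P i * S i) :
    PowerSeries.X * PowerSeries.derivative E (∏ i ∈ s, P i) =
      (∏ i ∈ s, P i) * ∑ i ∈ s, S i := by
  classical
  induction s using Finset.induction_on with
  | empty => simp
  | insert a s ha ih =>
    rw [Finset.prod_insert ha, Finset.sum_insert ha, Derivation.leibniz, smul_eq_mul, smul_eq_mul]
    linear_combination P a * ih (fun i hi => h i (Finset.mem_insert_of_mem hi)) +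
      (∏ i ∈ s, P i) * h a (Finset.mem_insert_self _ _)

theorem coeff_prod_one_add_C_mul_X (b : ℕ) (a : ℕ → E) :
    PowerSeries.coeff b (∏ i ∈ Finset.range b, (1 + PowerSeries.C (a i) * PowerSeries.X)) =
      ∏ i ∈ Finset.range b, a i := by
  have h : ∀ n, ∀ m, n < m → PowerSeries.coeff m
      (∏ i ∈ Finset.range n, (1 + PowerSeries.C (a i) * PowerSeries.X)) = 0 := by
    intro n
    induction n with
    | zero => intro m hm; simp [PowerSeries.coeff_one, hm.ne']
    | succ n ih =>
      intro m hm
      obtain ⟨m, rfl⟩ := Nat.exists_eq_succ_of_ne_zero (by omega : m ≠ 0)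
      rw [Finset.prod_range_succ, mul_add, mul_one, map_add, ih _ (by omega), ← mul_assoc,
        Nat.succ_eq_add_one, PowerSeries.coeff_succ_mul_X, PowerSeries.coeff_mul_C,
        ih _ (by omega)]
      simp
  induction b with
  | zero => simp
  | succ n ih =>
    rw [Finset.prod_range_succ, mul_add, mul_one, map_add, h n _ (by omega), ← mul_assoc,
      PowerSeries.coeff_succ_mul_X, PowerSeries.coeff_mul_C, ih, Finset.prod_range_succ, zero_add]

theorem exists_field_finrank_eq (k : Type*) [Field k] [Finite k] {j : ℕ} (hj : j ≠ 0) :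
    ∃ (L : Type) (_ : Field L) (_ : Fintype L) (_ : Algebra k L), Module.finrank k L = j := by
  obtain ⟨p, hp⟩ := CharP.exists k
  have := NeZero.mk hj
  have : Fact p.Prime := ⟨CharP.char_is_prime k p⟩
  exact ⟨FiniteField.Extension k p j, inferInstance, Fintype.ofFinite _, inferInstance,
    FiniteField.finrank_extension k p j⟩

/-- Compare logarithmic derivatives: their coefficients of index j > 0 are sums over the extension
of degree j, where `sum_norm_trace_pow_eq` identifies the two sides. -/
theorem monicSeries_charWeight_eq_prod [CharZero E] (χ φ : MulChar k E) {θ : AddChar k E}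
    {b : ℕ} (hb : b ≠ 0) (hφ : orderOf φ = b) :
    monicSeries (charWeight (χ ^ b) θ b) =
      ∏ i ∈ Finset.range b, monicSeries (charWeight (χ * φ ^ i) θ 1) := by
  refine eq_of_X_mul_derivative_eq
    (X_mul_derivative_monicSeries (isMonicMul_charWeight (χ ^ b) θ b)) (S :=
      PowerSeries.mk (mangoldtSum (charWeight (χ ^ b) θ b))) ?_ ?_ ?_
  · rw [X_mul_derivative_prod _ _ (fun i => PowerSeries.mk (mangoldtSum (charWeight (χ * φ ^ i) θ 1)))
      (fun i _ => X_mul_derivative_monicSeries (isMonicMul_charWeight _ _ _))]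
    congr 1
    ext j
    rw [map_sum, PowerSeries.coeff_mk]
    simp only [PowerSeries.coeff_mk]
    rcases eq_or_ne j 0 with rfl | hj
    · simp [mangoldtSum_zero]
    · obtain ⟨L, _, _, _, rfl⟩ := exists_field_finrank_eq k hj
      rw [mangoldtSum_charWeight _ _ hb, sum_norm_trace_pow_eq χ φ θ hb hφ]
      refine Finset.sum_congr rfl fun i _ => ?_
      rw [mangoldtSum_charWeight _ _ one_ne_zero]
      simp
  · simp [monicSeries, ← PowerSeries.coeff_zero_eq_constantCoeff_apply,
      monicSum_zero (isMonicMul_charWeight (χ ^ b) θ b)]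
  · rw [map_prod]
    refine Finset.prod_eq_one fun i _ => ?_
    simp [monicSeries, ← PowerSeries.coeff_zero_eq_constantCoeff_apply,
      monicSum_zero (isMonicMul_charWeight (χ * φ ^ i) θ 1)]

open Classical in
-- Write a monic polynomial of degree b as h + a with h(0) = 0. Then χ sees only a, and by
-- `powSum_add_C` the power sum is that of h minus b a, so the sum factors.
theorem monicSum_charWeight_self [Fintype k] (χ : MulChar k E) (θ : AddChar k E) {b : ℕ} (hb : b ≠ 0) :
    monicSum (charWeight χ θ b) b =
      (∑ g ∈ (monics k b).filter (fun g => g.coeff 0 = 0), θ (powSum b g)) *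
        ∑ a : k, χ ((-1) ^ b * a) * θ (-(b * a)) := by
  rw [monicSum, Finset.sum_mul_sum, ← Finset.sum_product']
  symm
  have hmem : ∀ (a : k) (g : k[X]), g ∈ monics k b → g + C a ∈ monics k b := by
    intro a g hg
    rw [mem_monics] at hg ⊢
    have h1 : (C a : k[X]).degree < g.degree := by
      refine degree_C_le.trans_lt ?_
      rw [degree_eq_natDegree hg.1.ne_zero, hg.2]
      exact_mod_cast Nat.pos_of_ne_zero hb
    exact ⟨hg.1.add_of_left h1, by rw [natDegree_add_eq_left_of_degree_lt h1, hg.2]⟩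
  refine Finset.sum_bij' (fun x _ => x.1 + C x.2) (fun g _ => (g + C (-g.coeff 0), g.coeff 0))
    ?_ ?_ ?_ ?_ ?_
  · rintro ⟨g, a⟩ hg
    simp only [Finset.mem_product, Finset.mem_filter, Finset.mem_univ, and_true] at hg
    exact hmem a g hg.1
  · intro g hg
    simp only [Finset.mem_product, Finset.mem_filter, Finset.mem_univ, and_true]
    exact ⟨hmem _ g hg, by simp⟩
  · rintro ⟨g, a⟩ hg
    simp only [Finset.mem_product, Finset.mem_filter, Finset.mem_univ, and_true] at hg
    simp [hg.2]
  · intro g _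
    simp
  · rintro ⟨g, a⟩ hg
    simp only [Finset.mem_product, Finset.mem_filter, Finset.mem_univ, and_true] at hg
    have h1 := mem_monics.1 (hmem a g hg.1)
    have h2 := mem_monics.1 hg.1
    simp only
    rw [charWeight, powSum_add_C hb h2.1 h2.2, h1.2, coeff_add, hg.2, zero_add, coeff_C_zero,
      sub_eq_add_neg, AddChar.map_add_eq_mul]
    ring

end HasseDavenport

/-- The Hasse–Davenport product relation. -/
theorem prod_gaussSum_mul_pow {k E : Type*} [Field k] [Field E] [Fintype k] [CharZero E] (χ φ : MulChar k E) {θ : AddChar k E}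
    (hθ : θ ≠ 1) {b : ℕ} (hb : (b : k) ≠ 0) (hφ : orderOf φ = b) :
    (χ ^ b) (b : k) * ∏ i ∈ Finset.range b, gaussSum (χ * φ ^ i) θ =
      gaussSum (χ ^ b) θ * ∏ i ∈ Finset.Ico 1 b, gaussSum (φ ^ i) θ := by
  classical
  have hb0 : b ≠ 0 := by rintro rfl; simp at hb
  set S := ∑ g ∈ (monics k b).filter (fun g => g.coeff 0 = 0), θ (powSum b g) with hS
  -- Compare the coefficients of index b in the factorisation of the L-series. The factor S does not
  -- involve χ, so it can be found from the case χ = 1.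
  have key : ∀ χ : MulChar k E, (χ ^ b) (b : k) * ∏ i ∈ Finset.range b, gaussSum (χ * φ ^ i) θ =
      S * gaussSum (χ ^ b) θ := by
    intro χ
    have h1 := congrArg (PowerSeries.coeff b)
      (monicSeries_charWeight_eq_prod χ φ (θ := θ) hb0 hφ)
    simp only [monicSeries_charWeight_one _ hθ] at h1
    rw [coeff_prod_one_add_C_mul_X, monicSeries, PowerSeries.coeff_mk,
      monicSum_charWeight_self _ _ hb0, ← hS] at h1
    rw [← h1]
    have h2 : ∑ a : k, (χ ^ b) (b : k) * ((χ ^ b) ((-1) ^ b * a) * θ (-(b * a))) =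
        gaussSum (χ ^ b) θ := by
      rw [gaussSum]
      refine Fintype.sum_equiv ((Equiv.neg k).trans (Equiv.mulLeft₀ (b : k) hb)) _ _ fun a => ?_
      simp only [Equiv.trans_apply, Equiv.neg_apply, Equiv.mulLeft₀_apply]
      rw [← mul_assoc, ← map_mul]
      congr 1
      · rw [MulChar.pow_apply' _ hb0, MulChar.pow_apply' _ hb0, ← map_pow, ← map_pow]
        congr 1
        rw [mul_pow, mul_pow, mul_pow, neg_pow a b, ← pow_mul]
        rcases Nat.even_or_odd b with h | h
        · rw [h.neg_one_pow, (h.mul_right b).neg_one_pow]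
        · rw [h.neg_one_pow, (h.mul h).neg_one_pow]
      · rw [mul_neg]
    rw [← h2, ← Finset.mul_sum]
    ring
  have hS1 : S = ∏ i ∈ Finset.Ico 1 b, gaussSum (φ ^ i) θ := by
    have h1 := key 1
    rw [one_pow, gaussSum_one_left hθ, MulChar.one_apply (Ne.isUnit hb), one_mul,
      Finset.prod_range_eq_mul_Ico _ (Nat.pos_of_ne_zero hb0), pow_zero, one_mul,
      gaussSum_one_left hθ] at h1
    simp only [one_mul] at h1
    linear_combination h1
  rw [key, hS1, mul_comm]

end MonomialDeformation
end

noncomputable section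
namespace MonomialDeformation

/-! ### The shape of the monomials forced by smoothness of X_0. -/

section Smoothness

variable {F : Type u} [Field F] {n : ℕ}

theorem aeval_deformedPoly (c : Fin (n + 1) → Fˣ) (A : Matrix (Fin (n + 1)) (Fin (n + 1)) ℕ)
    (lam : F) {K : Type*} [Field K] [Algebra F K] (x : Fin (n + 1) → K) :
    MvPolynomial.aeval x (deformedPoly c A lam) =
      ∑ i, algebraMap F K (c i) * ∏ j, x j ^ A j i - algebraMap F K lam * ∏ j, x j := by
  simp [deformedPoly]

/-- Consider the j-th coordinate point. Unless a pure power of T_j occurs, it lies on X_0, and a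
partial derivative with respect to T_k is non-zero there only if a monomial T_j^n T_k occurs. -/
theorem exists_column_of_isSmooth {c : Fin (n + 1) → Fˣ}
    {A : Matrix (Fin (n + 1)) (Fin (n + 1)) ℕ} (hdeg : ∀ i, ∑ j, A j i = n + 1)
    (hX₀ : IsSmoothHypersurface (deformedPoly c A 0)) (j : Fin (n + 1)) :
    ∃ i k, ∀ j', A j' i = (if j' = j then n else 0) + (if j' = k then 1 else 0) := by
  by_cases hex : ∃ i, ∀ j', j' ≠ j → A j' i = 0
  · obtain ⟨i, hi⟩ := hex
    refine ⟨i, j, fun j' => ?_⟩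
    split_ifs with h
    · rw [← hdeg i, Finset.sum_eq_single j (fun b _ hb => hi b hb) (by simp), h]
    · rw [hi j' h]
  · push Not at hex
    obtain ⟨k, hk⟩ := hX₀ (Pi.single j 1) (by simp) (by
      rw [aeval_deformedPoly, map_zero, zero_mul, sub_zero]
      refine Finset.sum_eq_zero fun i _ => ?_
      obtain ⟨j', hj', hA⟩ := hex i
      rw [Finset.prod_eq_zero (Finset.mem_univ j') (by simp [Pi.single_eq_of_ne hj', hA]),
        mul_zero])
    have hP : deformedPoly c A (0 : F) = ∑ i, MvPolynomial.monomial
        (Finsupp.equivFunOnFinite.symm fun j => A j i) (c i : F) := by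
      rw [deformedPoly, map_zero, zero_mul, sub_zero]
      refine Finset.sum_congr rfl fun i _ => ?_
      rw [MvPolynomial.monomial_eq, Finsupp.prod_fintype _ _ (by simp)]
      rfl
    rw [hP, map_sum, map_sum] at hk
    obtain ⟨i, -, hi⟩ := Finset.exists_ne_zero_of_sum_ne_zero hk
    rw [MvPolynomial.pderiv_monomial, MvPolynomial.aeval_monomial] at hi
    have h1 : A k i ≠ 0 := by
      intro h
      apply hi
      simp [h]
    have h2 : ∀ j', j' ≠ j → A j' i - (if j' = k then 1 else 0) = 0 := by
      intro j' hj'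
      by_contra h
      apply hi
      rw [Finsupp.prod_fintype _ _ (by simp), Finset.prod_eq_zero (Finset.mem_univ j'), mul_zero]
      rw [Pi.single_eq_of_ne hj', zero_pow]
      simpa [Finsupp.single_apply, eq_comm] using h
    obtain ⟨j', hj', hA⟩ := hex i
    have hj'k : j' = k := by
      by_contra h
      have := h2 j' hj'
      rw [if_neg h] at this
      omega
    subst hj'k
    have hA1 : A j' i = 1 := by
      have := h2 j' hj'
      rw [if_pos rfl] at this
      omega
    have hAn : A j i = n := by
      have hs := hdeg i
      rw [← Finset.add_sum_erase _ _ (Finset.mem_univ j),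
        Finset.sum_eq_single j' (fun b hb hbj => by
          have := h2 b (Finset.ne_of_mem_erase hb)
          rwa [if_neg hbj] at this) (fun h => absurd (by simpa using hj') h), hA1] at hs
      omega
    refine ⟨i, j', fun l => ?_⟩
    by_cases hl : l = j
    · subst hl
      rw [if_pos rfl, if_neg hj'.symm, hAn, add_zero]
    · rw [if_neg hl]
      split_ifs with h
      · rw [h, hA1]
      · have := h2 l hl
        rwa [if_neg h] at this

/-- Up to a permutation `σ` of its columns, `A` is the exponent matrix of `∑ⱼ Tⱼ ^ n T_{f j}`
and `f` is injective outside its fixed points. -/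
structure IsChainLoop (A : Matrix (Fin (n + 1)) (Fin (n + 1)) ℕ)
    (σ : Equiv.Perm (Fin (n + 1))) (f : Fin (n + 1) → Fin (n + 1)) : Prop where
  apply_eq : ∀ j j', A j' (σ j) = (if j' = j then n else 0) + (if j' = f j then 1 else 0)
  inj : ∀ i k, f i = f k → f i ≠ i → f k ≠ k → i = k

/-- Two monomials T_i^n T_m and T_k^n T_m with i ≠ k both different from m would make X_0 singular.
On the line where only x_i and x_k may be non-zero, all partial derivatives vanish except the one
for T_m, which is c x_i^n + c' x_k^n and has a zero over the algebraic closure. -/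
theorem exists_isChainLoop (hn : 2 ≤ n) {c : Fin (n + 1) → Fˣ}
    {A : Matrix (Fin (n + 1)) (Fin (n + 1)) ℕ} (hdeg : ∀ i, ∑ j, A j i = n + 1)
    (hX₀ : IsSmoothHypersurface (deformedPoly c A 0)) :
    ∃ σ f, IsChainLoop A σ f := by
  choose σ f hA using exists_column_of_isSmooth hdeg hX₀
  -- The exponent of T_j is at least n ≥ 2 in the column of j but at most 1 in the column of any k ≠
  -- j.
  have hσ : Function.Injective σ := by
    intro j k hjk
    by_contra hne
    have h1 := hA k j
    rw [← hjk, hA j j, if_pos rfl, if_neg hne] at h1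
    split_ifs at h1 <;> omega
  have hbij : Function.Bijective σ := Finite.injective_iff_bijective.1 hσ
  refine ⟨Equiv.ofBijective σ hbij, f, ⟨hA, ?_⟩⟩
  intro i k hik hi hk
  by_contra hne
  set m := f i with hm
  obtain ⟨y, hy⟩ := IsAlgClosed.exists_pow_nat_eq
    (-(algebraMap F (AlgebraicClosure F) (c (σ k)) / algebraMap F (AlgebraicClosure F) (c (σ i))))
    (by omega : 0 < n)
  have hci : algebraMap F (AlgebraicClosure F) (c (σ i)) ≠ 0 := by simp
  set x : Fin (n + 1) → AlgebraicClosure F := Function.update (Pi.single k 1) i y with hx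
  have hxi : x i = y := by simp [hx]
  have hxk : x k = 1 := by simp [hx, Function.update_of_ne (Ne.symm hne)]
  have hx0 : ∀ l, l ≠ i → l ≠ k → x l = 0 := by
    intro l h1 h2
    simp [hx, Function.update_of_ne h1, h2]
  have hxm : x m = 0 := hx0 m hi (by rw [hik]; exact hk)
  have hxf : ∀ l, x l = 0 ∨ x (f l) = 0 := by
    intro l
    by_cases h1 : l = i
    · right; rw [h1, ← hm, hxm]
    by_cases h2 : l = k
    · right; rw [h2, ← hik, hxm]
    exact Or.inl (hx0 l h1 h2)
  have hP : deformedPoly c A (0 : F) = ∑ l, MvPolynomial.C (c (σ l) : F) *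
      (MvPolynomial.X l ^ n * MvPolynomial.X (f l)) := by
    rw [deformedPoly, map_zero, zero_mul, sub_zero]
    refine (Fintype.sum_equiv (Equiv.ofBijective σ hbij) _ _ fun l => ?_).symm
    rw [Equiv.ofBijective_apply]
    congr 1
    simp only [hA, pow_add, Finset.prod_mul_distrib]
    congr 1
    · rw [Finset.prod_eq_single l (fun b _ hb => by simp [hb]) (by simp), if_pos rfl]
    · rw [Finset.prod_eq_single (f l) (fun b _ hb => by simp [hb]) (by simp), if_pos rfl, pow_one]
  obtain ⟨p, hp⟩ := hX₀ x (fun h => one_ne_zero (hxk.symm.trans (congrFun h k))) (by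
    rw [hP, map_sum]
    refine Finset.sum_eq_zero fun l _ => ?_
    have hn0 : n ≠ 0 := by omega
    rcases hxf l with h | h <;> simp [h, hn0])
  apply hp
  rw [hP, map_sum, map_sum]
  have hterm : ∀ l, MvPolynomial.aeval x (MvPolynomial.pderiv p (MvPolynomial.C (c (σ l) : F) *
      (MvPolynomial.X l ^ n * MvPolynomial.X (f l)))) =
      if f l = p then algebraMap F (AlgebraicClosure F) (c (σ l)) * x l ^ n else 0 := by
    intro l
    rw [MvPolynomial.pderiv_C_mul, Derivation.leibniz, Derivation.leibniz_pow]
    simp only [smul_eq_mul, map_mul, map_add, map_pow, MvPolynomial.aeval_X, nsmul_eq_mul,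
      MvPolynomial.pderiv_X, map_natCast, Pi.single_apply, apply_ite (MvPolynomial.aeval x),
      map_one, map_zero, MvPolynomial.aeval_C]
    have h0 : x (f l) * ((n : AlgebraicClosure F) * (x l ^ (n - 1) *
        if l = p then 1 else 0)) = 0 := by
      rcases hxf l with h | h
      · rw [h, zero_pow (by omega)]; ring
      · rw [h]; ring
    rw [h0, add_zero]
    split_ifs <;> simp
  simp only [hterm]
  by_cases hpm : p = m
  · rw [← Finset.sum_subset (Finset.subset_univ {i, k}) (fun l _ hl => by
      simp only [Finset.mem_insert, Finset.mem_singleton, not_or] at hl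
      rw [hx0 l hl.1 hl.2, zero_pow (by omega), mul_zero, ite_self]), Finset.sum_pair hne,
      if_pos hpm.symm, if_pos (hik.symm.trans hpm.symm), hxi, hxk, hy, one_pow]
    field_simp
    ring
  · refine Finset.sum_eq_zero fun l _ => ?_
    split_ifs with h
    · rw [hx0 l, zero_pow (by omega), mul_zero]
      · rintro rfl; exact hpm h.symm
      · rintro rfl; exact hpm (h.symm.trans hik.symm)
    · rfl

end Smoothness

/-! ### Inequalities, determinant and positivity for the exponent matrix. -/

section ExponentMatrix

variable {n : ℕ} {A : Matrix (Fin (n + 1)) (Fin (n + 1)) ℕ} {σ : Equiv.Perm (Fin (n + 1))}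
  {f : Fin (n + 1) → Fin (n + 1)}

theorem mem_monomialsIn {J : Finset (Fin (n + 1))} {i : Fin (n + 1)} :
    i ∈ monomialsIn A J ↔ ∀ j, j ∉ J → A j i = 0 := by
  simp [monomialsIn]

theorem IsChainLoop.monomialsIn_eq (h : IsChainLoop A σ f) (hn : 2 ≤ n)
    (J : Finset (Fin (n + 1))) :
    monomialsIn A J = (J.filter fun l => f l ∈ J).map σ.toEmbedding := by
  ext i
  obtain ⟨l, rfl⟩ := σ.surjective i
  rw [mem_monomialsIn]
  simp only [Finset.mem_map_equiv, Equiv.symm_apply_apply, Finset.mem_filter, h.apply_eq,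
    Nat.add_eq_zero_iff, ite_eq_right_iff]
  constructor
  · intro hl
    constructor
    · by_contra hj
      have := (hl l hj).1 rfl
      omega
    · by_contra hj
      have := (hl (f l) hj).2 rfl
      omega
  · rintro ⟨h1, h2⟩ j hj
    constructor
    · rintro rfl; exact absurd h1 hj
    · rintro rfl; exact absurd h2 hj

theorem IsChainLoop.card_monomialsIn_le (h : IsChainLoop A σ f) (hn : 2 ≤ n)
    (J : Finset (Fin (n + 1))) : (monomialsIn A J).card ≤ J.card := by
  rw [h.monomialsIn_eq hn, Finset.card_map]
  exact Finset.card_filter_le _ _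

/-- The difference #J - s_J counts the l ∈ J with f l ∉ J. These are not fixed points, so f maps
them injectively into the complement of J. -/
theorem IsChainLoop.two_mul_card_le (h : IsChainLoop A σ f) (hn : 2 ≤ n)
    (J : Finset (Fin (n + 1))) : 2 * J.card ≤ n + 1 + (monomialsIn A J).card := by
  rw [h.monomialsIn_eq hn, Finset.card_map]
  have h1 := Finset.card_filter_add_card_filter_not (s := J) (fun l => f l ∈ J)
  have h2 : (J.filter fun l => f l ∉ J).card ≤ Jᶜ.card := by
    refine Finset.card_le_card_of_injOn f (fun l hl => ?_) (fun i hi k hk hik => ?_)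
    · simp only [Finset.coe_filter, Set.mem_ofPred_eq] at hl
      simpa using hl.2
    · simp only [Finset.coe_filter, Set.mem_ofPred_eq] at hi hk
      exact h.inj i k hik (fun h => hi.2 (by rw [h]; exact hi.1))
        (fun h => hk.2 (by rw [h]; exact hk.1))
  have h3 := Finset.card_compl_add_card J
  rw [Fintype.card_fin] at h3
  omega

/-- After permuting columns the diagonal entries are at least n ≥ 2, and the other entries of each
column sum to at most 1: strict diagonal dominance. -/
theorem IsChainLoop.det_ne_zero (h : IsChainLoop A σ f) (hn : 2 ≤ n) :
    (A.map (Nat.cast : ℕ → ℚ)).det ≠ 0 := by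
  have h1 : ((A.map (Nat.cast : ℕ → ℚ)).submatrix id σ).det ≠ 0 := by
    refine det_ne_zero_of_sum_col_lt_diag fun k => ?_
    have hB : ∀ i, (A.map (Nat.cast : ℕ → ℚ)).submatrix id σ i k =
        (if i = k then (n : ℚ) else 0) + (if i = f k then 1 else 0) := by
      intro i
      simp only [Matrix.submatrix_apply, Matrix.map_apply, h.apply_eq, id]
      push_cast
      rfl
    simp only [hB]
    have h2 : ∑ i ∈ Finset.univ.erase k,
        ‖(if i = k then (n : ℚ) else 0) + (if i = f k then 1 else 0)‖ ≤ 1 := by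
      calc _ ≤ ∑ i ∈ Finset.univ.erase k, if i = f k then (1 : ℝ) else 0 := by
            refine Finset.sum_le_sum fun i hi => ?_
            rw [if_neg (Finset.ne_of_mem_erase hi), zero_add]
            split_ifs <;> simp
        _ ≤ ∑ i, if i = f k then (1 : ℝ) else 0 :=
            Finset.sum_le_sum_of_subset_of_nonneg (Finset.subset_univ _)
              (fun i _ _ => by split_ifs <;> norm_num)
        _ = 1 := by simp
    refine h2.trans_lt ?_
    rw [if_true]
    have hn' : (2 : ℝ) ≤ n := by exact_mod_cast hn
    split_ifs
    · have : ‖(n : ℚ) + 1‖ = (n : ℝ) + 1 := by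
        rw [← Rat.norm_cast_real, Real.norm_of_nonneg (by positivity)]
        push_cast
        rfl
      rw [this]; linarith
    · rw [add_zero, ← Rat.norm_cast_real, Real.norm_of_nonneg (by positivity), Rat.cast_natCast]
      linarith
  intro h0
  apply h1
  rw [show (A.map (Nat.cast : ℕ → ℚ)).submatrix id σ =
    ((A.map (Nat.cast : ℕ → ℚ)).submatrix id σ) from rfl, Matrix.det_permute', h0, mul_zero]

/-- By injectivity of f each row has the form (n + ε) x_j + x_l = 1 with at most one l. If the least
entry x_m were ≤ 0, its partner would satisfy x_a ≥ 1 - 2 x_m, and the partner of x_a would satisfy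
x_b ≤ 1 - 2 x_a < x_m, against minimality. -/
theorem IsChainLoop.pos_of_mulVec_eq_one (h : IsChainLoop A σ f) (hn : 2 ≤ n)
    {x : Fin (n + 1) → ℚ} (hx : ∀ j, ∑ i, (A j i : ℚ) * x i = 1) (i : Fin (n + 1)) :
    0 < x i := by
  have hn' : (2 : ℚ) ≤ n := by exact_mod_cast hn
  have hrow : ∀ j, ∃ ε : ℚ, 0 ≤ ε ∧ (((n + ε) * x (σ j) = 1) ∨
      ∃ l, (n + ε) * x (σ j) + x (σ l) = 1) := by
    intro j
    have h1 : (n : ℚ) * x (σ j) + ∑ l, (if j = f l then x (σ l) else 0) = 1 := by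
      have h0 := hx j
      rw [← Equiv.sum_comp σ] at h0
      simp only [h.apply_eq] at h0
      push_cast at h0
      simp only [add_mul, Finset.sum_add_distrib, ite_mul, zero_mul, one_mul] at h0
      rw [Finset.sum_ite_eq, if_pos (Finset.mem_univ _)] at h0
      exact h0
    by_cases hex : ∃ l, l ≠ j ∧ f l = j
    · obtain ⟨l, hl, hfl⟩ := hex
      have h2 : ∑ m ∈ Finset.univ.erase j, (if j = f m then x (σ m) else 0) = x (σ l) := by
        rw [Finset.sum_eq_single l]
        · rw [if_pos hfl.symm]
        · intro m hm hml
          rw [if_neg]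
          intro hjm
          have hmj := Finset.ne_of_mem_erase hm
          exact hml (h.inj m l (hjm.symm.trans hfl.symm) (fun h => hmj (h.symm.trans hjm.symm))
            (fun h => hl (h.symm.trans hfl)))
        · simp [hl]
      rw [← Finset.add_sum_erase _ _ (Finset.mem_univ j), h2] at h1
      refine ⟨if j = f j then 1 else 0, by split_ifs <;> norm_num, Or.inr ⟨l, ?_⟩⟩
      split_ifs at h1 ⊢ <;> linarith
    · push Not at hex
      rw [← Finset.add_sum_erase _ _ (Finset.mem_univ j), Finset.sum_eq_zero (fun m hm => by
        rw [if_neg (fun h => hex m (Finset.ne_of_mem_erase hm) h.symm)]), add_zero] at h1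
      refine ⟨if j = f j then 1 else 0, by split_ifs <;> norm_num, Or.inl ?_⟩
      split_ifs at h1 ⊢ <;> linarith
  obtain ⟨m, -, hm⟩ := Finset.exists_min_image Finset.univ (fun j => x (σ j)) ⟨0, Finset.mem_univ _⟩
  have hmin : ∀ l, x (σ m) ≤ x (σ l) := fun l => hm l (Finset.mem_univ _)
  suffices hpos : 0 < x (σ m) by
    have := hmin (σ.symm i)
    rw [Equiv.apply_symm_apply] at this
    exact hpos.trans_le this
  by_contra hneg
  push Not at hneg
  obtain ⟨ε, hε, h1 | ⟨a, h1⟩⟩ := hrow m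
  · nlinarith
  obtain ⟨ε', hε', h2 | ⟨b, h2⟩⟩ := hrow a
  · have hp : (n + ε) * x (σ m) ≤ 0 := mul_nonpos_of_nonneg_of_nonpos (by linarith) hneg
    nlinarith [mul_nonneg hε' (by linarith : (0 : ℚ) ≤ x (σ a) - 1)]
  · have hp : (n + ε) * x (σ m) ≤ 2 * x (σ m) := by nlinarith
    have ha : 1 - 2 * x (σ m) ≤ x (σ a) := by linarith
    have hp2 : 2 * x (σ a) ≤ (n + ε') * x (σ a) := by nlinarith
    have := hmin b
    linarith

end ExponentMatrix

/-! ### The integral kernel of A' and the use of elementary divisors. -/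

section Kernel

variable {n : ℕ} {A : Matrix (Fin (n + 1)) (Fin (n + 1)) ℕ}

theorem shiftedMatrix_mulVec_apply (v : Fin (n + 1) → ℤ) (j : Fin (n + 1)) :
    (shiftedMatrix A).mulVec v j = ∑ i, (A j i : ℤ) * v i - ∑ i, v i := by
  simp [Matrix.mulVec, dotProduct, shiftedMatrix, sub_mul, Finset.sum_sub_distrib]

/-- A' v = 0 means that A v is constant with value Σ v, so v = (Σ v) x for x = A⁻¹ 1. Since x is
positive, the kernel is a lattice on a positive line, generated by its positive vector with least
first coordinate. -/
theorem exists_isPosGenerator (hdeg : ∀ i, ∑ j, A j i = n + 1)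
    (hdet : (A.map (Nat.cast : ℕ → ℚ)).det ≠ 0)
    (hpos : ∀ x : Fin (n + 1) → ℚ, (∀ j, ∑ i, (A j i : ℚ) * x i = 1) → ∀ i, 0 < x i) :
    ∃ α, IsPosGenerator A α := by
  set B := A.map (Nat.cast : ℕ → ℚ) with hB
  set x : Fin (n + 1) → ℚ := B⁻¹.mulVec 1 with hx
  have hBx : B.mulVec x = 1 := by
    rw [hx, Matrix.mulVec_mulVec, Matrix.mul_nonsing_inv _ (Ne.isUnit hdet), Matrix.one_mulVec]
  have hAx : ∀ j, ∑ i, (A j i : ℚ) * x i = 1 := fun j => congrFun hBx j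
  have hxpos := hpos x hAx
  have hsum : ∑ i, x i = 1 := by
    have h1 : ∑ j, ∑ i, (A j i : ℚ) * x i = n + 1 := by
      rw [Finset.sum_congr rfl fun j _ => hAx j]; simp
    rw [Finset.sum_comm] at h1
    simp only [← Finset.sum_mul, ← Nat.cast_sum, hdeg] at h1
    rw [← Finset.mul_sum] at h1
    push_cast at h1
    have : (n : ℚ) + 1 ≠ 0 := by positivity
    exact mul_left_cancel₀ this (by rw [h1, mul_one])
  have hker : ∀ v : Fin (n + 1) → ℤ, (shiftedMatrix A).mulVec v = 0 ↔
      ∀ i, (v i : ℚ) = (∑ i, v i : ℤ) * x i := by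
    intro v
    constructor
    · intro hv
      have h0 : B.mulVec (fun i => (v i : ℚ) - (∑ i, v i : ℤ) * x i) = 0 := by
        funext j
        have h1 := congrFun hv j
        rw [shiftedMatrix_mulVec_apply, Pi.zero_apply, sub_eq_zero] at h1
        have h2 : ∑ i, (A j i : ℚ) * v i = (∑ i, v i : ℤ) := by rw [← h1]; push_cast; rfl
        simp only [Matrix.mulVec, dotProduct, hB, Matrix.map_apply, mul_sub,
          Finset.sum_sub_distrib, h2, Pi.zero_apply]
        rw [sub_eq_zero]
        calc _ = ((∑ i, v i : ℤ) : ℚ) * 1 := (mul_one _).symm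
          _ = _ := by rw [← hAx j, Finset.mul_sum]; exact Finset.sum_congr rfl fun i _ => by ring
      have := Matrix.eq_zero_of_mulVec_eq_zero hdet h0
      intro i
      exact sub_eq_zero.1 (congrFun this i)
    · intro hv
      funext j
      rw [shiftedMatrix_mulVec_apply, Pi.zero_apply, sub_eq_zero]
      have : (∑ i, (A j i : ℚ) * v i) = (∑ i, v i : ℤ) := by
        calc _ = ((∑ i, v i : ℤ) : ℚ) * ∑ i, (A j i : ℚ) * x i := by
              rw [Finset.mul_sum]
              exact Finset.sum_congr rfl fun i _ => by rw [hv i]; ring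
          _ = _ := by rw [hAx j, mul_one]
      exact_mod_cast this
  have hex : ∃ m : ℕ, ∃ w : Fin (n + 1) → ℕ, (∀ i, 0 < w i) ∧
      (shiftedMatrix A).mulVec (fun i => (w i : ℤ)) = 0 ∧ w 0 = m := by
    -- This is x multiplied by the product of all denominators.
    refine ⟨_, fun i => ((∏ l, (x l).den) / (x i).den) * (x i).num.toNat, ?_, ?_, rfl⟩
    · intro i
      have h1 : (x i).den ∣ ∏ l, (x l).den := Finset.dvd_prod_of_mem _ (Finset.mem_univ i)
      have h2 : 0 < ∏ l, (x l).den := Finset.prod_pos fun l _ => (x l).den_pos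
      have h3 : 0 < (x i).num := Rat.num_pos.2 (hxpos i)
      exact Nat.mul_pos (Nat.div_pos (Nat.le_of_dvd h2 h1) (x i).den_pos) (by omega)
    · have hw : ∀ i, ((((∏ l, (x l).den) / (x i).den) * (x i).num.toNat : ℕ) : ℚ) =
          (∏ l, (x l).den : ℕ) * x i := by
        intro i
        have h1 : (x i).den ∣ ∏ l, (x l).den := Finset.dvd_prod_of_mem _ (Finset.mem_univ i)
        have h3 : 0 < (x i).num := Rat.num_pos.2 (hxpos i)
        have h4 : (((x i).num.toNat : ℕ) : ℚ) = (x i).num := by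
          have : (((x i).num.toNat : ℕ) : ℤ) = (x i).num := Int.toNat_of_nonneg h3.le
          exact_mod_cast this
        have h5 : ((x i).den : ℚ) ≠ 0 := by exact_mod_cast (x i).den_nz
        rw [Nat.cast_mul, h4, Nat.cast_div h1 h5]
        conv_rhs => rw [← Rat.num_div_den (x i)]
        field_simp
      rw [hker]
      intro i
      have h6 : ((∑ i, (((∏ l, (x l).den) / (x i).den * (x i).num.toNat : ℕ) : ℤ) : ℤ) : ℚ) =
          (∏ l, (x l).den : ℕ) := by
        rw [Int.cast_sum, Finset.sum_congr rfl fun i _ => (Int.cast_natCast _).trans (hw i),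
          ← Finset.mul_sum, hsum, mul_one]
      rw [h6, Int.cast_natCast, hw i]
  classical
  obtain ⟨α, hα, hαker, hα0⟩ := Nat.find_spec hex
  refine ⟨α, hα, fun v => ⟨fun hv => ?_, ?_⟩⟩
  · have hα0' : (0 : ℤ) < α 0 := by exact_mod_cast hα 0
    refine ⟨v 0 / α 0, ?_⟩
    set w : Fin (n + 1) → ℤ := fun i => v i - (v 0 / α 0) * α i with hw
    have hwker : (shiftedMatrix A).mulVec w = 0 := by
      have : w = v - (v 0 / (α 0 : ℤ)) • fun i => (α i : ℤ) := by
        funext i; simp [hw]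
      rw [this, Matrix.mulVec_sub, Matrix.mulVec_smul, hv, hαker, smul_zero, sub_zero]
    have hw0 : w 0 = v 0 % α 0 := by
      rw [hw, Int.emod_def]; ring
    have hwx := (hker w).1 hwker
    have hnn : 0 ≤ w 0 := by rw [hw0]; exact Int.emod_nonneg _ hα0'.ne'
    have hwsum : w 0 = 0 := by
      by_contra hne
      have hp : 0 < w 0 := lt_of_le_of_ne hnn (Ne.symm hne)
      have hS : (0 : ℚ) < (∑ i, w i : ℤ) := by
        have h1 : (0 : ℚ) < w 0 := by exact_mod_cast hp
        rw [hwx 0] at h1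
        exact pos_of_mul_pos_left h1 (hxpos 0).le
      have hwi : ∀ i, 0 < w i := by
        intro i
        have : (0 : ℚ) < w i := by rw [hwx i]; exact mul_pos hS (hxpos i)
        exact_mod_cast this
      have hcast : ∀ i, (((w i).toNat : ℕ) : ℤ) = w i := fun i => Int.toNat_of_nonneg (hwi i).le
      refine Nat.find_min hex (m := (w 0).toNat) ?_ ⟨fun i => (w i).toNat, ?_, ?_, rfl⟩
      · have h1 : w 0 < α 0 := by rw [hw0]; exact Int.emod_lt_of_pos _ hα0'
        have := hcast 0
        rw [← hα0]
        exact_mod_cast this ▸ h1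
      · intro i
        exact Int.pos_iff_toNat_pos.1 (hwi i)
      · simp only [hcast]
        exact hwker
    have hS0 : ((∑ i, w i : ℤ) : ℚ) = 0 := by
      have := hwx 0
      rw [hwsum, Int.cast_zero, eq_comm, mul_eq_zero] at this
      exact this.resolve_right (hxpos 0).ne'
    intro i
    have h1 := hwx i
    rw [hS0, zero_mul] at h1
    have h2 : w i = 0 := by exact_mod_cast h1
    exact sub_eq_zero.1 h2
  · rintro ⟨k, hk⟩
    have : v = k • fun i => (α i : ℤ) := by
      funext i; simp [hk i]
    rw [this, Matrix.mulVec_smul, hαker, smul_zero]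

/-- Dividing the generator by the gcd of its entries gives another kernel vector, which must be a
multiple of the generator; so the gcd is 1. -/
theorem IsPosGenerator.exists_sum_mul_eq_one {α : Fin (n + 1) → ℕ} (h : IsPosGenerator A α) :
    ∃ b : Fin (n + 1) → ℤ, ∑ i, b i * (α i : ℤ) = 1 := by
  set I := Ideal.span (Set.range fun i => (α i : ℤ)) with hI
  obtain ⟨g, hg⟩ := (IsPrincipalIdealRing.principal I).principal
  have hgmem : ∀ i, ∃ β, (α i : ℤ) = g * β := fun i => by
    have : (α i : ℤ) ∈ I := Ideal.subset_span ⟨i, rfl⟩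
    rw [hg] at this
    exact Ideal.mem_span_singleton.1 this
  choose β hβ using hgmem
  have hα0 : (α 0 : ℤ) ≠ 0 := by exact_mod_cast (h.1 0).ne'
  have hg0 : g ≠ 0 := by
    rintro rfl
    exact hα0 (by rw [hβ 0, zero_mul])
  obtain ⟨k, hk⟩ := (h.2 β).1 (by
    have h1 : (shiftedMatrix A).mulVec (g • β) = 0 := by
      rw [show g • β = fun i => (α i : ℤ) by funext i; simp [hβ i]]
      exact (h.2 _).2 ⟨1, by simp⟩
    rw [Matrix.mulVec_smul] at h1
    exact (smul_eq_zero.1 h1).resolve_left hg0)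
  have hgk : g * k = 1 := by
    have := hβ 0
    rw [hk 0, ← mul_assoc] at this
    exact mul_right_cancel₀ hα0 (by rw [← this, one_mul])
  have h1 : (1 : ℤ) ∈ I := by
    rw [hg]
    exact Ideal.mem_span_singleton.2 ⟨k, hgk.symm⟩
  exact Ideal.mem_span_range_iff_exists_fun.1 h1

/-- In a Smith basis of the column lattice, m divides each a_t y_t and hence N y_t, where the y_t
are the coordinates of M v. So N M v is m times a lattice vector, and injectivity of M transfers
this to v. -/
theorem dvd_mul_of_elementaryDivisorsDvd {ι κ : Type} [Fintype ι] [Fintype κ] {M : Matrix ι κ ℤ}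
    {N : ℕ} (hM : ElementaryDivisorsDvd M N) (hinj : Function.Injective M.mulVec)
    {v : κ → ℤ} {m : ℤ} (hv : ∀ j, m ∣ M.mulVec v j) (i : κ) : m ∣ N * v i := by
  classical
  choose u hu using hv
  obtain ⟨k, S⟩ := Submodule.smithNormalForm (Pi.basisFun ℤ ι) (LinearMap.range M.mulVecLin)
  have hMv : M.mulVec v = m • u := by funext j; simp [hu j]
  set y : LinearMap.range M.mulVecLin := ⟨M.mulVec v, ⟨v, rfl⟩⟩ with hy
  have hcoef : ∀ t, m ∣ S.bN.repr y t * S.a t := by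
    intro t
    have h1 : S.bM.repr (y : ι → ℤ) (S.f t) = S.a t * S.bN.repr y t := by
      conv_lhs => rw [← S.bN.sum_repr y]
      simp only [Submodule.coe_sum, Submodule.coe_smul, S.snf, map_sum, map_smul,
        Module.Basis.repr_self, Finsupp.coe_finsetSum, Finset.sum_apply, Finsupp.smul_apply,
        smul_eq_mul, Finsupp.single_apply, S.f.injective.eq_iff]
      simp [mul_comm]
    rw [mul_comm, ← h1, hy]
    simp only [hMv, map_smul, Finsupp.smul_apply, smul_eq_mul]
    exact dvd_mul_right _ _
  have hcoefN : ∀ t, m ∣ N * S.bN.repr y t := fun t => by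
    rw [mul_comm]
    exact (hcoef t).trans (mul_dvd_mul_left _ (hM k S t))
  choose w hw using hcoefN
  obtain ⟨v', hv'⟩ := (∑ t, w t • S.bN t).2
  have hNy : (N : ℤ) • y = m • ∑ t, w t • S.bN t := by
    conv_lhs => rw [← S.bN.sum_repr y]
    rw [Finset.smul_sum, Finset.smul_sum]
    refine Finset.sum_congr rfl fun t _ => ?_
    rw [smul_smul, smul_smul, hw t]
  have heq : M.mulVec ((N : ℤ) • v) = M.mulVec (m • v') := by
    rw [Matrix.mulVec_smul, Matrix.mulVec_smul]
    have := congrArg Subtype.val hNy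
    rw [Submodule.coe_smul, Submodule.coe_smul, ← hv'] at this
    exact this
  have := congrFun (hinj heq) i
  simp only [Pi.smul_apply, smul_eq_mul] at this
  exact ⟨v' i, this⟩

theorem dvd_mul_of_dvd_mulVec {N : ℕ} (hdet : (A.map (Nat.cast : ℕ → ℚ)).det ≠ 0)
    (hdiv : ElementaryDivisorsDvd (extMatrix A Finset.univ) N)
    {v : Fin (n + 1) → ℤ} {m : ℤ} (hv : ∀ j, m ∣ ∑ i, (A j i : ℤ) * v i) (hsum : m ∣ ∑ i, v i)
    (i : Fin (n + 1)) : m ∣ N * v i := by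
  have hmem : ∀ i, i ∈ monomialsIn A Finset.univ := fun i => by simp [mem_monomialsIn]
  have hsum_eq : ∀ g : Fin (n + 1) → ℤ, ∑ i : monomialsIn A Finset.univ, g i = ∑ i, g i := by
    intro g
    rw [Finset.sum_coe_sort _ g, Finset.eq_univ_iff_forall.2 hmem]
  have hinl : ∀ (u : monomialsIn A Finset.univ → ℤ) j,
      (extMatrix A Finset.univ).mulVec u (Sum.inl j) =
        ∑ i : monomialsIn A Finset.univ, (A j i : ℤ) * u i := fun _ _ => rfl
  have hinr : ∀ (u : monomialsIn A Finset.univ → ℤ) j,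
      (extMatrix A Finset.univ).mulVec u (Sum.inr j) = ∑ i, u i := fun u j => by
    change ∑ i : monomialsIn A Finset.univ, (1 : ℤ) * u i = _
    simp
  refine dvd_mul_of_elementaryDivisorsDvd hdiv ?_ (v := fun i => v i) ?_ ⟨i, hmem i⟩
  · intro u u' huu'
    have h0 : (A.map (Nat.cast : ℕ → ℚ)).mulVec
        (fun i => (u ⟨i, hmem i⟩ : ℚ) - u' ⟨i, hmem i⟩) = 0 := by
      funext j
      have h1 := congrFun huu' (Sum.inl ⟨j, Finset.mem_univ j⟩)
      rw [hinl, hinl] at h1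
      have h2 : ∀ u : monomialsIn A Finset.univ → ℤ, ∑ i : monomialsIn A Finset.univ, (A j i : ℤ) * u i =
          ∑ i, (A j i : ℤ) * u ⟨i, hmem i⟩ := fun u => by
        rw [← hsum_eq]
      rw [h2, h2] at h1
      simp only [Matrix.mulVec, dotProduct, Matrix.map_apply, mul_sub, Finset.sum_sub_distrib,
        Pi.zero_apply, sub_eq_zero]
      exact_mod_cast h1
    have h3 := Matrix.eq_zero_of_mulVec_eq_zero hdet h0
    funext i
    have h4 := congrFun h3 i
    exact_mod_cast sub_eq_zero.1 h4
  · rintro (j | j)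
    · rw [hinl, hsum_eq fun i => (A j i : ℤ) * v i]
      exact hv j
    · rw [hinr, hsum_eq]
      exact hsum

end Kernel

theorem traceLift_apply {F : Type u} [Field F] (K : Type u) [Field K] [Algebra F K]
    (θ : AddChar F Qbar) (x : K) : traceLift K θ x = θ (Algebra.trace F K x) := rfl

/-! ### Lifting characters and Gauss sums to an extension. -/

section Lifts

variable {F : Type u} [Field F] (K : Type u) [Field K] [Fintype K] [Algebra F K]

theorem normLift_apply (χ : MulChar F Qbar) (x : K) :
    normLift K χ x = χ (Algebra.norm F x) := by
  have hfin : Finite F := Finite.of_injective _ (algebraMap F K).injective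
  by_cases hx : x = 0
  · rw [hx, MulChar.map_zero, Algebra.norm_zero, MulChar.map_zero]
  · obtain ⟨u, rfl⟩ := Ne.isUnit hx
    rw [normLift, MulChar.ofUnitHom_coe, MonoidHom.comp_apply, MulChar.coe_toUnitHom]
    rfl

/-- `normLift` as a homomorphism. -/
def normLiftHom : MulChar F Qbar →* MulChar K Qbar where
  toFun := normLift K
  map_one' := MulChar.ext fun a => by
    have hfin : Finite F := Finite.of_injective _ (algebraMap F K).injective
    rw [normLift_apply, MulChar.one_apply a.isUnit,
      MulChar.one_apply (Ne.isUnit (Algebra.norm_ne_zero_iff.2 a.ne_zero))]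
  map_mul' χ ψ := MulChar.ext fun a => by
    rw [normLift_apply, MulChar.mul_apply, MulChar.mul_apply, normLift_apply, normLift_apply]

@[simp] theorem normLiftHom_apply (χ : MulChar F Qbar) : normLiftHom K χ = normLift K χ := rfl

theorem normLift_one : normLift K (1 : MulChar F Qbar) = 1 := map_one (normLiftHom K)

theorem normLift_mul (χ ψ : MulChar F Qbar) :
    normLift K (χ * ψ) = normLift K χ * normLift K ψ := map_mul (normLiftHom K) χ ψ

theorem normLift_pow (χ : MulChar F Qbar) (m : ℕ) :
    normLift K (χ ^ m) = normLift K χ ^ m := map_pow (normLiftHom K) χ m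

theorem normLift_zpow (χ : MulChar F Qbar) (m : ℤ) :
    normLift K (χ ^ m) = normLift K χ ^ m := map_zpow (normLiftHom K) χ m

theorem normLift_inv (χ : MulChar F Qbar) :
    normLift K χ⁻¹ = (normLift K χ)⁻¹ := map_inv (normLiftHom K) χ

theorem normLiftHom_injective : Function.Injective (normLiftHom (F := F) K) := by
  have hfin : Finite F := Finite.of_injective _ (algebraMap F K).injective
  intro χ ψ h
  refine MulChar.ext fun a => ?_
  obtain ⟨x, hx⟩ := FiniteField.norm_surjective F K (a : F)
  have := congrArg (fun η : MulChar K Qbar => η x) h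
  simpa only [normLiftHom_apply, normLift_apply, hx] using this

theorem normLift_eq_one_iff {χ : MulChar F Qbar} : normLift K χ = 1 ↔ χ = 1 :=
  map_eq_one_iff (normLiftHom K) (normLiftHom_injective K)

theorem orderOf_normLift (χ : MulChar F Qbar) : orderOf (normLift K χ) = orderOf χ :=
  orderOf_injective (normLiftHom K) (normLiftHom_injective K) χ

theorem traceLift_ne_one {θ : AddChar F Qbar} (hθ : θ ≠ 1) : traceLift K θ ≠ 1 := by
  have hfin : Finite F := Finite.of_injective _ (algebraMap F K).injective
  obtain ⟨a, ha⟩ := AddChar.ne_one_iff.1 hθ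
  obtain ⟨x, rfl⟩ := Algebra.trace_surjective F K a
  exact AddChar.ne_one_iff.2 ⟨x, ha⟩

theorem G_one {θ : AddChar F Qbar} (hθ : θ ≠ 1) : G K θ 1 = -1 :=
  gaussSum_one_left (traceLift_ne_one K hθ)

/-- The Hasse–Davenport lifting relation for `G`. -/
theorem G_normLift [Fintype F] {θ : AddChar F Qbar} (hθ : θ ≠ 1) (χ : MulChar F Qbar) :
    G K θ (normLift K χ) = -(-gaussSum χ θ) ^ Module.finrank F K := by
  rw [← neg_sum_norm_trace_eq χ hθ K, neg_neg, G, gaussSum]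
  simp only [normLift_apply, traceLift_apply]

theorem G_mul_G_inv {θ : AddChar F Qbar} (hθ : θ ≠ 1) {μ : MulChar K Qbar} (hμ : μ ≠ 1) :
    G K θ μ * G K θ μ⁻¹ = μ (-1) * Fintype.card K := by
  have h1 := gaussSum_mul_gaussSum_eq_card hμ
    (AddChar.IsPrimitive.of_ne_one (traceLift_ne_one K hθ))
  have h2 := mul_gaussSum_inv_eq_gaussSum μ⁻¹ (traceLift K θ)
  have h3 : μ (-1) * μ⁻¹ (-1) = 1 := by
    rw [← MulChar.mul_apply, mul_inv_cancel, MulChar.one_apply isUnit_one.neg]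
  have h4 : μ (-1) * μ (-1) = 1 := by rw [← map_mul]; simp
  rw [G, G, ← h2, ← h1]
  have h5 : μ⁻¹ (-1) = μ (-1) := by linear_combination μ (-1) * h3 - μ⁻¹ (-1) * h4
  rw [h5]
  ring

theorem G_ne_zero {θ : AddChar F Qbar} (hθ : θ ≠ 1) (μ : MulChar K Qbar) : G K θ μ ≠ 0 := by
  by_cases hμ : μ = 1
  · rw [hμ, G_one K hθ]
    norm_num
  · intro h
    have h1 := G_mul_G_inv K hθ hμ
    rw [h, zero_mul, eq_comm, mul_eq_zero] at h1
    rcases h1 with h1 | h1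
    · exact MulChar.apply_ne_zero_iff.2 isUnit_one.neg h1
    · exact Nat.cast_ne_zero.2 Fintype.card_ne_zero h1

/-- The Hasse–Davenport product relation for `G`. -/
theorem G_pow_eq {θ : AddChar F Qbar} (hθ : θ ≠ 1) (η φ : MulChar K Qbar) {b : ℕ}
    (hb : (b : K) ≠ 0) (hφ : orderOf φ = b) :
    G K θ (η ^ b) = (η ^ b) (b : K) *
      (G K θ η * ∏ i ∈ Finset.Ico 1 b, G K θ (η * φ ^ i) / G K θ (φ ^ i)) := by
  have h := prod_gaussSum_mul_pow η φ (traceLift_ne_one K hθ) hb hφ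
  have hb0 : b ≠ 0 := by rintro rfl; simp at hb
  rw [Finset.prod_range_eq_mul_Ico _ (Nat.pos_of_ne_zero hb0), pow_zero, mul_one] at h
  have hne : ∏ i ∈ Finset.Ico 1 b, G K θ (φ ^ i) ≠ 0 :=
    Finset.prod_ne_zero_iff.2 fun i _ => G_ne_zero K hθ _
  rw [Finset.prod_div_distrib, ← mul_div_assoc, ← mul_div_assoc, eq_div_iff hne]
  exact h.symm

end Lifts

/-! ### Fourier analysis on Kˣ and on split tori. -/

section Fourier

variable {F : Type u} [Field F] (K : Type u) [Field K] [Fintype K]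

instance instFintypeMulCharQbar : Fintype (MulChar K Qbar) := Fintype.ofFinite _

instance hasEnoughRootsOfUnity_Qbar (m : ℕ) [NeZero m] : HasEnoughRootsOfUnity Qbar m :=
  inferInstance

instance neZero_exponent_units : NeZero (Monoid.exponent Kˣ) :=
  ⟨Monoid.exponent_ne_zero_of_finite⟩

instance isCyclic_mulChar : IsCyclic (MulChar K Qbar) :=
  isCyclic_of_surjective (MulChar.mulEquiv_units K Qbar).some.symm
    (MulChar.mulEquiv_units K Qbar).some.symm.surjective

theorem card_mulChar : Fintype.card (MulChar K Qbar) = Fintype.card K - 1 := by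
  classical
  rw [← Nat.card_eq_fintype_card, MulChar.card_eq_card_units_of_hasEnoughRootsOfUnity,
    Nat.card_eq_fintype_card, Fintype.card_units]

theorem cast_card_sub_one : ((Fintype.card K - 1 : ℕ) : Qbar) = (Fintype.card K : Qbar) - 1 := by
  rw [Nat.cast_sub Fintype.card_pos, Nat.cast_one]

theorem card_sub_one_ne_zero : (Fintype.card K : Qbar) - 1 ≠ 0 := by
  rw [← cast_card_sub_one, Nat.cast_ne_zero]
  have := Fintype.one_lt_card (α := K)
  omega

open Classical in
theorem sum_mulChar_apply (a : K) :
    ∑ χ : MulChar K Qbar, χ a = if a = 1 then (Fintype.card K : Qbar) - 1 else 0 := by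
  split_ifs with ha
  · rw [ha, Finset.sum_congr rfl fun χ _ => MulChar.map_one χ, Finset.sum_const, Finset.card_univ,
      card_mulChar, nsmul_eq_mul, mul_one, cast_card_sub_one]
  · obtain ⟨χ₀, hχ₀⟩ := MulChar.exists_apply_ne_one_of_hasEnoughRootsOfUnity K Qbar ha
    have h1 : χ₀ a * ∑ χ : MulChar K Qbar, χ a = ∑ χ : MulChar K Qbar, χ a := by
      rw [Finset.mul_sum]
      exact Fintype.sum_equiv (Equiv.mulLeft χ₀) _ _ fun χ => by
        rw [Equiv.coe_mulLeft, MulChar.mul_apply]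
    have h2 : (χ₀ a - 1) * ∑ χ : MulChar K Qbar, χ a = 0 := by linear_combination h1
    exact (mul_eq_zero.1 h2).resolve_left (sub_ne_zero.2 hχ₀)

open Classical in
theorem sum_units_apply (χ : MulChar K Qbar) :
    ∑ a : Kˣ, χ a = if χ = 1 then (Fintype.card K : Qbar) - 1 else 0 := by
  split_ifs with h
  · rw [h, Finset.sum_congr rfl fun a _ => MulChar.one_apply_coe a, Finset.sum_const,
      Finset.card_univ, Fintype.card_units, nsmul_eq_mul, mul_one, cast_card_sub_one]
  · rw [← sum_eq_sum_units (f := fun x => χ x) (MulChar.map_zero χ),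
      MulChar.sum_eq_zero_of_ne_one h]

theorem traceLift_fourier [Algebra F K] (θ : AddChar F Qbar) (x : Kˣ) :
    ((Fintype.card K : Qbar) - 1) * traceLift K θ x =
      ∑ χ : MulChar K Qbar, G K θ χ⁻¹ * χ x := by
  classical
  simp only [G, gaussSum]
  simp only [fun χ : MulChar K Qbar => sum_eq_sum_units (f := fun y : K => χ⁻¹ y * traceLift K θ y)
    (by rw [MulChar.map_zero, zero_mul]), Finset.sum_mul]
  rw [Finset.sum_comm]
  have h : ∀ y : Kˣ, ∑ χ : MulChar K Qbar, χ⁻¹ (y : K) * traceLift K θ (y : K) * χ (x : K) =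
      if x = y then ((Fintype.card K : Qbar) - 1) * traceLift K θ y else 0 := by
    intro y
    have h1 : ∀ χ : MulChar K Qbar, χ⁻¹ (y : K) * traceLift K θ (y : K) * χ (x : K) =
        χ ((x : K) * (y : K)⁻¹) * traceLift K θ (y : K) := fun χ => by
      rw [MulChar.inv_apply', map_mul]; ring
    rw [Finset.sum_congr rfl fun χ _ => h1 χ, ← Finset.sum_mul, sum_mulChar_apply]
    have h2 : (x : K) * (y : K)⁻¹ = 1 ↔ x = y := by
      rw [mul_inv_eq_one₀ y.ne_zero, Units.val_inj]
    simp only [h2]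
    split_ifs <;> ring
  rw [Finset.sum_congr rfl fun y _ => h y]
  simp

open Classical in
/-- A sum of additive characters over a split torus in terms of Gauss sums. -/
theorem sum_torus_eq [Algebra F K] (θ : AddChar F Qbar) {ι κ : Type} [Fintype ι] [Fintype κ]
    [DecidableEq ι] [DecidableEq κ] (M : Matrix ι κ ℤ) (c : κ → Kˣ) :
    ((Fintype.card K : Qbar) - 1) ^ Fintype.card κ *
      ∑ t : ι → Kˣ, ∏ k, traceLift K θ (c k * ∏ j, t j ^ M j k : Kˣ) =
    ((Fintype.card K : Qbar) - 1) ^ Fintype.card ι *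
      ∑ χ : κ → MulChar K Qbar, if χ ∈ kerPhi M then ∏ k, G K θ (χ k)⁻¹ * χ k (c k) else 0 := by
  have happ : ∀ (μ : MulChar K Qbar) (a : Kˣ), μ a = (μ.toUnitHom a : Qbar) := fun μ a =>
    (MulChar.coe_toUnitHom μ a).symm
  have hpow : ∀ (μ : κ → MulChar K Qbar) (j : ι) (a : Kˣ),
      (∏ k, μ k ^ M j k) (a : K) = ∏ k, μ k ((a ^ M j k : Kˣ) : K) := by
    intro μ j a
    have : ∀ (s : Finset κ), (∏ k ∈ s, μ k ^ M j k) (a : K) =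
        ∏ k ∈ s, μ k ((a ^ M j k : Kˣ) : K) := by
      intro s
      induction s using Finset.induction_on with
      | empty => simp
      | insert k s hk ih =>
        rw [Finset.prod_insert hk, Finset.prod_insert hk, MulChar.mul_apply, ih]
        congr 1
        have hz : (μ k ^ M j k).toUnitHom a = (μ k).toUnitHom a ^ M j k := by
          have := map_zpow (MulChar.mulEquivToUnitHom (R := K) (R' := Qbar)) (μ k) (M j k)
          exact congrArg (fun f : Kˣ →* Qbarˣ => f a) this
        rw [happ, happ, hz, map_zpow]
    exact this Finset.univ
  -- Expand every factor by `traceLift_fourier` and regroup by the torus coordinates; orthogonality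
  -- on Kˣ then leaves exactly the families in the kernel.
  have h1 : ∀ t : ι → Kˣ, ((Fintype.card K : Qbar) - 1) ^ Fintype.card κ *
      ∏ k, traceLift K θ (c k * ∏ j, t j ^ M j k : Kˣ) =
      ∑ χ : κ → MulChar K Qbar, (∏ k, G K θ (χ k)⁻¹ * χ k (c k)) *
        ∏ j, (∏ k, χ k ^ M j k) (t j : K) := by
    intro t
    rw [← Finset.card_univ (α := κ), ← Finset.prod_const, ← Finset.prod_mul_distrib]
    simp only [traceLift_fourier]
    rw [Finset.prod_univ_sum, Fintype.piFinset_univ]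
    refine Finset.sum_congr rfl fun χ _ => ?_
    rw [Finset.prod_congr rfl fun j _ => hpow χ j (t j), Finset.prod_comm,
      ← Finset.prod_mul_distrib]
    refine Finset.prod_congr rfl fun k _ => ?_
    rw [Units.val_mul, map_mul, mul_assoc]
    congr 2
    rw [happ, map_prod, Units.coe_prod]
    exact Finset.prod_congr rfl fun j _ => (happ _ _).symm
  rw [Finset.mul_sum, Finset.sum_congr rfl fun t _ => h1 t, Finset.sum_comm, Finset.mul_sum]
  refine Finset.sum_congr rfl fun χ _ => ?_
  rw [← Finset.mul_sum]
  have h2 : ∑ t : ι → Kˣ, ∏ j, (∏ k, χ k ^ M j k) (t j : K) =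
      ∏ j, ∑ a : Kˣ, (∏ k, χ k ^ M j k) (a : K) := by
    rw [Finset.prod_univ_sum, Fintype.piFinset_univ]
  rw [h2]
  simp only [sum_units_apply]
  split_ifs with hχ
  · rw [Finset.prod_congr rfl fun j _ => if_pos (hχ j), Finset.prod_const, Finset.card_univ]
    ring
  · have : ∃ j, ∏ k, χ k ^ M j k ≠ 1 := by
      by_contra hne
      push Not at hne
      exact hχ hne
    obtain ⟨j, hj⟩ := this
    rw [Finset.prod_eq_zero (Finset.mem_univ j) (if_neg hj), mul_zero, mul_zero]

end Fourier

section

variable {F : Type u} [Field F] (K : Type u) [Field K] [Algebra F K]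

/-- The image in `K` of a unit of `F`. -/
def unitLift (a : Fˣ) : Kˣ := Units.map (algebraMap F K : F →* K) a

@[simp] theorem coe_unitLift (a : Fˣ) : (unitLift K a : K) = algebraMap F K a := rfl

end

theorem addChar_map_sum {R R' ι : Type*} [AddCommMonoid R] [CommMonoid R'] (ψ : AddChar R R')
    (s : Finset ι) (g : ι → R) : ψ (∑ i ∈ s, g i) = ∏ i ∈ s, ψ (g i) := by
  classical
  induction s using Finset.induction_on with
  | empty => simp
  | insert a s ha ih =>
    rw [Finset.sum_insert ha, Finset.prod_insert ha, AddChar.map_add_eq_mul, ih]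

/-! ### The point count as a sum over tori. -/

section PointCount

variable {F : Type u} [Field F] {n : ℕ} {c : Fin (n + 1) → Fˣ}
  {A : Matrix (Fin (n + 1)) (Fin (n + 1)) ℕ} {lam : F}
  (K : Type u) [Field K] [Fintype K] [Algebra F K]

theorem aeval_smul_deformedPoly {K : Type*} [Field K] [Algebra F K]
    (hdeg : ∀ i, ∑ j, A j i = n + 1) (a : K) (x : Fin (n + 1) → K) :
    MvPolynomial.aeval (a • x) (deformedPoly c A lam) =
      a ^ (n + 1) * MvPolynomial.aeval x (deformedPoly c A lam) := by
  rw [aeval_deformedPoly, aeval_deformedPoly]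
  simp only [Pi.smul_apply, smul_eq_mul, mul_pow, Finset.prod_mul_distrib, Finset.prod_pow_eq_pow_sum,
    hdeg, Finset.prod_const, Finset.card_univ, Fintype.card_fin]
  rw [mul_sub, Finset.mul_sum]
  congr 1
  · exact Finset.sum_congr rfl fun i _ => by ring
  · ring

/-- Kˣ acts freely on the affine cone minus its vertex, with the projective points as orbits; the
summand 1 is the vertex. -/
theorem pointCount_mul (hdeg : ∀ i, ∑ j, A j i = n + 1) :
    pointCount (deformedPoly c A lam) K * (Fintype.card K - 1) + 1 =
      Nat.card {x : Fin (n + 1) → K // MvPolynomial.aeval x (deformedPoly c A lam) = 0} := by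
  classical
  set P := deformedPoly c A lam with hP
  have hzero : MvPolynomial.aeval (0 : Fin (n + 1) → K) P = 0 := by
    have h := aeval_smul_deformedPoly (c := c) (A := A) (lam := lam) (K := K) hdeg 0 0
    rwa [zero_smul, zero_pow (by omega), zero_mul] at h
  have hunit : ∀ (a : Kˣ) (x : Fin (n + 1) → K),
      MvPolynomial.aeval ((a : K) • x) P = 0 ↔ MvPolynomial.aeval x P = 0 := by
    intro a x
    rw [hP, aeval_smul_deformedPoly hdeg, mul_eq_zero, or_iff_right (pow_ne_zero _ a.ne_zero)]
  let φ : {x : Projectivization K (Fin (n + 1) → K) // MvPolynomial.aeval x.rep P = 0} × Kˣ →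
      {x : {x : Fin (n + 1) → K // MvPolynomial.aeval x P = 0} // x ≠ ⟨0, hzero⟩} := fun y =>
    ⟨⟨(y.2 : K) • y.1.1.rep, (hunit _ _).2 y.1.2⟩, fun h =>
      smul_ne_zero y.2.ne_zero y.1.1.rep_nonzero (congrArg Subtype.val h)⟩
  have hφ : Function.Bijective φ := by
    constructor
    · rintro ⟨⟨p, hp⟩, a⟩ ⟨⟨p', hp'⟩, a'⟩ h
      have h1 : (a : K) • p.rep = (a' : K) • p'.rep :=
        congrArg (fun z : {x : {x : Fin (n + 1) → K // MvPolynomial.aeval x P = 0} //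
          x ≠ ⟨0, hzero⟩} => z.1.1) h
      have h2 : p = p' := by
        rw [← p.mk_rep, ← p'.mk_rep, Projectivization.mk_eq_mk_iff']
        exact ⟨(a : K)⁻¹ * a', by rw [mul_smul, ← h1, smul_smul, inv_mul_cancel₀ a.ne_zero, one_smul]⟩
      subst h2
      have h3 := smul_left_injective K p.rep_nonzero h1
      rw [Units.ext h3]
    · rintro ⟨⟨x, hx⟩, hx0⟩
      have hx0' : x ≠ 0 := fun h => hx0 (Subtype.ext h)
      obtain ⟨a, ha⟩ := Projectivization.exists_smul_eq_mk_rep K x hx0'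
      refine ⟨⟨⟨Projectivization.mk K x hx0', ?_⟩, a⁻¹⟩, ?_⟩
      · rw [← ha]
        exact (hunit a x).2 hx
      · apply Subtype.ext
        apply Subtype.ext
        change ((a⁻¹ : Kˣ) : K) • (Projectivization.mk K x hx0').rep = x
        rw [← ha]
        change a⁻¹ • a • x = x
        rw [inv_smul_smul]
  have h1 := Nat.card_eq_of_bijective φ hφ
  rw [Nat.card_prod, Nat.card_eq_fintype_card (α := Kˣ), Fintype.card_units] at h1
  rw [pointCount, h1, Nat.card_eq_fintype_card, Nat.card_eq_fintype_card,
    Fintype.card_subtype_compl, Fintype.card_subtype_eq]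
  have : 0 < Fintype.card {x : Fin (n + 1) → K // MvPolynomial.aeval x P = 0} :=
    Fintype.card_pos_iff.2 ⟨⟨0, hzero⟩⟩
  omega

theorem card_mul_card_zeros [Fintype Kˣ] {θ : AddChar F Qbar} (hθ : θ ≠ 1) {X : Type*} [Fintype X]
    (f : X → K) : (Fintype.card K : Qbar) * Nat.card {x : X // f x = 0} =
      Fintype.card X + ∑ x, ∑ v : Kˣ, traceLift K θ (v * f x) := by
  classical
  have h : ∀ x, (if f x = 0 then (Fintype.card K : Qbar) else 0) =
      1 + ∑ v : Kˣ, traceLift K θ (v * f x) := by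
    intro x
    have h1 := AddChar.sum_mulShift (f x)
      (AddChar.IsPrimitive.of_ne_one (traceLift_ne_one K hθ))
    rw [Nat.cast_ite, Nat.cast_zero] at h1
    rw [← h1, ← Finset.add_sum_erase _ _ (Finset.mem_univ 0), zero_mul, AddChar.map_zero_eq_one]
    congr 1
    symm
    refine Finset.sum_of_injOn (fun u : Kˣ => (u : K)) Units.val_injective.injOn
      (fun u _ => by simp) (fun x hx hx' => ?_) (fun _ _ => rfl)
    exact absurd ⟨Units.mk0 x (by simpa using hx), by simp⟩ hx'
  have h2 := Finset.sum_congr rfl fun x (_ : x ∈ Finset.univ) => h x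
  rw [Finset.sum_add_distrib, ← Finset.sum_filter, Finset.sum_const, Finset.sum_const,
    Finset.card_univ, nsmul_eq_mul, nsmul_eq_mul, mul_one] at h2
  rw [← h2, Nat.card_eq_fintype_card, Fintype.card_subtype, mul_comm]

/-- The vector with coordinates `t j` for `j ∈ J` and `0` otherwise. -/
def extendZero {ι K : Type*} [DecidableEq ι] [Field K] (J : Finset ι) (t : J → Kˣ) : ι → K :=
  fun j => if h : j ∈ J then t ⟨j, h⟩ else 0

theorem extendZero_of_mem {ι K : Type*} [DecidableEq ι] [Field K] {J : Finset ι} (t : J → Kˣ)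
    (j : J) : extendZero J t j = t j := dif_pos j.2

theorem extendZero_of_notMem {ι K : Type*} [DecidableEq ι] [Field K] {J : Finset ι} (t : J → Kˣ)
    {j : ι} (h : j ∉ J) : extendZero J t j = 0 := dif_neg h

theorem sum_eq_sum_extendZero {ι K M : Type*} [Fintype ι] [DecidableEq ι] [Field K] [Fintype K]
    [Fintype Kˣ] [AddCommMonoid M] (g : (ι → K) → M) :
    ∑ x, g x = ∑ J : Finset ι, ∑ t : J → Kˣ, g (extendZero J t) := by
  classical
  rw [← Fintype.sum_sigma' (fun (J : Finset ι) (t : J → Kˣ) => g (extendZero J t))]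
  symm
  refine Fintype.sum_bijective (fun y : (J : Finset ι) × (J → Kˣ) => extendZero y.1 y.2) ⟨?_, ?_⟩
    _ _ fun _ => rfl
  · rintro ⟨J, t⟩ ⟨J', t'⟩ h
    have hmem : ∀ (J : Finset ι) (t : J → Kˣ) j, j ∈ J ↔ extendZero J t j ≠ 0 := by
      intro J t j
      by_cases hj : j ∈ J
      · simp [extendZero, hj]
      · simp [extendZero, hj]
    have hJ : J = J' := by
      ext j
      rw [hmem J t, hmem J' t']
      exact not_congr (by rw [show extendZero J t j = extendZero J' t' j from congrFun h j])
    subst hJ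
    congr 1
    funext j
    have := congrFun h j
    simp only [extendZero_of_mem] at this
    exact Units.ext this
  · intro x
    refine ⟨⟨Finset.univ.filter fun j => x j ≠ 0, fun j =>
      Units.mk0 (x j) (Finset.mem_filter.1 j.2).2⟩, ?_⟩
    funext j
    by_cases hj : x j = 0
    · rw [hj]
      exact extendZero_of_notMem _ (by simp [hj])
    · exact extendZero_of_mem (J := Finset.univ.filter fun j => x j ≠ 0) _ ⟨j, by simp [hj]⟩

open Classical in
/-- The contribution of the torus `{x | supp x = J}` to the point count. -/
def torusSum (θ : AddChar F Qbar) (c : Fin (n + 1) → Fˣ)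
    (A : Matrix (Fin (n + 1)) (Fin (n + 1)) ℕ) (lam : F) (J : Finset (Fin (n + 1))) : Qbar :=
  ∑ t : J → Kˣ, ∑ v : Kˣ,
    traceLift K θ (v * MvPolynomial.aeval (extendZero J t) (deformedPoly c A lam))

/-- The empty support is the origin and contributes Q - 1. Together with Q^(n+1) and the correction
for the vertex of the cone it produces the geometric series and the extra Q⁻¹. -/
theorem pointCount_eq_sum_torusSum (hdeg : ∀ i, ∑ j, A j i = n + 1) {θ : AddChar F Qbar}
    (hθ : θ ≠ 1) :
    (pointCount (deformedPoly c A lam) K : Qbar) =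
      (Fintype.card K : Qbar)⁻¹ + (∑ i ∈ Finset.range n, (Fintype.card K : Qbar) ^ i) +
      ∑ J ∈ Finset.univ.erase ∅, torusSum K θ c A lam J /
        ((Fintype.card K : Qbar) * ((Fintype.card K : Qbar) - 1)) := by
  classical
  have h1 := pointCount_mul (c := c) (A := A) (lam := lam) K hdeg
  have h2 := card_mul_card_zeros K hθ
    (fun x : Fin (n + 1) → K => MvPolynomial.aeval x (deformedPoly c A lam))
  rw [← h1, sum_eq_sum_extendZero, ← Finset.add_sum_erase _ _ (Finset.mem_univ ∅)] at h2
  have hempty : ∑ t : (∅ : Finset (Fin (n + 1))) → Kˣ, ∑ v : Kˣ,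
      traceLift K θ (v * MvPolynomial.aeval (extendZero ∅ t) (deformedPoly c A lam)) =
      (Fintype.card K : Qbar) - 1 := by
    have h0 : ∀ t : (∅ : Finset (Fin (n + 1))) → Kˣ,
        MvPolynomial.aeval (extendZero ∅ t) (deformedPoly c A lam) = 0 := by
      intro t
      have h := aeval_smul_deformedPoly (c := c) (A := A) (lam := lam) (K := K) hdeg 0 0
      rw [zero_smul, zero_pow (by omega), zero_mul] at h
      rw [show extendZero ∅ t = (0 : Fin (n + 1) → K) from
        funext fun j => extendZero_of_notMem t (Finset.notMem_empty j)]
      exact h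
    simp only [h0, mul_zero, AddChar.map_zero_eq_one, Finset.sum_const, Finset.card_univ,
      Fintype.card_units, nsmul_eq_mul, mul_one, cast_card_sub_one]
    simp
  rw [hempty] at h2
  have hQ : (Fintype.card K : Qbar) ≠ 0 := Nat.cast_ne_zero.2 Fintype.card_ne_zero
  have hQ1 := card_sub_one_ne_zero K
  have h3 : (Fintype.card K : Qbar) *
      ((pointCount (deformedPoly c A lam) K : Qbar) * ((Fintype.card K : Qbar) - 1) + 1) =
      (Fintype.card K : Qbar) ^ (n + 1) + ((Fintype.card K : Qbar) - 1 +
        ∑ J ∈ Finset.univ.erase ∅, torusSum K θ c A lam J) := by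
    have hX : (Fintype.card (Fin (n + 1) → K) : Qbar) = (Fintype.card K : Qbar) ^ (n + 1) := by
      simp
    rw [← hX]
    refine Eq.trans ?_ h2
    rw [Nat.cast_add, Nat.cast_mul, cast_card_sub_one, Nat.cast_one]
  rw [← Finset.sum_div]
  have hg := geom_sum_mul (Fintype.card K : Qbar) n
  set S := ∑ i ∈ Finset.range n, (Fintype.card K : Qbar) ^ i
  field_simp
  linear_combination h3 - (Fintype.card K : Qbar) * hg

/-- The Gauss sum term attached to a family of characters. -/
def gaussTerm (θ : AddChar F Qbar) {κ : Type} [Fintype κ] (c : κ → Kˣ)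
    (χ : κ → MulChar K Qbar) : Qbar := ∏ k, G K θ (χ k)⁻¹ * χ k (c k)

open Classical in
-- Some coordinate is zero, so the product of all coordinates vanishes and λ disappears. The
-- multiplier v is responsible for the row of ones in `extMatrix`.
theorem torusSum_of_ne_univ (θ : AddChar F Qbar) {J : Finset (Fin (n + 1))}
    (hJ : J ≠ Finset.univ) :
    ((Fintype.card K : Qbar) - 1) ^ (monomialsIn A J).card * torusSum K θ c A lam J =
      ((Fintype.card K : Qbar) - 1) ^ (J.card + 1) *
        ∑ χ : monomialsIn A J → MulChar K Qbar,
          if χ ∈ kerPhi (extMatrix A J) then gaussTerm K θ (fun i : monomialsIn A J => unitLift K (c i)) χ else 0 := by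
  have h := sum_torus_eq K θ (extMatrix A J) (fun i => unitLift K (c i))
  rw [Fintype.card_coe, Fintype.card_sum, Fintype.card_coe, Fintype.card_unit] at h
  refine Eq.trans ?_ h
  congr 1
  rw [torusSum, ← Fintype.sum_prod_type']
  refine Fintype.sum_equiv (((Equiv.refl _).prodCongr (Equiv.funUnique Unit Kˣ).symm).trans
    (Equiv.sumArrowEquivProdArrow J Unit Kˣ).symm) _ _ ?_
  rintro ⟨t, v⟩
  obtain ⟨j₀, hj₀⟩ : ∃ j, j ∉ J := by
    by_contra hne
    push Not at hne
    exact hJ (Finset.eq_univ_iff_forall.2 hne)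
  have hval : MvPolynomial.aeval (extendZero J t) (deformedPoly c A lam) =
      ∑ i : monomialsIn A J, algebraMap F K (c i) * ∏ j : J, (t j : K) ^ A j i := by
    rw [aeval_deformedPoly, Finset.prod_eq_zero (Finset.mem_univ j₀) (extendZero_of_notMem t hj₀),
      mul_zero, sub_zero,
      Finset.sum_coe_sort (monomialsIn A J)
        (fun i => algebraMap F K (c i) * ∏ j : J, (t j : K) ^ A j i)]
    symm
    refine Finset.sum_subset_zero_on_sdiff (Finset.subset_univ _) (fun i hi => ?_) (fun i hi => ?_)
    · rw [Finset.mem_sdiff, mem_monomialsIn] at hi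
      have := hi.2
      push Not at this
      obtain ⟨j, hj, hA⟩ := this
      rw [Finset.prod_eq_zero (Finset.mem_univ j), mul_zero]
      rw [extendZero_of_notMem t hj, zero_pow hA]
    · rw [mem_monomialsIn] at hi
      congr 1
      rw [← Finset.prod_subset (Finset.subset_univ J) (fun j _ hj => by rw [hi j hj, pow_zero]),
        ← Finset.prod_coe_sort J]
      exact Finset.prod_congr rfl fun j _ => by rw [extendZero_of_mem]
  simp only [hval]
  rw [Finset.mul_sum, addChar_map_sum]
  refine Finset.prod_congr rfl fun i _ => ?_
  congr 1
  rw [Units.val_mul, coe_unitLift, Fintype.prod_sum_type, Finset.univ_unique (α := Unit), Finset.prod_singleton, Units.val_mul]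
  have h1 : (((((Equiv.refl _).prodCongr (Equiv.funUnique Unit Kˣ).symm).trans
    (Equiv.sumArrowEquivProdArrow J Unit Kˣ).symm) (t, v) (Sum.inr default)) ^
      extMatrix A J (Sum.inr default) i : Kˣ) = v := zpow_one v
  have h2 : ∀ j : J, (((((Equiv.refl _).prodCongr (Equiv.funUnique Unit Kˣ).symm).trans
    (Equiv.sumArrowEquivProdArrow J Unit Kˣ).symm) (t, v) (Sum.inl j)) ^
      extMatrix A J (Sum.inl j) i : Kˣ) = t j ^ A j i := fun j => zpow_natCast (t j) (A j i)
  rw [h1, Finset.prod_congr rfl fun j _ => h2 j, Units.coe_prod]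
  simp only [Units.val_pow_eq_pow_val]
  ring

open Classical in
-- The monomial T_1 ⋯ T_{n+1} adds a column and the multiplier v a row of ones. That row forces the
-- extra character to be (∏ χ_i)⁻¹, which turns the relations of A into those of A'. The matrix is
-- square, so the powers of Q - 1 cancel.
theorem torusSum_univ (θ : AddChar F Qbar) {lam : Fˣ} :
    torusSum K θ c A lam Finset.univ =
        ∑ χ : Fin (n + 1) → MulChar K Qbar,
          if χ ∈ kerPhi (shiftedMatrix A) then gaussTerm K θ (fun i => unitLift K (c i)) χ *
            (G K θ (∏ i, χ i) * (∏ i, χ i)⁻¹ (-algebraMap F K lam)) else 0 := by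
  set M : Matrix (Fin (n + 1) ⊕ Unit) (Fin (n + 1) ⊕ Unit) ℤ :=
    Matrix.of fun j i => Sum.elim (fun j => Sum.elim (fun i => (A j i : ℤ)) (fun _ => 1) i)
      (fun _ => 1) j with hM
  set c' : Fin (n + 1) ⊕ Unit → Kˣ :=
    Sum.elim (fun i => unitLift K (c i)) (fun _ => -unitLift K lam) with hc'
  have h := sum_torus_eq K θ M c'
  have hQ1 := pow_ne_zero (Fintype.card (Fin (n + 1) ⊕ Unit)) (card_sub_one_ne_zero K)
  have h := mul_left_cancel₀ hQ1 h
  have hl : torusSum K θ c A (lam : F) Finset.univ =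
      ∑ t : Fin (n + 1) ⊕ Unit → Kˣ, ∏ k, traceLift K θ (c' k * ∏ j, t j ^ M j k : Kˣ) := by
    rw [torusSum, ← Fintype.sum_prod_type']
    refine Fintype.sum_equiv (((Equiv.arrowCongr (Equiv.subtypeUnivEquiv Finset.mem_univ)
      (Equiv.refl Kˣ)).prodCongr (Equiv.funUnique Unit Kˣ).symm).trans
      (Equiv.sumArrowEquivProdArrow (Fin (n + 1)) Unit Kˣ).symm) _ _ ?_
    rintro ⟨t, v⟩
    set y := (((Equiv.arrowCongr (Equiv.subtypeUnivEquiv Finset.mem_univ)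
      (Equiv.refl Kˣ)).prodCongr (Equiv.funUnique Unit Kˣ).symm).trans
      (Equiv.sumArrowEquivProdArrow (Fin (n + 1)) Unit Kˣ).symm) (t, v) with hy
    have hyl : ∀ j, y (Sum.inl j) = t ⟨j, Finset.mem_univ j⟩ := fun j => rfl
    have hyr : y (Sum.inr default) = v := rfl
    have hext : ∀ j, extendZero Finset.univ t j = y (Sum.inl j) := fun j =>
      extendZero_of_mem t ⟨j, Finset.mem_univ j⟩
    rw [aeval_deformedPoly, mul_sub, sub_eq_add_neg, AddChar.map_add_eq_mul, Finset.mul_sum,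
      addChar_map_sum, Fintype.prod_sum_type, Finset.univ_unique (α := Unit), Finset.prod_singleton]
    congr 1
    · refine Finset.prod_congr rfl fun i _ => ?_
      congr 1
      rw [Fintype.prod_sum_type, Finset.univ_unique (α := Unit), Finset.prod_singleton, hyr]
      have h1 : ∀ j, M (Sum.inl j) (Sum.inl i) = (A j i : ℤ) := fun _ => rfl
      have h2 : M (Sum.inr default) (Sum.inl i) = 1 := rfl
      rw [h2, zpow_one, Finset.prod_congr rfl fun j _ => (congrArg (y (Sum.inl j) ^ ·) (h1 j)).trans
        (zpow_natCast _ (A j i)), Units.val_mul, Units.val_mul, Units.coe_prod]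
      simp only [hext, Units.val_pow_eq_pow_val, hc', Sum.elim_inl, coe_unitLift]
      ring
    · congr 1
      rw [Fintype.prod_sum_type, Finset.univ_unique (α := Unit), Finset.prod_singleton, hyr]
      have h1 : ∀ j, M (Sum.inl j) (Sum.inr default) = 1 := fun _ => rfl
      have h2 : M (Sum.inr default) (Sum.inr default) = 1 := rfl
      rw [h2, zpow_one, Finset.prod_congr rfl fun j _ => (congrArg (y (Sum.inl j) ^ ·) (h1 j)).trans
        (zpow_one _), Units.val_mul, Units.val_mul, Units.coe_prod]
      simp only [hext, hc', Sum.elim_inr, Units.val_neg, coe_unitLift]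
      ring
  rw [hl, h, ← Finset.sum_filter, ← Finset.sum_filter]
  refine Finset.sum_bij' (fun χ _ i => χ (Sum.inl i))
    (fun χ _ => Sum.elim χ (fun _ => (∏ i, χ i)⁻¹)) ?_ ?_ ?_ ?_ ?_
  · intro χ hχ
    rw [Finset.mem_filter] at hχ ⊢
    refine ⟨Finset.mem_univ _, fun j => ?_⟩
    have h1 := hχ.2 (Sum.inl j)
    have h2 := hχ.2 (Sum.inr default)
    rw [Fintype.prod_sum_type, Finset.univ_unique (α := Unit), Finset.prod_singleton] at h1 h2
    change (∏ i, χ (Sum.inl i) ^ (A j i : ℤ)) * χ (Sum.inr default) ^ (1 : ℤ) = 1 at h1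
    change (∏ i, χ (Sum.inl i) ^ (1 : ℤ)) * χ (Sum.inr default) ^ (1 : ℤ) = 1 at h2
    change ∏ i, χ (Sum.inl i) ^ ((A j i : ℤ) - 1) = 1
    rw [Finset.prod_congr rfl fun i _ => zpow_sub (χ (Sum.inl i)) _ _, Finset.prod_mul_distrib,
      Finset.prod_inv_distrib, mul_inv_eq_one, ← mul_left_inj (χ (Sum.inr default) ^ (1 : ℤ)), h1, h2]
  · intro χ hχ
    rw [Finset.mem_filter] at hχ ⊢
    refine ⟨Finset.mem_univ _, ?_⟩
    have hone : ∏ i, χ i ^ (1 : ℤ) = ∏ i, χ i := Finset.prod_congr rfl fun i _ => zpow_one _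
    rintro (j | j)
    · rw [Fintype.prod_sum_type, Finset.univ_unique (α := Unit), Finset.prod_singleton]
      change (∏ i, χ i ^ (A j i : ℤ)) * (∏ i, χ i)⁻¹ ^ (1 : ℤ) = 1
      have h1 : ∏ i, χ i ^ ((A j i : ℤ) - 1) = 1 := hχ.2 j
      rw [Finset.prod_congr rfl fun i _ => zpow_sub (χ i) _ _, Finset.prod_mul_distrib,
        Finset.prod_inv_distrib, mul_inv_eq_one, hone] at h1
      rw [h1, zpow_one, mul_inv_cancel]
    · rw [Fintype.prod_sum_type, Finset.univ_unique (α := Unit), Finset.prod_singleton]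
      change (∏ i, χ i ^ (1 : ℤ)) * (∏ i, χ i)⁻¹ ^ (1 : ℤ) = 1
      rw [hone, zpow_one, mul_inv_cancel]
  · intro χ hχ
    rw [Finset.mem_filter] at hχ
    have h2 := hχ.2 (Sum.inr default)
    rw [Fintype.prod_sum_type, Finset.univ_unique (α := Unit), Finset.prod_singleton] at h2
    change (∏ i, χ (Sum.inl i) ^ (1 : ℤ)) * χ (Sum.inr default) ^ (1 : ℤ) = 1 at h2
    simp only [zpow_one] at h2
    funext i
    rcases i with i | i
    · rfl
    · exact (eq_inv_of_mul_eq_one_right h2).symm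
  · intro χ _
    rfl
  · intro χ hχ
    rw [Finset.mem_filter] at hχ
    have h2 := hχ.2 (Sum.inr default)
    rw [Fintype.prod_sum_type, Finset.univ_unique (α := Unit), Finset.prod_singleton] at h2
    change (∏ i, χ (Sum.inl i) ^ (1 : ℤ)) * χ (Sum.inr default) ^ (1 : ℤ) = 1 at h2
    simp only [zpow_one] at h2
    have h3 : χ (Sum.inr default) = (∏ i, χ (Sum.inl i))⁻¹ := eq_inv_of_mul_eq_one_right h2
    rw [Fintype.prod_sum_type, Finset.univ_unique (α := Unit), Finset.prod_singleton]
    change _ * (G K θ (χ (Sum.inr default))⁻¹ * _) = _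
    rw [show c' (Sum.inr default) = -unitLift K lam from rfl]
    change _ * (G K θ (χ (Sum.inr default))⁻¹ * χ (Sum.inr default) _) = _
    rw [h3, inv_inv]
    rfl

end PointCount

/-! ### Weil numbers and Weil functions. -/

section WeilNumbers

variable {q : ℕ}

theorem isWeilNumber_one : IsWeilNumber q 0 1 := fun ι => by simp

theorem IsWeilNumber.mul (hq : 0 < q) {k l : ℤ} {a b : Qbar} (ha : IsWeilNumber q k a)
    (hb : IsWeilNumber q l b) : IsWeilNumber q (k + l) (a * b) := fun ι => by
  rw [map_mul, norm_mul, ha ι, hb ι, ← Real.rpow_add (Nat.cast_pos.2 hq)]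
  push_cast
  ring_nf

theorem IsWeilNumber.neg {k : ℤ} {a : Qbar} (ha : IsWeilNumber q k a) :
    IsWeilNumber q k (-a) := fun ι => by rw [map_neg, norm_neg, ha ι]

theorem IsWeilNumber.prod (hq : 0 < q) {κ : Type*} {s : Finset κ} {k : κ → ℤ} {a : κ → Qbar}
    (h : ∀ i ∈ s, IsWeilNumber q (k i) (a i)) :
    IsWeilNumber q (∑ i ∈ s, k i) (∏ i ∈ s, a i) := by
  classical
  induction s using Finset.induction_on with
  | empty => simpa using isWeilNumber_one
  | insert i s hi ih =>
    rw [Finset.sum_insert hi, Finset.prod_insert hi]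
    exact (h i (Finset.mem_insert_self i s)).mul hq
      (ih fun j hj => h j (Finset.mem_insert_of_mem hj))

theorem isWeilNumber_natCast_zpow (l : ℤ) : IsWeilNumber q (2 * l) ((q : Qbar) ^ l) := fun ι => by
  rw [map_zpow₀, map_natCast, norm_zpow, Complex.norm_natCast, ← Real.rpow_intCast]
  congr 1
  push_cast
  ring

theorem isWeilNumber_of_pow_eq_one {m : ℕ} (hm : m ≠ 0) {a : Qbar} (ha : a ^ m = 1) :
    IsWeilNumber q 0 a := fun ι => by
  rw [Int.cast_zero, zero_div, Real.rpow_zero]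
  exact Complex.norm_eq_one_of_pow_eq_one (by rw [← map_pow, ha, map_one]) hm

theorem isWeilNumber_mulChar_apply {F : Type*} [Field F] [Fintype F] (χ : MulChar F Qbar)
    (a : Fˣ) : IsWeilNumber q 0 (χ a) := by
  classical
  refine isWeilNumber_of_pow_eq_one (m := Fintype.card Fˣ) Fintype.card_ne_zero ?_
  rw [← map_pow, ← Units.val_pow_eq_pow_val, pow_card_eq_one, Units.val_one, map_one]

theorem isWeilNumber_gaussSum {F : Type*} [Field F] [Fintype F] {χ : MulChar F Qbar}
    (hχ : χ ≠ 1) {θ : AddChar F Qbar} (hθ : θ ≠ 1) :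
    IsWeilNumber (Fintype.card F) 1 (gaussSum χ θ) := fun ι => by
  set χ' : MulChar F ℂ := χ.ringHomComp ι
  set θ' : AddChar F ℂ := (ι : Qbar →* ℂ).compAddChar θ
  have hg : ι (gaussSum χ θ) = gaussSum χ' θ' := by
    simp only [gaussSum, map_sum, map_mul]
    rfl
  have hχ' : χ' ≠ 1 := (MulChar.ringHomComp_ne_one_iff ι.injective).2 hχ
  have hθ' : θ' ≠ 1 := by
    obtain ⟨a, ha⟩ := AddChar.ne_one_iff.1 hθ
    refine AddChar.ne_one_iff.2 ⟨a, fun h => ha (ι.injective ?_)⟩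
    rw [map_one]
    exact h
  have h1 := gaussSum_mul_gaussSum_eq_card hχ' (AddChar.IsPrimitive.of_ne_one hθ')
  rw [← star_gaussSum_eq, ← hg] at h1
  have h2 : ‖ι (gaussSum χ θ)‖ ^ 2 = (Fintype.card F : ℝ) := by
    have := congrArg norm h1
    rwa [norm_mul, norm_star, Complex.norm_natCast, ← sq] at this
  rw [← Real.sqrt_sq (norm_nonneg _), h2, Real.sqrt_eq_rpow]
  norm_num

end WeilNumbers

section WeilFunctions

variable {q : ℕ} {k : ℤ}

theorem IsWeilFunctionOfWeightNe.congr {f g : ℕ → Qbar} (hf : IsWeilFunctionOfWeightNe q k f)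
    (h : ∀ r, 1 ≤ r → g r = f r) : IsWeilFunctionOfWeightNe q k g := by
  obtain ⟨m, wt, G, ε, h1, h2, h3, h4⟩ := hf
  exact ⟨m, wt, G, ε, h1, h2, h3, fun r hr => (h r hr).trans (h4 r hr)⟩

theorem isWeilFunctionOfWeightNe_zero : IsWeilFunctionOfWeightNe q k fun _ => 0 :=
  ⟨0, Fin.elim0, Fin.elim0, Fin.elim0, fun i => i.elim0, fun i => i.elim0, fun i => i.elim0,
    fun r _ => by simp⟩

theorem isWeilFunctionOfWeightNe_pow {l : ℤ} (hl : l ≠ k) {a : Qbar} (ha : IsWeilNumber q l a) :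
    IsWeilFunctionOfWeightNe q k fun r => a ^ r :=
  ⟨1, fun _ => l, fun _ r => a ^ r, fun _ => 1, fun _ => ⟨1, fun _ => a, fun _ => ha,
    fun r _ => by simp⟩, fun _ => hl, fun _ => Or.inl rfl, fun r _ => by simp⟩

theorem IsWeilFunctionOfWeightNe.add {f g : ℕ → Qbar} (hf : IsWeilFunctionOfWeightNe q k f)
    (hg : IsWeilFunctionOfWeightNe q k g) : IsWeilFunctionOfWeightNe q k fun r => f r + g r := by
  obtain ⟨m, wt, G, ε, h1, h2, h3, h4⟩ := hf
  obtain ⟨m', wt', G', ε', h1', h2', h3', h4'⟩ := hg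
  refine ⟨m + m', Fin.append wt wt', Fin.append G G', Fin.append ε ε', ?_, ?_, ?_, ?_⟩
  · exact fun i => Fin.addCases (fun i => by simpa using h1 i) (fun i => by simpa using h1' i) i
  · exact fun i => Fin.addCases (fun i => by simpa using h2 i) (fun i => by simpa using h2' i) i
  · exact fun i => Fin.addCases (fun i => by simpa using h3 i) (fun i => by simpa using h3' i) i
  · intro r hr
    change f r + g r = _
    rw [h4 r hr, h4' r hr, Fin.sum_univ_add]
    simp

theorem IsWeilFunctionOfWeightNe.neg {f : ℕ → Qbar} (hf : IsWeilFunctionOfWeightNe q k f) :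
    IsWeilFunctionOfWeightNe q k fun r => -f r := by
  obtain ⟨m, wt, G, ε, h1, h2, h3, h4⟩ := hf
  refine ⟨m, wt, G, fun i => -ε i, h1, h2, fun i => ?_, fun r hr => ?_⟩
  · rcases h3 i with h | h <;> simp [h]
  · change -f r = ∑ i, -ε i * G i r
    rw [h4 r hr, ← Finset.sum_neg_distrib]
    exact Finset.sum_congr rfl fun i _ => (neg_mul _ _).symm

theorem IsWeilFunctionOfWeightNe.sum {κ : Type*} (s : Finset κ) {f : κ → ℕ → Qbar}
    (h : ∀ i ∈ s, IsWeilFunctionOfWeightNe q k (f i)) :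
    IsWeilFunctionOfWeightNe q k fun r => ∑ i ∈ s, f i r := by
  classical
  induction s using Finset.induction_on with
  | empty => simpa using isWeilFunctionOfWeightNe_zero
  | insert i s hi ih =>
    simp only [Finset.sum_insert hi]
    exact (h i (Finset.mem_insert_self i s)).add
      (ih fun j hj => h j (Finset.mem_insert_of_mem hj))

theorem IsWeilFunctionOfWeightNe.neg_one_pow_mul {f : ℕ → Qbar}
    (hf : IsWeilFunctionOfWeightNe q k f) (m : ℕ) :
    IsWeilFunctionOfWeightNe q k fun r => (-1) ^ m * f r := by
  rcases neg_one_pow_eq_or Qbar m with h | h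
  · simpa only [h, one_mul] using hf
  · simpa only [h, neg_one_mul] using hf.neg

theorem IsWeilFunctionOfWeightNe.natCast_mul {f : ℕ → Qbar}
    (hf : IsWeilFunctionOfWeightNe q k f) (m : ℕ) :
    IsWeilFunctionOfWeightNe q k fun r => m * f r :=
  (IsWeilFunctionOfWeightNe.sum (Finset.range m) fun _ _ => hf).congr fun r _ => by simp

end WeilFunctions

/-! ### Products of Gauss sums as powers of Weil numbers. -/

section GaussTerm

variable {F : Type u} [Field F] [Fintype F]

/-- The `q`-Weil number whose powers are, up to sign, the Gauss sum terms attached to lifts of the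
family `χ`. -/
def gaussNumber (θ : AddChar F Qbar) {κ : Type} [Fintype κ] (c : κ → Fˣ)
    (χ : κ → MulChar F Qbar) : Qbar := ∏ k, -gaussSum (χ k)⁻¹ θ * χ k (c k)

/-- The lifting relation involves the negatives of the Gauss sums, which yields one sign per
character; the character values are r-th powers because the norm of an element of F is its r-th
power. -/
theorem gaussTerm_normLift (K : Type u) [Field K] [Fintype K] [Algebra F K]
    {θ : AddChar F Qbar} (hθ : θ ≠ 1) {κ : Type} [Fintype κ] (c : κ → Fˣ)
    (χ : κ → MulChar F Qbar) :
    gaussTerm K θ (fun k => unitLift K (c k)) (fun k => normLift K (χ k)) =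
      (-1) ^ Fintype.card κ * gaussNumber θ c χ ^ Module.finrank F K := by
  rw [gaussTerm, gaussNumber, ← Finset.prod_pow, ← Finset.card_univ, ← Finset.prod_const,
    ← Finset.prod_mul_distrib]
  refine Finset.prod_congr rfl fun k _ => ?_
  rw [← normLift_inv, G_normLift K hθ, coe_unitLift, normLift_apply, Algebra.norm_algebraMap,
    map_pow, mul_pow]
  ring

open Classical in
theorem isWeilNumber_gaussNumber {θ : AddChar F Qbar} (hθ : θ ≠ 1) {κ : Type} [Fintype κ]
    (c : κ → Fˣ) (χ : κ → MulChar F Qbar) :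
    IsWeilNumber (Fintype.card F) ((Finset.univ.filter fun k => χ k ≠ 1).card : ℤ)
      (gaussNumber θ c χ) := by
  rw [Finset.card_filter, Nat.cast_sum]
  refine IsWeilNumber.prod Fintype.card_pos fun k _ => ?_
  have h1 := isWeilNumber_mulChar_apply (q := Fintype.card F) (χ k) (c k)
  rw [← add_zero (Nat.cast _ : ℤ)]
  refine IsWeilNumber.mul Fintype.card_pos ?_ h1
  split_ifs with h
  · exact (isWeilNumber_gaussSum (inv_ne_one.2 h) hθ).neg
  · rw [not_not.1 h, inv_one, gaussSum_one_left hθ, neg_neg]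
    exact isWeilNumber_one

open Classical in
theorem isWeilFunctionOfWeightNe_gaussNumber {θ : AddChar F Qbar} (hθ : θ ≠ 1) {κ : Type}
    [Fintype κ] (c : κ → Fˣ) (χ : κ → MulChar F Qbar) (l k : ℤ)
    (h : 2 * l + (Finset.univ.filter fun k => χ k ≠ 1).card ≠ k) :
    IsWeilFunctionOfWeightNe (Fintype.card F) k fun r =>
      ((Fintype.card F : Qbar) ^ r) ^ l * gaussNumber θ c χ ^ r := by
  refine (isWeilFunctionOfWeightNe_pow h ((isWeilNumber_natCast_zpow l).mul Fintype.card_pos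
    (isWeilNumber_gaussNumber hθ c χ))).congr fun r _ => ?_
  rw [mul_pow, ← zpow_natCast, ← zpow_mul, ← zpow_natCast (_ ^ l), ← zpow_mul, mul_comm (r : ℤ)]

end GaussTerm

/-! ### Kernel families that are lifted from the base field. -/

section KernelLift

theorem normLift_mem_kerPhi_iff {F : Type u} [Field F] (K : Type u) [Field K] [Fintype K]
    [Algebra F K] {ι κ : Type} [Fintype κ] (M : Matrix ι κ ℤ) (χ : κ → MulChar F Qbar) : (fun k => normLift K (χ k)) ∈ kerPhi M ↔ χ ∈ kerPhi M := by
  refine forall_congr' fun j => ?_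
  rw [← normLift_eq_one_iff K (F := F), ← normLiftHom_apply, map_prod]
  simp only [normLiftHom_apply, normLift_zpow]

variable {F : Type u} [Field F] [Fintype F] (K : Type u) [Field K] [Fintype K] [Algebra F K]

/-- Counting: lifting is injective on q - 1 characters, and the cyclic character group of Kˣ has at
most q - 1 elements killed by q - 1. -/
theorem exists_normLift_eq {ψ : MulChar K Qbar} (h : ψ ^ (Fintype.card F - 1) = 1) :
    ∃ χ : MulChar F Qbar, normLift K χ = ψ := by
  classical
  have h1 : (Finset.univ.image (normLift (F := F) K)).card = Fintype.card F - 1 := by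
    rw [Finset.card_image_of_injective _ (f := normLift K) (normLiftHom_injective K), Finset.card_univ, card_mulChar]
  have hpos : 0 < Fintype.card F - 1 := Nat.sub_pos_of_lt Fintype.one_lt_card
  have h2 : Finset.univ.image (normLift (F := F) K) ⊆
      Finset.univ.filter fun ψ : MulChar K Qbar => ψ ^ (Fintype.card F - 1) = 1 := by
    intro ψ hψ
    obtain ⟨χ, -, rfl⟩ := Finset.mem_image.1 hψ
    rw [Finset.mem_filter, ← normLift_pow, ← card_mulChar, pow_card_eq_one, normLift_one]
    exact ⟨Finset.mem_univ _, rfl⟩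
  have h3 := Finset.eq_of_subset_of_card_le h2
    (h1.symm ▸ IsCyclic.card_pow_eq_one_le hpos)
  have h4 : ψ ∈ Finset.univ.image (normLift (F := F) K) := by
    rw [h3, Finset.mem_filter]
    exact ⟨Finset.mem_univ _, h⟩
  obtain ⟨χ, -, hχ⟩ := Finset.mem_image.1 h4
  exact ⟨χ, hχ⟩

theorem prod_zpow_zpow {G ι : Type*} [CommGroup G] (g : G) (s : Finset ι) (x m : ι → ℤ) :
    ∏ i ∈ s, (g ^ x i) ^ m i = g ^ ∑ i ∈ s, m i * x i := by
  classical
  induction s using Finset.induction_on with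
  | empty => simp
  | insert i s hi ih =>
    rw [Finset.prod_insert hi, Finset.sum_insert hi, zpow_add, ih, ← zpow_mul, mul_comm (x i)]

theorem exists_generator_exponents {κ : Type*} (χ : κ → MulChar K Qbar) :
    ∃ (g : MulChar K Qbar) (x : κ → ℤ), orderOf g = Fintype.card K - 1 ∧ ∀ i, χ i = g ^ x i := by
  obtain ⟨g, hg⟩ := IsCyclic.exists_generator (α := MulChar K Qbar)
  choose x hx using fun i => Subgroup.mem_zpowers_iff.1 (hg (χ i))
  refine ⟨g, x, ?_, fun i => (hx i).symm⟩
  rw [orderOf_eq_card_of_forall_mem_zpowers hg, Nat.card_eq_fintype_card, card_mulChar]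

variable {n : ℕ} {A : Matrix (Fin (n + 1)) (Fin (n + 1)) ℕ}

theorem pow_eq_one_of_prod_eq_one {N : ℕ} (hdet : (A.map (Nat.cast : ℕ → ℚ)).det ≠ 0)
    (hdiv : ElementaryDivisorsDvd (extMatrix A Finset.univ) N)
    {χ : Fin (n + 1) → MulChar K Qbar} (h1 : ∀ j, ∏ i, χ i ^ (A j i : ℤ) = 1)
    (h2 : ∏ i, χ i = 1) (i : Fin (n + 1)) : χ i ^ N = 1 := by
  obtain ⟨g, x, hg, hx⟩ := exists_generator_exponents K χ
  obtain rfl : χ = fun i => g ^ x i := funext hx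
  have h3 : ∀ j, (orderOf g : ℤ) ∣ ∑ i, (A j i : ℤ) * x i := fun j => by
    rw [orderOf_dvd_iff_zpow_eq_one, ← prod_zpow_zpow]
    exact h1 j
  have h4 : (orderOf g : ℤ) ∣ ∑ i, x i := by
    rw [orderOf_dvd_iff_zpow_eq_one, ← h2]
    simpa using (prod_zpow_zpow g Finset.univ x fun _ => 1).symm
  have h5 := dvd_mul_of_dvd_mulVec hdet hdiv h3 h4 i
  change (g ^ x i) ^ N = 1
  rw [← zpow_natCast, ← zpow_mul, mul_comm]
  exact orderOf_dvd_iff_zpow_eq_one.1 h5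

/-- Extended by trivial characters, the family satisfies the relations of the full index set,
because the columns in `monomialsIn A J` vanish outside J. -/
theorem pow_eq_one_of_mem_kerPhi {N : ℕ} (hdet : (A.map (Nat.cast : ℕ → ℚ)).det ≠ 0)
    (hdiv : ElementaryDivisorsDvd (extMatrix A Finset.univ) N) {J : Finset (Fin (n + 1))}
    {χ : monomialsIn A J → MulChar K Qbar} (h : χ ∈ kerPhi (extMatrix A J))
    (i : monomialsIn A J) : χ i ^ N = 1 := by
  classical
  set χ' : Fin (n + 1) → MulChar K Qbar := fun i =>
    if hi : i ∈ monomialsIn A J then χ ⟨i, hi⟩ else 1 with hχ'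
  have hin : ∀ i : monomialsIn A J, χ' i = χ i := fun i => dif_pos i.2
  have hout : ∀ i, i ∉ monomialsIn A J → χ' i = 1 := fun i hi => dif_neg hi
  have hprod : ∀ m : Fin (n + 1) → ℤ, ∏ i, χ' i ^ m i = ∏ i : monomialsIn A J, χ i ^ m i := by
    intro m
    rw [← Finset.prod_subset (Finset.subset_univ (monomialsIn A J))
      (fun i _ hi => by rw [hout i hi, one_zpow]), ← Finset.prod_coe_sort (monomialsIn A J)]
    exact Finset.prod_congr rfl fun i _ => by rw [hin]
  rw [← hin]
  refine pow_eq_one_of_prod_eq_one K hdet hdiv (fun j => ?_) ?_ i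
  · rw [hprod fun i => (A j i : ℤ)]
    by_cases hj : j ∈ J
    · exact h (Sum.inl ⟨j, hj⟩)
    · refine Finset.prod_eq_one fun i _ => ?_
      rw [mem_monomialsIn.1 i.2 j hj, Nat.cast_zero, zpow_zero]
  · have h1 := hprod fun _ => 1
    have h2 : ∏ i : monomialsIn A J, χ i ^ (1 : ℤ) = 1 := h (Sum.inr ())
    rw [h2] at h1
    simpa using h1

open Classical in
/-- All families in the kernel defined by `extMatrix A J` are lifts from the base field. -/
theorem sum_kerPhi_extMatrix (hdet : (A.map (Nat.cast : ℕ → ℚ)).det ≠ 0)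
    (hdiv : ElementaryDivisorsDvd (extMatrix A Finset.univ) (Fintype.card F - 1))
    (J : Finset (Fin (n + 1))) (f : (monomialsIn A J → MulChar K Qbar) → Qbar) :
    ∑ χ : monomialsIn A J → MulChar K Qbar, (if χ ∈ kerPhi (extMatrix A J) then f χ else 0) =
      ∑ χ : monomialsIn A J → MulChar F Qbar, if χ ∈ kerPhi (extMatrix A J) then
        f (fun k => normLift K (χ k)) else 0 := by
  rw [← Finset.sum_filter, ← Finset.sum_filter]
  symm
  refine Finset.sum_bij (fun χ _ k => normLift K (χ k)) (fun χ hχ => ?_) (fun χ _ ψ _ h => ?_)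
    (fun χ hχ => ?_) (fun _ _ => rfl)
  · rw [Finset.mem_filter] at hχ ⊢
    exact ⟨Finset.mem_univ _, (normLift_mem_kerPhi_iff K _ χ).2 hχ.2⟩
  · exact funext fun k => normLiftHom_injective K (congrFun h k)
  · rw [Finset.mem_filter] at hχ
    choose χ' hχ' using fun k => exists_normLift_eq (F := F) K
      (pow_eq_one_of_mem_kerPhi K hdet hdiv hχ.2 k)
    refine ⟨χ', ?_, funext hχ'⟩
    rw [Finset.mem_filter, ← normLift_mem_kerPhi_iff K]
    exact ⟨Finset.mem_univ _, (funext hχ' : (fun k => normLift K (χ' k)) = χ) ▸ hχ.2⟩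

end KernelLift

/-! ### Parametrisation of the kernel of A' on characters. -/

section ShiftedKernel

variable {n : ℕ} {A : Matrix (Fin (n + 1)) (Fin (n + 1)) ℕ}

theorem IsPosGenerator.sum_mul {α : Fin (n + 1) → ℕ} (h : IsPosGenerator A α) (j : Fin (n + 1)) :
    ∑ i, shiftedMatrix A j i * (α i : ℤ) = 0 :=
  congrFun ((h.2 fun i => (α i : ℤ)).2 ⟨1, fun _ => (one_mul _).symm⟩) j

/-- A vector in the kernel of `A'` modulo `N * R` is, modulo `R`, a multiple of the generator of
the kernel of `A'`. -/
theorem IsPosGenerator.exists_dvd_sub_mul {α : Fin (n + 1) → ℕ} (h : IsPosGenerator A α) {N : ℕ}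
    (hN : N ≠ 0) (hdet : (A.map (Nat.cast : ℕ → ℚ)).det ≠ 0)
    (hdiv : ElementaryDivisorsDvd (extMatrix A Finset.univ) N) {R : ℤ} {x : Fin (n + 1) → ℤ}
    (hx : ∀ j, (N : ℤ) * R ∣ ∑ i, shiftedMatrix A j i * x i) :
    ∃ y : ℤ, ∀ i, R ∣ x i - y * α i := by
  set a : ℤ := ∑ i, (α i : ℤ) with ha
  have ha0 : a ≠ 0 := (Finset.sum_pos (fun i _ => Int.natCast_pos.2 (h.1 i))
    Finset.univ_nonempty).ne'
  obtain ⟨b, hb⟩ := h.exists_sum_mul_eq_one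
  set t : ℤ := ∑ i, x i with ht
  -- Removing the component along α gives Σ X = 0 and A X = a A' x, so that the divisibility result
  -- for A and the row of ones applies to X.
  set X : Fin (n + 1) → ℤ := fun i => a * x i - t * α i with hX
  have hAα : ∀ j, ∑ i, (A j i : ℤ) * α i = a := fun j => by
    have h1 := h.sum_mul j
    simp only [shiftedMatrix, sub_mul, one_mul, Finset.sum_sub_distrib] at h1
    linarith
  have hAX : ∀ j, ∑ i, (A j i : ℤ) * X i = a * ∑ i, shiftedMatrix A j i * x i := fun j => by
    have h1 : ∑ i, (A j i : ℤ) * X i = a * ∑ i, (A j i : ℤ) * x i - t * ∑ i, (A j i : ℤ) * α i := by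
      rw [Finset.mul_sum, Finset.mul_sum, ← Finset.sum_sub_distrib]
      exact Finset.sum_congr rfl fun i _ => by ring
    rw [h1, hAα]
    simp only [shiftedMatrix, sub_mul, one_mul, Finset.sum_sub_distrib]
    ring
  have hX0 : ∑ i, X i = 0 := by
    simp only [hX, Finset.sum_sub_distrib, ← Finset.mul_sum]
    rw [← ha, ← ht]
    ring
  have hXdvd : ∀ i, a * R ∣ X i := fun i => by
    have h1 := dvd_mul_of_dvd_mulVec (v := X) (m := N * (a * R)) hdet hdiv (fun j => by
      rw [hAX, mul_left_comm]
      exact mul_dvd_mul_left a (hx j)) (by rw [hX0]; exact dvd_zero _) i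
    exact (mul_dvd_mul_iff_left (Int.natCast_ne_zero.2 hN)).1 h1
  -- The Bézout relation Σ b_i α_i = 1 gives a (x_i - y α_i) = X_i - (Σ b_l X_l) α_i for this y.
  refine ⟨∑ i, b i * x i, fun i => ?_⟩
  have h2 : a * R ∣ ∑ i, b i * X i :=
    Finset.dvd_sum fun i _ => Dvd.dvd.mul_left (hXdvd i) _
  have h3 : ∑ i, b i * X i = a * ∑ i, b i * x i - t := by
    have : ∑ i, b i * X i = a * ∑ i, b i * x i - t * ∑ i, b i * α i := by
      rw [Finset.mul_sum, Finset.mul_sum, ← Finset.sum_sub_distrib]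
      exact Finset.sum_congr rfl fun i _ => by ring
    rw [this, hb, mul_one]
  have h4 : a * R ∣ a * (x i - (∑ i, b i * x i) * α i) := by
    have h5 : a * (x i - (∑ i, b i * x i) * α i) = X i - (∑ i, b i * X i) * α i := by
      rw [h3]
      simp only [hX]
      ring
    rw [h5]
    exact dvd_sub (hXdvd i) (Dvd.dvd.mul_right h2 _)
  exact (mul_dvd_mul_iff_left ha0).1 h4

theorem mkQ_eq_iff {N : ℕ} (v w : Fin (n + 1) → ℤ) :
    (Submodule.mkQ (Submodule.span (ZMod N) {fun i => ((alphaVec A i : ℕ) : ZMod N)}))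
      (fun i => (v i : ZMod N)) =
    (Submodule.mkQ (Submodule.span (ZMod N) {fun i => ((alphaVec A i : ℕ) : ZMod N)}))
      (fun i => (w i : ZMod N)) ↔ ∃ t : ℤ, ∀ i, (N : ℤ) ∣ v i - w i - t * alphaVec A i := by
  rw [← sub_eq_zero, ← map_sub, Submodule.mkQ_apply, Submodule.Quotient.mk_eq_zero,
    Submodule.mem_span_singleton]
  constructor
  · rintro ⟨t, ht⟩
    refine ⟨(t.cast : ℤ), fun i => ?_⟩
    rw [← ZMod.intCast_zmod_eq_zero_iff_dvd]
    have := congrFun ht i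
    simp only [Pi.smul_apply, smul_eq_mul, Pi.sub_apply] at this
    rw [Int.cast_sub, Int.cast_sub, Int.cast_mul, Int.cast_natCast, ZMod.intCast_zmod_cast, ← this,
      sub_self]
  · rintro ⟨t, ht⟩
    refine ⟨(t : ZMod N), funext fun i => ?_⟩
    have := (ZMod.intCast_zmod_eq_zero_iff_dvd _ _).2 (ht i)
    push_cast at this
    simp only [Pi.smul_apply, smul_eq_mul, Pi.sub_apply]
    rw [sub_eq_zero] at this
    exact this.symm

theorem mem_kerF_iff {N : ℕ} (hα : IsPosGenerator A (alphaVec A)) (v : Fin (n + 1) → ℤ) :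
    (Submodule.mkQ (Submodule.span (ZMod N) {fun i => ((alphaVec A i : ℕ) : ZMod N)}))
      (fun i => (v i : ZMod N)) ∈ kerF A N ↔
    ∀ j, (N : ℤ) ∣ ∑ i, shiftedMatrix A j i * v i := by
  have hker : ∀ v : Fin (n + 1) → ℤ, (fun i => (v i : ZMod N)) ∈
      LinearMap.ker ((shiftedMatrix A).map (Int.cast : ℤ → ZMod N)).mulVecLin ↔
      ∀ j, (N : ℤ) ∣ ∑ i, shiftedMatrix A j i * v i := by
    intro v
    rw [LinearMap.mem_ker, funext_iff]
    refine forall_congr' fun j => ?_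
    rw [← ZMod.intCast_zmod_eq_zero_iff_dvd]
    push_cast
    rfl
  rw [kerF]
  constructor
  · rintro ⟨w, hw, hwv⟩
    have hw' : w = fun i => (((w i).cast : ℤ) : ZMod N) :=
      funext fun i => (ZMod.intCast_zmod_cast _).symm
    rw [hw'] at hw hwv
    obtain ⟨t, ht⟩ := (mkQ_eq_iff _ _).1 hwv
    intro j
    have h1 := (hker _).1 hw j
    have h2 : ∑ i, shiftedMatrix A j i * v i = ∑ i, shiftedMatrix A j i * ((w i).cast : ℤ)
        - (∑ i, shiftedMatrix A j i * (((w i).cast : ℤ) - v i - t * alphaVec A i))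
        - t * ∑ i, shiftedMatrix A j i * (alphaVec A i : ℤ) := by
      rw [Finset.mul_sum, ← Finset.sum_sub_distrib, ← Finset.sum_sub_distrib]
      exact Finset.sum_congr rfl fun i _ => by ring
    rw [h2, hα.sum_mul j, mul_zero, sub_zero]
    exact dvd_sub h1 (Finset.dvd_sum fun i _ => Dvd.dvd.mul_left (ht i) _)
  · exact fun h => ⟨_, (hker v).2 h, rfl⟩

theorem orderOf_eq_of_forall_mem_zpowers {F : Type u} [Field F] [Fintype F] {ρ : MulChar F Qbar}
    (hρ : ∀ χ : MulChar F Qbar, χ ∈ Subgroup.zpowers ρ) : orderOf ρ = Fintype.card F - 1 := by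
  rw [orderOf_eq_card_of_forall_mem_zpowers hρ, Nat.card_eq_fintype_card, card_mulChar]

theorem pow_mul_pow_mem_kerPhi {K : Type u} [Field K] (hα : IsPosGenerator A (alphaVec A)) {μ : MulChar K Qbar}
    {N : ℕ} (hμ : orderOf μ = N) (v : Fin (n + 1) → ℤ) (ψ : MulChar K Qbar) :
    (fun i => μ ^ v i * ψ ^ alphaVec A i) ∈ kerPhi (shiftedMatrix A) ↔
      ∀ j, (N : ℤ) ∣ ∑ i, shiftedMatrix A j i * v i := by
  refine forall_congr' fun j => ?_
  have h1 : ∏ i, (ψ ^ alphaVec A i) ^ shiftedMatrix A j i = 1 := by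
    have := prod_zpow_zpow ψ Finset.univ (fun i => (alphaVec A i : ℤ)) (shiftedMatrix A j)
    simp only [zpow_natCast] at this
    rw [this, hα.sum_mul j, zpow_zero]
  rw [Finset.prod_congr rfl fun i _ => mul_zpow _ _ _, Finset.prod_mul_distrib, h1, mul_one,
    prod_zpow_zpow, ← orderOf_dvd_iff_zpow_eq_one, hμ]

variable {F : Type u} [Field F] [Fintype F] (K : Type u) [Field K] [Fintype K] [Algebra F K]

open Classical in
/-- The kernel defined by `A'` over `K` is the disjoint union of the families
`ρ ^ s_{ij} ψ ^ α_i`. -/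
theorem sum_kerPhi_shiftedMatrix (hα : IsPosGenerator A (alphaVec A))
    (hdet : (A.map (Nat.cast : ℕ → ℚ)).det ≠ 0)
    (hdiv : ElementaryDivisorsDvd (extMatrix A Finset.univ) (Fintype.card F - 1))
    {d : ℕ} {s : Fin d → Fin (n + 1) → ℕ} (hs : IsKernelReps A (Fintype.card F - 1) s)
    {ρ : MulChar F Qbar} (hρ : ∀ χ : MulChar F Qbar, χ ∈ Subgroup.zpowers ρ)
    (f : (Fin (n + 1) → MulChar K Qbar) → Qbar) :
    ∑ χ : Fin (n + 1) → MulChar K Qbar, (if χ ∈ kerPhi (shiftedMatrix A) then f χ else 0) =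
      ∑ j, ∑ ψ : MulChar K Qbar, f fun i => normLift K ρ ^ s j i * ψ ^ alphaVec A i := by
  set N := Fintype.card F - 1 with hN
  have hN0 : N ≠ 0 := (Nat.sub_pos_of_lt Fintype.one_lt_card).ne'
  set μ := normLift K ρ with hμdef
  have hμ : orderOf μ = N := by rw [hμdef, orderOf_normLift, orderOf_eq_of_forall_mem_zpowers hρ]
  obtain ⟨b, hb⟩ := hα.exists_sum_mul_eq_one
  have hmk : ∀ j, (fun i => ((s j i : ℕ) : ZMod N)) = fun i => (((s j i : ℕ) : ℤ) : ZMod N) :=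
    fun j => funext fun i => (Int.cast_natCast _).symm
  rw [← Finset.sum_filter, ← Finset.sum_product']
  symm
  refine Finset.sum_bij (fun p _ i => μ ^ s p.1 i * p.2 ^ alphaVec A i) (fun p _ => ?_)
    (fun p _ p' _ h => ?_) (fun χ hχ => ?_) (fun _ _ => rfl)
  · rw [Finset.mem_filter]
    refine ⟨Finset.mem_univ _, ?_⟩
    have h1 := (pow_mul_pow_mem_kerPhi hα hμ (fun i => (s p.1 i : ℤ)) p.2).2
    simp only [zpow_natCast] at h1
    refine h1 ((mem_kerF_iff hα _).1 ?_)
    rw [← hmk, ← SetLike.mem_coe, ← hs.range_eq]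
    exact ⟨p.1, rfl⟩
  · obtain ⟨j, ψ⟩ := p
    obtain ⟨j', ψ'⟩ := p'
    have h1 : ∀ i, (ψ' / ψ) ^ alphaVec A i = μ ^ ((s j i : ℤ) - s j' i) := by
      intro i
      have h2 : μ ^ s j i * ψ ^ alphaVec A i = μ ^ s j' i * ψ' ^ alphaVec A i := congrFun h i
      rw [div_pow, zpow_sub, zpow_natCast, zpow_natCast, div_eq_iff_eq_mul, ← div_eq_mul_inv,
        div_mul_eq_mul_div, eq_div_iff_mul_eq', h2, mul_comm]
    -- The Bézout coefficients recover ψ'/ψ from its powers, hence as a power of μ. So s_j and s_j'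
    -- differ by a multiple of α modulo N and represent the same class.
    have h3 : ψ' / ψ = ∏ i, ((ψ' / ψ) ^ alphaVec A i) ^ b i := by
      have := prod_zpow_zpow (ψ' / ψ) Finset.univ (fun i => (alphaVec A i : ℤ)) b
      simp only [zpow_natCast] at this
      rw [this, hb, zpow_one]
    have h4 : ψ' / ψ = μ ^ ∑ i, b i * ((s j i : ℤ) - s j' i) := by
      rw [← prod_zpow_zpow]
      exact h3.trans (Finset.prod_congr rfl fun i _ => by rw [h1])
    have hj : j = j' := by
      refine hs.injective ?_
      simp only [hmk]
      refine (mkQ_eq_iff _ _).2 ⟨∑ i, b i * ((s j i : ℤ) - s j' i), fun i => ?_⟩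
      have h5 := h1 i
      rw [h4, ← zpow_natCast, ← zpow_mul] at h5
      rw [← hμ, orderOf_dvd_iff_zpow_eq_one, zpow_sub, ← h5, mul_inv_cancel]
    subst hj
    have h6 : ψ' / ψ = 1 := by rw [h4]; simp
    rw [div_eq_one.1 h6]
  · rw [Finset.mem_filter] at hχ
    obtain ⟨g, x, hg, hx⟩ := exists_generator_exponents K χ
    have hdvd : N ∣ Fintype.card K - 1 := by
      rw [← hμ, ← card_mulChar]
      exact orderOf_dvd_card
    obtain ⟨R, hR⟩ := hdvd
    have hx1 : ∀ j, (N : ℤ) * R ∣ ∑ i, shiftedMatrix A j i * x i := fun j => by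
      rw [← Nat.cast_mul, ← hR, ← hg, orderOf_dvd_iff_zpow_eq_one, ← prod_zpow_zpow]
      rw [← hχ.2 j]
      exact Finset.prod_congr rfl fun i _ => by rw [hx i]
    -- With #Kˣ = N R the exponents are y α + R z. The character g^R is killed by N, hence is the
    -- lift of some ρ^u, and the class of u z is represented by one of the s_j.
    obtain ⟨y, hy⟩ := hα.exists_dvd_sub_mul hN0 hdet hdiv hx1
    choose z hz using hy
    obtain ⟨χ₀, hχ₀⟩ := exists_normLift_eq (F := F) K (ψ := g ^ R) (by
      rw [← pow_mul, mul_comm, ← hN, ← hR, ← hg, pow_orderOf_eq_one])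
    obtain ⟨u, rfl⟩ := Subgroup.mem_zpowers_iff.1 (hρ χ₀)
    rw [normLift_zpow] at hχ₀
    have hχ1 : χ = fun i => μ ^ (u * z i) * (g ^ y) ^ alphaVec A i := funext fun i => by
      rw [hx i, zpow_mul, hχ₀, ← zpow_natCast g R, ← zpow_mul, ← hz i, ← zpow_natCast, ← zpow_mul,
        ← zpow_add, sub_add_cancel]
    have h1 := hχ.2
    rw [hχ1, pow_mul_pow_mem_kerPhi hα hμ, ← mem_kerF_iff hα, ← SetLike.mem_coe,
      ← hs.range_eq] at h1
    obtain ⟨j, hj⟩ := h1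
    simp only [hmk] at hj
    obtain ⟨t, ht⟩ := (mkQ_eq_iff _ _).1 hj.symm
    refine ⟨(j, μ ^ t * g ^ y), Finset.mem_univ _, ?_⟩
    rw [hχ1]
    funext i
    have h2 := ht i
    rw [← hμ, orderOf_dvd_iff_zpow_eq_one, sub_sub, zpow_sub, mul_inv_eq_one, zpow_add,
      zpow_natCast, zpow_mul μ t, zpow_natCast] at h2
    rw [h2, mul_pow, mul_assoc]

end ShiftedKernel

/-! ### The parameter sequences of the hypergeometric functions. -/

section Phi

variable {F : Type u} [Field F] [Fintype F] {ρ : MulChar F Qbar}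

theorem natCast_ne_zero_of_dvd_card_sub_one {β : ℕ} (hβ : β ∣ Fintype.card F - 1) :
    (β : F) ≠ 0 := by
  intro h
  obtain ⟨k, hk⟩ := hβ
  have h1 : ((Fintype.card F - 1 : ℕ) : F) = 0 := by rw [hk, Nat.cast_mul, h, zero_mul]
  rw [Nat.cast_sub Fintype.card_pos, Nat.cast_card_eq_zero] at h1
  simp at h1

theorem orderOf_phi (hρ : ∀ χ : MulChar F Qbar, χ ∈ Subgroup.zpowers ρ) {β : ℕ}
    (hβ : β ∣ Fintype.card F - 1) : orderOf (phi ρ β) = β := by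
  have h := orderOf_eq_of_forall_mem_zpowers hρ
  have hN : Fintype.card F - 1 ≠ 0 := (Nat.sub_pos_of_lt Fintype.one_lt_card).ne'
  rw [phi, orderOf_pow_of_dvd, h, Nat.div_div_self hβ hN]
  · exact (Nat.div_pos (Nat.le_of_dvd (Nat.pos_of_ne_zero hN) hβ)
      (Nat.pos_of_dvd_of_pos hβ (Nat.pos_of_ne_zero hN))).ne'
  · rw [h]
    exact Nat.div_dvd_of_dvd hβ

/-- The character `phi ρ β` generates the group of characters killed by β. -/
theorem mem_phiSeq_iff (hρ : ∀ χ : MulChar F Qbar, χ ∈ Subgroup.zpowers ρ) {β : ℕ}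
    (hβ : β ∣ Fintype.card F - 1) {ψ χ : MulChar F Qbar} :
    χ ∈ phiSeq ρ ψ β ↔ χ ^ β = ψ ^ β := by
  have hN : 0 < Fintype.card F - 1 := Nat.sub_pos_of_lt Fintype.one_lt_card
  have hβ0 : 0 < β := Nat.pos_of_dvd_of_pos hβ hN
  have ho := orderOf_phi hρ hβ
  rw [phiSeq, Multiset.mem_map]
  constructor
  · rintro ⟨b, -, rfl⟩
    have h1 := pow_orderOf_eq_one (phi ρ β)
    rw [ho] at h1
    rw [mul_pow, ← pow_mul, mul_comm b, pow_mul, h1, one_pow, mul_one]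
  · intro h
    obtain ⟨m, hm⟩ := Subgroup.mem_zpowers_iff.1 (hρ (χ / ψ))
    have h1 : ρ ^ (m * (β : ℤ)) = 1 := by
      rw [zpow_mul, hm, zpow_natCast, div_pow, h, div_self']
    rw [← orderOf_dvd_iff_zpow_eq_one, orderOf_eq_of_forall_mem_zpowers hρ] at h1
    obtain ⟨k, hk⟩ := hβ
    rw [hk, Nat.cast_mul, mul_comm m, mul_dvd_mul_iff_left (by exact_mod_cast hβ0.ne')] at h1
    obtain ⟨l, rfl⟩ := h1
    have hphi : phi ρ β = ρ ^ k := by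
      rw [phi, hk, Nat.mul_div_cancel_left _ hβ0]
    refine ⟨(l % β).toNat, ?_, ?_⟩
    · rw [Multiset.mem_range]
      have := Int.emod_lt_of_pos l (Int.natCast_pos.2 hβ0)
      have := Int.emod_nonneg l (Int.natCast_pos.2 hβ0).ne'
      omega
    · have h2 := zpow_mod_orderOf (phi ρ β) l
      rw [ho] at h2
      rw [← zpow_natCast, Int.toNat_of_nonneg (Int.emod_nonneg l (Int.natCast_pos.2 hβ0).ne'), h2,
        hphi, ← zpow_natCast, ← zpow_mul, hm, mul_div_cancel]

theorem nodup_phiSeq (hρ : ∀ χ : MulChar F Qbar, χ ∈ Subgroup.zpowers ρ) {β : ℕ}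
    (hβ : β ∣ Fintype.card F - 1) (ψ : MulChar F Qbar) : (phiSeq ρ ψ β).Nodup := by
  refine Multiset.Nodup.map_on (fun b hb b' hb' h => ?_) (Multiset.nodup_range β)
  rw [Multiset.mem_range] at hb hb'
  have ho := orderOf_phi hρ hβ
  exact pow_injOn_Iio_orderOf (by rw [Set.mem_Iio, ho]; exact hb)
    (by rw [Set.mem_Iio, ho]; exact hb') (mul_left_cancel h)

theorem card_phiSeq (ψ : MulChar F Qbar) (β : ℕ) : Multiset.card (phiSeq ρ ψ β) = β := by
  rw [phiSeq, Multiset.card_map, Multiset.card_range]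

end Phi

/-! ### Cancellation of common hypergeometric parameters. -/

section HypTerm

variable {F : Type u} [Field F] (K : Type u) [Field K] [Fintype K] [Algebra F K]

/-- The summand of the hypergeometric function belonging to the character `χ`. -/
def hypTerm (θ : AddChar F Qbar) (A B : Multiset (MulChar F Qbar)) (x : K) (χ : MulChar K Qbar) :
    Qbar :=
  (A.map fun a => G K θ (normLift K a * χ) / G K θ (normLift K a)).prod *
    (B.map fun b => G K θ (normLift K b * χ)⁻¹ / G K θ (normLift K b)⁻¹).prod *
    χ (-1) ^ Multiset.card A * χ x

theorem hyp_eq_sum (θ : AddChar F Qbar) (A B : Multiset (MulChar F Qbar)) (x : K) :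
    hyp K θ A B x = 1 / ((Fintype.card K : Qbar) - 1) * ∑ χ, hypTerm K θ A B x χ := by
  rw [hyp, finsum_eq_sum_of_fintype]
  rfl

theorem hypTerm_add (θ : AddChar F Qbar) (A B I : Multiset (MulChar F Qbar)) (x : K)
    (χ : MulChar K Qbar) : hypTerm K θ (A + I) (B + I) x χ = hypTerm K θ A B x χ *
      (I.map fun a => G K θ (normLift K a * χ) / G K θ (normLift K a) *
        (G K θ (normLift K a * χ)⁻¹ / G K θ (normLift K a)⁻¹) * χ (-1)).prod := by
  rw [hypTerm, hypTerm, Multiset.map_add, Multiset.map_add, Multiset.prod_add, Multiset.prod_add,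
    Multiset.card_add, Multiset.prod_map_mul, Multiset.prod_map_mul, Multiset.map_const',
    Multiset.prod_replicate, pow_add]
  ring

open Classical in
theorem G_mul_G_inv_eq_ite {θ : AddChar F Qbar} (hθ : θ ≠ 1) (μ : MulChar K Qbar) :
    G K θ μ * G K θ μ⁻¹ = μ (-1) * if μ = 1 then 1 else (Fintype.card K : Qbar) := by
  split_ifs with h
  · rw [h, inv_one, G_one K hθ, MulChar.one_apply isUnit_one.neg]
    norm_num
  · exact G_mul_G_inv K hθ h

open Classical in
-- G(μ) G(μ⁻¹) equals μ(-1) Q for non-trivial μ but only 1 for trivial μ, and the signs cancel. A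
-- common parameter therefore matters only when μ or μχ is trivial.
theorem common_factor_eq {θ : AddChar F Qbar} (hθ : θ ≠ 1) (μ χ : MulChar K Qbar) :
    G K θ (μ * χ) / G K θ μ * (G K θ (μ * χ)⁻¹ / G K θ μ⁻¹) * χ (-1) =
      (if μ * χ = 1 then (Fintype.card K : Qbar)⁻¹ else 1) *
        if μ = 1 then (Fintype.card K : Qbar) else 1 := by
  have hQ : (Fintype.card K : Qbar) ≠ 0 := Nat.cast_ne_zero.2 Fintype.card_ne_zero
  have h1 := G_mul_G_inv_eq_ite K hθ μ
  have h2 := G_mul_G_inv_eq_ite K hθ (μ * χ)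
  have hsq : ∀ χ : MulChar K Qbar, χ (-1) * χ (-1) = 1 := fun χ => by rw [← map_mul]; simp
  have hne : μ (-1) ≠ 0 := left_ne_zero_of_mul_eq_one (hsq μ)
  rw [div_mul_div_comm, h1, h2, MulChar.mul_apply]
  have hχ := hsq χ
  split_ifs <;> field_simp <;> linear_combination hχ

theorem prod_map_ite_eq {M X : Type*} [CommMonoid M] (I : Multiset X) (hI : I.Nodup)
    (p : X → Prop) [DecidablePred p] [Decidable (∃ a ∈ I, p a)]
    (hp : ∀ a ∈ I, ∀ b ∈ I, p a → p b → a = b) (u : M) :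
    (I.map fun a => if p a then u else 1).prod = if ∃ a ∈ I, p a then u else 1 := by
  change ∏ a ∈ (⟨I, hI⟩ : Finset X), (if p a then u else 1) = _
  split_ifs with h
  · obtain ⟨a, ha, hpa⟩ := h
    rw [Finset.prod_eq_single_of_mem a (Finset.mem_mk.2 ha) (fun b hb hba =>
      if_neg fun hpb => hba (hp b (Finset.mem_mk.1 hb) a ha hpb hpa)), if_pos hpa]
  · exact Finset.prod_eq_one fun a ha => if_neg fun hpa => h ⟨a, ha, hpa⟩

open Classical in
/-- The effect on the summands of removing common parameters. -/
theorem hypTerm_eq_reduced [DecidableEq (MulChar F Qbar)] {θ : AddChar F Qbar} (hθ : θ ≠ 1) {A B : Multiset (MulChar F Qbar)}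
    (hA : A.Nodup) (x : K) (χ : MulChar K Qbar) :
    hypTerm K θ A B x χ = hypTerm K θ (A - B) (B - A) x χ *
      ((if ∃ a ∈ A ∩ B, normLift K a * χ = 1 then (Fintype.card K : Qbar)⁻¹ else 1) *
        if 1 ∈ A ∩ B then (Fintype.card K : Qbar) else 1) := by
  -- Without repetitions and by injectivity of lifting, at most one common parameter satisfies each
  -- of the two triviality conditions.
  have hI : (A ∩ B).Nodup := Multiset.nodup_of_le (Multiset.inter_le_left) hA
  have h1 : A - B + A ∩ B = A := Multiset.sub_add_inter A B
  have h2 : B - A + A ∩ B = B := by rw [Multiset.inter_comm]; exact Multiset.sub_add_inter B A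
  have h3 := hypTerm_add K θ (A - B) (B - A) (A ∩ B) x χ
  rw [h1, h2] at h3
  rw [h3]
  congr 1
  simp only [common_factor_eq K hθ]
  rw [Multiset.prod_map_mul]
  congr 1
  · exact prod_map_ite_eq _ hI (fun a => normLift K a * χ = 1) (fun a _ b _ ha hb =>
      normLiftHom_injective K (mul_right_cancel (ha.trans hb.symm))) _
  · refine (prod_map_ite_eq _ hI (fun a => normLift K a = 1) (fun a _ b _ ha hb =>
      normLiftHom_injective K (ha.trans hb.symm)) _).trans ?_
    simp only [normLift_eq_one_iff, exists_eq_right]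

end HypTerm

/-! ### From Gauss sum terms to hypergeometric summands. -/

section HasseDavenportProduct

variable {F : Type u} [Field F] (K : Type u) [Field K] [Fintype K] [Algebra F K]

/-- The product of Gauss sums occurring in the Hasse–Davenport product relation. -/
def hdProd (θ : AddChar F Qbar) (φ : MulChar K Qbar) (β : ℕ) (η : MulChar K Qbar) : Qbar :=
  G K θ η * ∏ b ∈ Finset.Ico 1 β, G K θ (η * φ ^ b) / G K θ (φ ^ b)

theorem hdProd_mul {θ : AddChar F Qbar} (hθ : θ ≠ 1) (φ : MulChar K Qbar) {β : ℕ} (hβ : 0 < β)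
    (η ψ : MulChar K Qbar) : hdProd K θ φ β (η * ψ) = hdProd K θ φ β η *
      ∏ b ∈ Finset.range β, G K θ (η * φ ^ b * ψ) / G K θ (η * φ ^ b) := by
  rw [Finset.prod_range_eq_mul_Ico _ hβ, hdProd, hdProd, pow_zero, mul_one, mul_mul_mul_comm,
    ← Finset.prod_mul_distrib, mul_div_cancel₀ _ (G_ne_zero K hθ η)]
  congr 1
  refine Finset.prod_congr rfl fun b _ => ?_
  have h1 := G_ne_zero K hθ (η * φ ^ b)
  rw [mul_right_comm η (φ ^ b) ψ]
  field_simp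

/-- Lower parameters enter the hypergeometric summand through their inverses, whereas the product
relation yields the powers of φ themselves. -/
theorem prod_range_pow_inv {M X : Type*} [CommMonoid M] [CommGroup X] {φ : X} {β : ℕ}
    (hφ : φ ^ β = 1) (f : X → M) :
    ∏ b ∈ Finset.range β, f (φ ^ b)⁻¹ = ∏ b ∈ Finset.range β, f (φ ^ b) := by
  rcases Nat.eq_zero_or_pos β with rfl | hβ
  · simp
  rw [Finset.prod_range_eq_mul_Ico _ hβ, Finset.prod_range_eq_mul_Ico _ hβ, pow_zero, inv_one]
  congr 1
  refine Finset.prod_nbij' (fun b => β - b) (fun b => β - b) ?_ ?_ ?_ ?_ ?_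
  · intro b hb
    rw [Finset.mem_Ico] at hb ⊢
    omega
  · intro b hb
    rw [Finset.mem_Ico] at hb ⊢
    omega
  · intro b hb
    rw [Finset.mem_Ico] at hb
    omega
  · intro b hb
    rw [Finset.mem_Ico] at hb
    omega
  · intro b hb
    rw [Finset.mem_Ico] at hb
    congr 1
    rw [inv_eq_iff_mul_eq_one, ← pow_add, Nat.add_sub_cancel' hb.2.le, hφ]

end HasseDavenportProduct

section HypergeometricTerm

/-- The origin of the argument C λ^(-α); the sign matches the factor χ(-1)^α of the hypergeometric
summand. -/
theorem prod_pow_mul_pow {F : Type u} [Field F] {n : ℕ} {c : Fin (n + 1) → Fˣ}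
    {A : Matrix (Fin (n + 1)) (Fin (n + 1)) ℕ} (lam : Fˣ) :
    (∏ i, ((alphaVec A i : F)⁻¹ * (c i : F)) ^ alphaVec A i) *
      ((-(lam : F))⁻¹ * (alphaSum A : F)) ^ alphaSum A =
      (-1) ^ alphaSum A * (constC c A * ((lam : F) ^ alphaSum A)⁻¹) := by
  have h1 : ((-(lam : F))⁻¹) ^ alphaSum A = (-1) ^ alphaSum A * ((lam : F) ^ alphaSum A)⁻¹ := by
    rw [neg_eq_neg_one_mul, mul_inv, mul_pow, inv_neg_one, inv_pow]
  have h2 : ∏ i, ((alphaVec A i : F)⁻¹ * (c i : F)) ^ alphaVec A i =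
      ∏ i, (c i : F) ^ alphaVec A i / (alphaVec A i : F) ^ alphaVec A i :=
    Finset.prod_congr rfl fun i _ => by rw [mul_pow, inv_pow, div_eq_mul_inv, mul_comm]
  rw [mul_pow, h1, h2, constC]
  ring

theorem natCast_ne_zero_of_dvd {F : Type u} [Field F] [Fintype F] (K : Type u) [Field K] [Algebra F K]
    {β : ℕ} (hβ : β ∣ Fintype.card F - 1) : (β : K) ≠ 0 := by
  rw [← map_natCast (algebraMap F K)]
  exact (map_ne_zero _).2 (natCast_ne_zero_of_dvd_card_sub_one hβ)

variable {F : Type u} [Field F] [Fintype F] {n : ℕ} {c : Fin (n + 1) → Fˣ}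
  {A : Matrix (Fin (n + 1)) (Fin (n + 1)) ℕ} {θ : AddChar F Qbar} {ρ : MulChar F Qbar}
  (K : Type u) [Field K] [Fintype K] [Algebra F K]

theorem prod_map_phiSeq (ψ : MulChar F Qbar) (β : ℕ) (f : MulChar F Qbar → Qbar) :
    ((phiSeq ρ ψ β).map f).prod = ∏ b ∈ Finset.range β, f (ψ * phi ρ β ^ b) := by
  rw [phiSeq, Multiset.map_map]
  rfl

theorem prod_map_sum_phiSeq {ι : Type*} (s : Finset ι) (ψ : ι → MulChar F Qbar) (β : ι → ℕ)
    (f : MulChar F Qbar → Qbar) : ((∑ i ∈ s, phiSeq ρ (ψ i) (β i)).map f).prod =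
      ∏ i ∈ s, ∏ b ∈ Finset.range (β i), f (ψ i * phi ρ (β i) ^ b) := by
  rw [← Multiset.coe_mapAddMonoidHom, map_sum, Multiset.prod_sum]
  exact Finset.prod_congr rfl fun i _ => prod_map_phiSeq _ _ _

theorem G_inv_eq (hθ : θ ≠ 1) (hρ : ∀ χ : MulChar F Qbar, χ ∈ Subgroup.zpowers ρ) {β m : ℕ}
    (hβ : β ∣ Fintype.card F - 1) (hm : β ∣ m) (ψ : MulChar K Qbar) :
    G K θ (normLift K ρ ^ m * ψ ^ β)⁻¹ = (normLift K ρ ^ m * ψ ^ β)⁻¹ (β : K) *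
      (hdProd K θ (normLift K (phi ρ β)) β (normLift K ρ ^ (m / β))⁻¹ *
        ∏ b ∈ Finset.range β, G K θ (normLift K (ρ ^ (m / β) * phi ρ β ^ b) * ψ)⁻¹ /
          G K θ (normLift K (ρ ^ (m / β) * phi ρ β ^ b))⁻¹) := by
  have ho : orderOf (normLift K (phi ρ β)) = β := by rw [orderOf_normLift, orderOf_phi hρ hβ]
  have hpos : 0 < β := Nat.pos_of_dvd_of_pos hβ (Nat.sub_pos_of_lt Fintype.one_lt_card)
  have hone : normLift K (phi ρ β) ^ β = 1 := by
    have := pow_orderOf_eq_one (normLift K (phi ρ β))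
    rwa [ho] at this
  have h1 : (normLift K ρ ^ m * ψ ^ β)⁻¹ = ((normLift K ρ ^ (m / β))⁻¹ * ψ⁻¹) ^ β := by
    rw [mul_pow, inv_pow, inv_pow, ← pow_mul, Nat.div_mul_cancel hm, mul_inv]
  have h2 := prod_range_pow_inv hone fun x => G K θ ((normLift K ρ ^ (m / β))⁻¹ * x * ψ⁻¹) /
    G K θ ((normLift K ρ ^ (m / β))⁻¹ * x)
  rw [h1, G_pow_eq K hθ _ _ (natCast_ne_zero_of_dvd K hβ) ho, ← hdProd, hdProd_mul K hθ _ hpos, ← h2]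
  congr 2
  refine Finset.prod_congr rfl fun b _ => ?_
  rw [normLift_mul, normLift_pow, normLift_pow, mul_inv, mul_inv]

theorem G_eq_hdProd (hθ : θ ≠ 1) (hρ : ∀ χ : MulChar F Qbar, χ ∈ Subgroup.zpowers ρ) {β m : ℕ}
    (hβ : β ∣ Fintype.card F - 1) (hm : β ∣ m) (ψ : MulChar K Qbar) :
    G K θ (normLift K ρ ^ m * ψ ^ β) = (normLift K ρ ^ m * ψ ^ β) (β : K) *
      (hdProd K θ (normLift K (phi ρ β)) β (normLift K ρ ^ (m / β)) *
        ∏ b ∈ Finset.range β, G K θ (normLift K (ρ ^ (m / β) * phi ρ β ^ b) * ψ) /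
          G K θ (normLift K (ρ ^ (m / β) * phi ρ β ^ b))) := by
  have ho : orderOf (normLift K (phi ρ β)) = β := by rw [orderOf_normLift, orderOf_phi hρ hβ]
  have hpos : 0 < β := Nat.pos_of_dvd_of_pos hβ (Nat.sub_pos_of_lt Fintype.one_lt_card)
  have h1 : normLift K ρ ^ m * ψ ^ β = (normLift K ρ ^ (m / β) * ψ) ^ β := by
    rw [mul_pow, ← pow_mul, Nat.div_mul_cancel hm]
  rw [h1, G_pow_eq K hθ _ _ (natCast_ne_zero_of_dvd K hβ) ho, ← hdProd, hdProd_mul K hθ _ hpos]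
  congr 2
  refine Finset.prod_congr rfl fun b _ => ?_
  rw [normLift_mul, normLift_pow, normLift_pow]

/-- The upper parameters of the hypergeometric function belonging to `σ`. -/
abbrev upperParams (ρ : MulChar F Qbar) (A : Matrix (Fin (n + 1)) (Fin (n + 1)) ℕ)
    (σ : Fin (n + 1) → ℕ) : Multiset (MulChar F Qbar) :=
  phiSeq ρ (ρ ^ ((∑ i, σ i) / alphaSum A)) (alphaSum A)

/-- The lower parameters of the hypergeometric function belonging to `σ`. -/
abbrev lowerParams (ρ : MulChar F Qbar) (A : Matrix (Fin (n + 1)) (Fin (n + 1)) ℕ)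
    (σ : Fin (n + 1) → ℕ) : Multiset (MulChar F Qbar) :=
  ∑ i, phiSeq ρ (ρ ^ (σ i / alphaVec A i)) (alphaVec A i)

/-- The product relation, applied with β = α_i to each Gauss sum and with β = α to that of the
product, separates a part independent of ψ, collected in `valGamma`, from the Gauss sum quotients of
the summand. The remaining values of ψ combine to ψ(-1)^α ψ(C λ^(-α)). -/
theorem gaussTerm_mul_eq_valGamma_mul_hypTerm (hθ : θ ≠ 1)
    (hρ : ∀ χ : MulChar F Qbar, χ ∈ Subgroup.zpowers ρ)
    (hαi : ∀ i, alphaVec A i ∣ Fintype.card F - 1) (hα : alphaSum A ∣ Fintype.card F - 1)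
    {σ : Fin (n + 1) → ℕ} (hσi : ∀ i, alphaVec A i ∣ σ i) (hσ : alphaSum A ∣ ∑ i, σ i)
    (lam : Fˣ) (ψ : MulChar K Qbar) :
    gaussTerm K θ (fun i => unitLift K (c i)) (fun i => normLift K ρ ^ σ i * ψ ^ alphaVec A i) *
      (G K θ (∏ i, (normLift K ρ ^ σ i * ψ ^ alphaVec A i)) *
        (∏ i, (normLift K ρ ^ σ i * ψ ^ alphaVec A i))⁻¹ (-algebraMap F K lam)) =
    valGamma K θ ρ c A lam σ * hypTerm K θ (upperParams ρ A σ) (lowerParams ρ A σ)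
      (algebraMap F K (constC c A * ((lam : F) ^ alphaSum A)⁻¹)) ψ := by
  have hN : 0 < Fintype.card F - 1 := Nat.sub_pos_of_lt Fintype.one_lt_card
  have hpos : ∀ i, alphaVec A i ≠ 0 := fun i => (Nat.pos_of_dvd_of_pos (hαi i) hN).ne'
  have hpos' : alphaSum A ≠ 0 := (Nat.pos_of_dvd_of_pos hα hN).ne'
  have hprod : ∏ i, (normLift K ρ ^ σ i * ψ ^ alphaVec A i) =
      normLift K ρ ^ (∑ i, σ i) * ψ ^ alphaSum A := by
    rw [Finset.prod_mul_distrib, Finset.prod_pow_eq_pow_sum, Finset.prod_pow_eq_pow_sum]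
    rfl
  have hχ : ∀ (χ : MulChar K Qbar) (u v : K), χ⁻¹ u * χ v = χ (u⁻¹ * v) := fun χ u v => by
    rw [MulChar.inv_apply', map_mul]
  set y : Fin (n + 1) → K := fun i => algebraMap F K ((alphaVec A i : F)⁻¹ * (c i : F)) with hy
  set z : K := algebraMap F K ((-(lam : F))⁻¹ * (alphaSum A : F)) with hz
  set x : K := algebraMap F K (constC c A * ((lam : F) ^ alphaSum A)⁻¹) with hx
  have hyz : (∏ i, y i ^ alphaVec A i) * z ^ alphaSum A = (-1) ^ alphaSum A * x := by
    have h := congrArg (algebraMap F K) (prod_pow_mul_pow (c := c) (A := A) lam)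
    simpa only [map_mul, map_prod, map_pow, map_neg, map_one, hy, hz, hx] using h
  have hψ : (∏ i, ψ (y i) ^ alphaVec A i) * ψ z ^ alphaSum A = ψ (-1) ^ alphaSum A * ψ x := by
    have h := congrArg ψ hyz
    simpa only [map_mul, map_prod, map_pow] using h
  have hfac : ∀ i, G K θ (normLift K ρ ^ σ i * ψ ^ alphaVec A i)⁻¹ *
      (normLift K ρ ^ σ i * ψ ^ alphaVec A i) (unitLift K (c i) : K) =
      (normLift K ρ ^ σ i) (y i) * ψ (y i) ^ alphaVec A i *
      (hdProd K θ (normLift K (phi ρ (alphaVec A i))) (alphaVec A i)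
          (normLift K ρ ^ (σ i / alphaVec A i))⁻¹ *
        ∏ b ∈ Finset.range (alphaVec A i),
          G K θ (normLift K (ρ ^ (σ i / alphaVec A i) * phi ρ (alphaVec A i) ^ b) * ψ)⁻¹ /
          G K θ (normLift K (ρ ^ (σ i / alphaVec A i) * phi ρ (alphaVec A i) ^ b))⁻¹) := by
    intro i
    rw [G_inv_eq K hθ hρ (hαi i) (hσi i), mul_right_comm, hχ, coe_unitLift]
    have h1 : (alphaVec A i : K)⁻¹ * algebraMap F K (c i) = y i := by
      rw [hy]
      simp only [map_mul, map_inv₀, map_natCast]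
    rw [h1, MulChar.mul_apply, MulChar.pow_apply' ψ (hpos i)]
  have hfac' : G K θ (normLift K ρ ^ (∑ i, σ i) * ψ ^ alphaSum A) *
      (normLift K ρ ^ (∑ i, σ i) * ψ ^ alphaSum A)⁻¹ (-algebraMap F K lam) =
      (normLift K ρ ^ (∑ i, σ i)) z * ψ z ^ alphaSum A *
      (hdProd K θ (normLift K (phi ρ (alphaSum A))) (alphaSum A)
          (normLift K ρ ^ ((∑ i, σ i) / alphaSum A)) *
        ∏ b ∈ Finset.range (alphaSum A),
          G K θ (normLift K (ρ ^ ((∑ i, σ i) / alphaSum A) * phi ρ (alphaSum A) ^ b) * ψ) /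
          G K θ (normLift K (ρ ^ ((∑ i, σ i) / alphaSum A) * phi ρ (alphaSum A) ^ b))) := by
    rw [G_eq_hdProd K hθ hρ hα hσ, mul_right_comm, mul_comm (DFunLike.coe _ _), hχ]
    have h1 : (-algebraMap F K lam)⁻¹ * (alphaSum A : K) = z := by
      rw [hz]
      simp only [map_mul, map_inv₀, map_natCast, map_neg]
    rw [h1, MulChar.mul_apply, MulChar.pow_apply' ψ hpos']
  rw [hprod, hfac', gaussTerm, Finset.prod_congr rfl fun i _ => hfac i, Finset.prod_mul_distrib,
    Finset.prod_mul_distrib, Finset.prod_mul_distrib, hypTerm, prod_map_phiSeq, prod_map_sum_phiSeq,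
    card_phiSeq]
  change _ = ((∏ i, (normLift K ρ ^ σ i) (y i)) * (normLift K ρ ^ (∑ i, σ i)) z *
    (∏ i, hdProd K θ (normLift K (phi ρ (alphaVec A i))) (alphaVec A i)
          (normLift K ρ ^ (σ i / alphaVec A i))⁻¹) *
    hdProd K θ (normLift K (phi ρ (alphaSum A))) (alphaSum A)
          (normLift K ρ ^ ((∑ i, σ i) / alphaSum A))) * _
  rw [mul_assoc (_ * _) (ψ (-1) ^ alphaSum A) (ψ x), ← hψ]
  ring

end HypergeometricTerm

/-! ### The full torus in terms of reduced hypergeometric functions. -/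

section HypergeometricSum

variable {F : Type u} [Field F] [Fintype F] {n : ℕ} {c : Fin (n + 1) → Fˣ}
  {A : Matrix (Fin (n + 1)) (Fin (n + 1)) ℕ} {θ : AddChar F Qbar} {ρ : MulChar F Qbar}
  (K : Type u) [Field K] [Fintype K] [Algebra F K]

theorem mem_lowerParams_iff (hρ : ∀ χ : MulChar F Qbar, χ ∈ Subgroup.zpowers ρ)
    (hαi : ∀ i, alphaVec A i ∣ Fintype.card F - 1) {σ : Fin (n + 1) → ℕ}
    (hσi : ∀ i, alphaVec A i ∣ σ i) {χ : MulChar F Qbar} :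
    χ ∈ lowerParams ρ A σ ↔ ∃ i, χ ^ alphaVec A i = ρ ^ σ i := by
  rw [lowerParams, Multiset.mem_sum]
  simp only [Finset.mem_univ, true_and]
  refine exists_congr fun i => ?_
  rw [mem_phiSeq_iff hρ (hαi i), ← pow_mul, Nat.div_mul_cancel (hσi i)]

theorem mem_upperParams_iff (hρ : ∀ χ : MulChar F Qbar, χ ∈ Subgroup.zpowers ρ)
    (hα : alphaSum A ∣ Fintype.card F - 1) {σ : Fin (n + 1) → ℕ}
    (hσ : alphaSum A ∣ ∑ i, σ i) {χ : MulChar F Qbar} :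
    χ ∈ upperParams ρ A σ ↔ χ ^ alphaSum A = ρ ^ ∑ i, σ i := by
  rw [upperParams, mem_phiSeq_iff hρ hα, ← pow_mul, Nat.div_mul_cancel hσ]

open Classical in
theorem delta_eq_ite (hρ : ∀ χ : MulChar F Qbar, χ ∈ Subgroup.zpowers ρ)
    (hαi : ∀ i, alphaVec A i ∣ Fintype.card F - 1) (hα : alphaSum A ∣ Fintype.card F - 1)
    {σ : Fin (n + 1) → ℕ} (hlt : ∀ i, σ i < Fintype.card F - 1)
    (hσi : ∀ i, alphaVec A i ∣ σ i) (hσ : alphaSum A ∣ ∑ i, σ i) :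
    delta (Fintype.card F - 1) σ =
      if 1 ∈ upperParams ρ A σ ∩ lowerParams ρ A σ then 1 else 0 := by
  rw [delta]
  refine if_congr ?_ rfl rfl
  rw [Multiset.mem_inter, mem_upperParams_iff hρ hα hσ, mem_lowerParams_iff hρ hαi hσi]
  simp only [one_pow, eq_comm (a := (1 : MulChar F Qbar)), ← orderOf_dvd_iff_pow_eq_one,
    orderOf_eq_of_forall_mem_zpowers hρ]
  refine and_congr_right fun _ => exists_congr fun i => ?_
  exact ⟨fun h => h ▸ dvd_zero _, fun h => Nat.eq_zero_of_dvd_of_lt h (hlt i)⟩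

/-- The characters at which the reduced and the unreduced hypergeometric summands have a different
ratio. -/
theorem exists_mem_inter_iff (hρ : ∀ χ : MulChar F Qbar, χ ∈ Subgroup.zpowers ρ)
    (hαi : ∀ i, alphaVec A i ∣ Fintype.card F - 1) (hα : alphaSum A ∣ Fintype.card F - 1)
    {σ : Fin (n + 1) → ℕ} (hσi : ∀ i, alphaVec A i ∣ σ i) (hσ : alphaSum A ∣ ∑ i, σ i)
    (ψ : MulChar K Qbar) :
    (∃ a, (a ∈ upperParams ρ A σ ∧ a ∈ lowerParams ρ A σ) ∧ normLift K a * ψ = 1) ↔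
      ∏ i, (normLift K ρ ^ σ i * ψ ^ alphaVec A i) = 1 ∧
        ∃ i, normLift K ρ ^ σ i * ψ ^ alphaVec A i = 1 := by
  have hprod : ∏ i, (normLift K ρ ^ σ i * ψ ^ alphaVec A i) =
      normLift K ρ ^ (∑ i, σ i) * ψ ^ alphaSum A := by
    rw [Finset.prod_mul_distrib, Finset.prod_pow_eq_pow_sum, Finset.prod_pow_eq_pow_sum]
    rfl
  have key : ∀ (a : MulChar F Qbar), normLift K a * ψ = 1 → ∀ β m : ℕ,
      a ^ β = ρ ^ m ↔ normLift K ρ ^ m * ψ ^ β = 1 := by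
    intro a ha β m
    rw [eq_inv_of_mul_eq_one_right ha, inv_pow, mul_inv_eq_one, ← normLift_pow, ← normLift_pow]
    exact ⟨fun h => by rw [h], fun h => normLiftHom_injective K h.symm⟩
  rw [hprod]
  constructor
  · rintro ⟨a, ⟨h1, h2⟩, h3⟩
    rw [mem_upperParams_iff hρ hα hσ] at h1
    rw [mem_lowerParams_iff hρ hαi hσi] at h2
    exact ⟨(key a h3 _ _).1 h1, h2.imp fun i hi => (key a h3 _ _).1 hi⟩
  · rintro ⟨h1, h2⟩
    obtain ⟨k, hk⟩ := hα
    -- Triviality of the product gives ψ^(-α) = ρ^|σ| (lifted). Since α divides |σ| and q - 1,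
    -- raising to the power (q - 1)/α gives 1, so ψ⁻¹ is a lift.
    have h3 : (ψ⁻¹) ^ (Fintype.card F - 1) = 1 := by
      rw [hk, pow_mul, inv_pow, ← eq_inv_of_mul_eq_one_left h1, ← normLift_pow]
      obtain ⟨l, hl⟩ := hσ
      rw [← normLift_pow, ← pow_mul, hl, mul_right_comm, ← hk, pow_mul, ← card_mulChar,
        pow_card_eq_one, one_pow, normLift_one]
    obtain ⟨a, ha⟩ := exists_normLift_eq (F := F) K h3
    have ha' : normLift K a * ψ = 1 := by rw [ha, inv_mul_cancel]
    refine ⟨a, ⟨?_, ?_⟩, ha'⟩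
    · rw [mem_upperParams_iff hρ ⟨k, hk⟩ hσ]
      exact (key a ha' _ _).2 h1
    · rw [mem_lowerParams_iff hρ hαi hσi]
      exact h2.imp fun i hi => (key a ha' _ _).2 hi

open Classical in
/-- The sum of the Gauss sum terms belonging to `σ`, in terms of the reduced hypergeometric
function. -/
theorem valGamma_mul_valF (hθ : θ ≠ 1) (hρ : ∀ χ : MulChar F Qbar, χ ∈ Subgroup.zpowers ρ)
    (hαi : ∀ i, alphaVec A i ∣ Fintype.card F - 1) (hα : alphaSum A ∣ Fintype.card F - 1)
    {σ : Fin (n + 1) → ℕ} (hlt : ∀ i, σ i < Fintype.card F - 1)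
    (hσi : ∀ i, alphaVec A i ∣ σ i) (hσ : alphaSum A ∣ ∑ i, σ i) (lam : Fˣ)
    {f g : (Fin (n + 1) → MulChar K Qbar) → Qbar}
    (hf : ∀ χ, f χ = gaussTerm K θ (fun i => unitLift K (c i)) χ *
      (G K θ (∏ i, χ i) * (∏ i, χ i)⁻¹ (-algebraMap F K lam)))
    (hg : ∀ χ, g χ = if ∏ i, χ i = 1 ∧ ∃ i, χ i = 1 then
      gaussTerm K θ (fun i => unitLift K (c i)) χ else 0) :
    valGamma K θ ρ c A lam σ * valF K θ ρ c A lam σ =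
      (∑ ψ : MulChar K Qbar, f fun i => normLift K ρ ^ σ i * ψ ^ alphaVec A i) /
        ((Fintype.card K : Qbar) * ((Fintype.card K : Qbar) - 1)) -
      (Fintype.card K : Qbar)⁻¹ * ∑ ψ : MulChar K Qbar,
        g fun i => normLift K ρ ^ σ i * ψ ^ alphaVec A i := by
  have hQ : (Fintype.card K : Qbar) ≠ 0 := Nat.cast_ne_zero.2 Fintype.card_ne_zero
  have hQ1 := card_sub_one_ne_zero K
  have hterm : ∀ ψ : MulChar K Qbar, valGamma K θ ρ c A lam σ *
      ((Fintype.card K : Qbar) ^ (delta (Fintype.card F - 1) σ - 1) *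
        (1 / ((Fintype.card K : Qbar) - 1) *
        hypTerm K θ (upperParams ρ A σ - lowerParams ρ A σ)
        (lowerParams ρ A σ - upperParams ρ A σ)
        (algebraMap F K (constC c A * ((lam : F) ^ alphaSum A)⁻¹)) ψ)) =
      f (fun i => normLift K ρ ^ σ i * ψ ^ alphaVec A i) /
        ((Fintype.card K : Qbar) * ((Fintype.card K : Qbar) - 1)) -
      (Fintype.card K : Qbar)⁻¹ *
        g fun i => normLift K ρ ^ σ i * ψ ^ alphaVec A i := by
    intro ψ
    have h1 := gaussTerm_mul_eq_valGamma_mul_hypTerm (c := c) K hθ hρ hαi hα hσi hσ lam ψ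
    have hA : (upperParams ρ A σ).Nodup := nodup_phiSeq hρ hα _
    rw [← hf, hypTerm_eq_reduced K hθ hA] at h1
    have h2 : (Fintype.card K : Qbar) ^ (delta (Fintype.card F - 1) σ - 1) =
        (if 1 ∈ upperParams ρ A σ ∩ lowerParams ρ A σ then (Fintype.card K : Qbar) else 1) *
          (Fintype.card K : Qbar)⁻¹ := by
      rw [delta_eq_ite hρ hαi hα hlt hσi hσ, zpow_sub₀ hQ, zpow_one, div_eq_mul_inv]
      split_ifs <;> simp
    rw [h2, h1]
    have h3 := exists_mem_inter_iff K hρ hαi hα hσi hσ ψ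
    simp only [← Multiset.mem_inter] at h3
    rw [hg]
    -- At such ψ the product of the characters is trivial, so its Gauss sum is -1 and f = -g.
    -- Removing the common parameter brings an additional factor Q, and f/(Q - 1) = f/(Q (Q - 1)) +
    -- f/Q accounts for the correction by g.
    by_cases hbad : ∃ a ∈ upperParams ρ A σ ∩ lowerParams ρ A σ, normLift K a * ψ = 1
    · have h4 := (h3.1 hbad).1
      rw [hf, h4, G_one K hθ, inv_one, MulChar.one_apply
        (Ne.isUnit (neg_ne_zero.2 ((map_ne_zero _).2 lam.ne_zero))), if_pos hbad] at h1
      rw [if_pos hbad, if_pos (h3.1 hbad)]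
      have h5 := h1
      set D := (if 1 ∈ upperParams ρ A σ ∩ lowerParams ρ A σ then (Fintype.card K : Qbar) else 1)
      set H := hypTerm K θ (upperParams ρ A σ - lowerParams ρ A σ)
        (lowerParams ρ A σ - upperParams ρ A σ)
        (algebraMap F K (constC c A * ((lam : F) ^ alphaSum A)⁻¹)) ψ
      have h6 : gaussTerm K θ (fun i => unitLift K (c i))
          (fun i => normLift K ρ ^ σ i * ψ ^ alphaVec A i) =
          -(valGamma K θ ρ c A lam σ * (H * ((Fintype.card K : Qbar)⁻¹ * D))) := by
        linear_combination -h5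
      rw [h6]
      field_simp
      ring
    · rw [if_neg hbad, if_neg fun h => hbad (h3.2 h)]
      field_simp
      ring
  rw [valF, redHyp, hyp_eq_sum, Finset.mul_sum, Finset.mul_sum, Finset.mul_sum, Finset.sum_div,
    Finset.mul_sum, ← Finset.sum_sub_distrib]
  exact Finset.sum_congr rfl fun ψ _ => by convert hterm ψ

end HypergeometricSum

/-! ### Separation of the part of weight n - 1. -/

section Splitting

variable {F : Type u} [Field F] [Fintype F] {n : ℕ} {c : Fin (n + 1) → Fˣ}
  {A : Matrix (Fin (n + 1)) (Fin (n + 1)) ℕ} {θ : AddChar F Qbar} {ρ : MulChar F Qbar}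
  (K : Type u) [Field K] [Fintype K] [Algebra F K]

open Classical in
/-- The contribution of the full torus to the point count. -/
theorem torusSum_univ_div (hθ : θ ≠ 1) (hρ : ∀ χ : MulChar F Qbar, χ ∈ Subgroup.zpowers ρ)
    (hgen : IsPosGenerator A (alphaVec A)) (hdet : (A.map (Nat.cast : ℕ → ℚ)).det ≠ 0)
    (hdiv : ElementaryDivisorsDvd (extMatrix A Finset.univ) (Fintype.card F - 1))
    (hαi : ∀ i, alphaVec A i ∣ Fintype.card F - 1) (hα : alphaSum A ∣ Fintype.card F - 1)
    {d : ℕ} {s : Fin d → Fin (n + 1) → ℕ} (hs : IsKernelReps A (Fintype.card F - 1) s)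
    (hsi : ∀ j i, alphaVec A i ∣ s j i) (hsum : ∀ j, alphaSum A ∣ ∑ i, s j i) (lam : Fˣ) :
    torusSum K θ c A (lam : F) Finset.univ /
        ((Fintype.card K : Qbar) * ((Fintype.card K : Qbar) - 1)) =
      (∑ j, valGamma K θ ρ c A lam (s j) * valF K θ ρ c A lam (s j)) +
      (Fintype.card K : Qbar)⁻¹ * ∑ χ : Fin (n + 1) → MulChar F Qbar,
        if χ ∈ kerPhi (shiftedMatrix A) ∧ ∏ i, χ i = 1 ∧ ∃ i, χ i = 1 then
          gaussTerm K θ (fun i => unitLift K (c i)) (fun i => normLift K (χ i)) else 0 := by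
  obtain ⟨f, hf⟩ : ∃ f : (Fin (n + 1) → MulChar K Qbar) → Qbar, ∀ χ, f χ =
      gaussTerm K θ (fun i => unitLift K (c i)) χ *
        (G K θ (∏ i, χ i) * (∏ i, χ i)⁻¹ (-algebraMap F K lam)) := ⟨_, fun _ => rfl⟩
  obtain ⟨g, hg⟩ : ∃ g : (Fin (n + 1) → MulChar K Qbar) → Qbar, ∀ χ, g χ =
      if ∏ i, χ i = 1 ∧ ∃ i, χ i = 1 then gaussTerm K θ (fun i => unitLift K (c i)) χ else 0 :=
    ⟨_, fun _ => rfl⟩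
  rw [torusSum_univ]
  simp only [← hf]
  rw [sum_kerPhi_shiftedMatrix K hgen hdet hdiv hs hρ f]
  have h1 : ∀ j, valGamma K θ ρ c A lam (s j) * valF K θ ρ c A lam (s j) = _ := fun j =>
    valGamma_mul_valF (c := c) K hθ hρ hαi hα (hs.lt j) (hsi j) (hsum j) lam hf hg
  rw [Finset.sum_congr rfl fun j _ => h1 j, Finset.sum_sub_distrib, ← Finset.mul_sum,
    ← sum_kerPhi_shiftedMatrix K hgen hdet hdiv hs hρ g]
  have h2 : (∑ χ : Fin (n + 1) → MulChar K Qbar,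
      if χ ∈ kerPhi (shiftedMatrix A) then g χ else 0) =
      ∑ χ : Fin (n + 1) → MulChar F Qbar,
        if χ ∈ kerPhi (shiftedMatrix A) ∧ ∏ i, χ i = 1 ∧ ∃ i, χ i = 1 then
          gaussTerm K θ (fun i => unitLift K (c i)) (fun i => normLift K (χ i)) else 0 := by
    simp only [hg, ← ite_and]
    rw [← Finset.sum_filter, ← Finset.sum_filter]
    symm
    have hone : ∀ χ : Fin (n + 1) → MulChar F Qbar, (∏ i, normLift K (χ i) = 1 ∧
        ∃ i, normLift K (χ i) = 1) ↔ (∏ i, χ i = 1 ∧ ∃ i, χ i = 1) := by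
      intro χ
      simp only [normLift_eq_one_iff]
      rw [← normLift_eq_one_iff K (F := F), ← normLiftHom_apply, map_prod]
      rfl
    refine Finset.sum_bij (fun χ _ k => normLift K (χ k)) (fun χ hχ => ?_) (fun χ _ ψ _ h => ?_)
      (fun χ hχ => ?_) (fun _ _ => rfl)
    · rw [Finset.mem_filter] at hχ ⊢
      exact ⟨Finset.mem_univ _, (normLift_mem_kerPhi_iff K _ χ).2 hχ.2.1, (hone χ).2 hχ.2.2⟩
    · exact funext fun k => normLiftHom_injective K (congrFun h k)
    · rw [Finset.mem_filter] at hχ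
      obtain ⟨-, hker, hprod, hex⟩ := hχ
      -- As ∏ χ_i = 1, the relations of A' become those of A, and the family is lifted from F.
      have hA : ∀ j, ∏ i, χ i ^ (A j i : ℤ) = 1 := fun j => by
        have h := hker j
        simp only [shiftedMatrix, zpow_sub, zpow_one] at h
        rwa [Finset.prod_mul_distrib, Finset.prod_inv_distrib, hprod, inv_one, mul_one] at h
      choose χ' hχ' using fun k => exists_normLift_eq (F := F) K
        (pow_eq_one_of_prod_eq_one K hdet hdiv hA hprod k)
      obtain rfl : (fun k => normLift K (χ' k)) = χ := funext hχ'
      refine ⟨χ', ?_, rfl⟩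
      rw [Finset.mem_filter, ← normLift_mem_kerPhi_iff K, ← hone]
      exact ⟨Finset.mem_univ _, hker, hprod, hex⟩
  rw [h2, ← Finset.sum_div]
  ring

open Classical in
/-- The part of weight `n - 1` of the contribution of the torus belonging to `J`. -/
def mainPart (θ : AddChar F Qbar) (c : Fin (n + 1) → Fˣ)
    (A : Matrix (Fin (n + 1)) (Fin (n + 1)) ℕ) (J : Finset (Fin (n + 1))) : Qbar :=
  ∑ i ∈ Finset.range (J.card - (monomialsIn A J).card + 1),
    (-1 : Qbar) ^ (J.card - (monomialsIn A J).card - i) * (Fintype.card K : Qbar) ^ ((i : ℤ) - 1) *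
    ∑ χ : monomialsIn A J → MulChar F Qbar, if χ ∈ kerPhi (extMatrix A J) ∧
        (Finset.univ.filter fun j => χ j ≠ 1).card + 2 * i = n + 1 then
      gaussTerm K θ (fun i : monomialsIn A J => unitLift K (c i)) (fun i => normLift K (χ i)) else 0

open Classical in
/-- The part of weight `≠ n - 1` of the contribution of the torus belonging to `J`. -/
def errorPart (θ : AddChar F Qbar) (c : Fin (n + 1) → Fˣ)
    (A : Matrix (Fin (n + 1)) (Fin (n + 1)) ℕ) (J : Finset (Fin (n + 1))) (r : ℕ) : Qbar :=
  ∑ i ∈ Finset.range (J.card - (monomialsIn A J).card + 1),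
    ∑ χ ∈ Finset.univ.filter (fun χ : monomialsIn A J → MulChar F Qbar =>
      χ ∈ kerPhi (extMatrix A J) ∧ (Finset.univ.filter fun j => χ j ≠ 1).card + 2 * i ≠ n + 1),
      (-1 : Qbar) ^ (J.card - (monomialsIn A J).card - i) *
      (((J.card - (monomialsIn A J).card).choose i : ℕ) *
      ((-1) ^ (monomialsIn A J).card * (((Fintype.card F : Qbar) ^ r) ^ ((i : ℤ) - 1) *
        gaussNumber θ (fun i : monomialsIn A J => c i) χ ^ r)))

theorem isWeilFunctionOfWeightNe_errorPart (hθ : θ ≠ 1) (J : Finset (Fin (n + 1))) :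
    IsWeilFunctionOfWeightNe (Fintype.card F) ((n : ℤ) - 1) (errorPart θ c A J) := by
  classical
  refine IsWeilFunctionOfWeightNe.sum _ fun i _ => IsWeilFunctionOfWeightNe.sum _ fun χ hχ => ?_
  refine .neg_one_pow_mul (.natCast_mul (.neg_one_pow_mul
    (isWeilFunctionOfWeightNe_gaussNumber hθ _ _ _ _ fun h => ?_) _) _) _
  refine (Finset.mem_filter.1 hχ).2.2 ?_
  have : ((Finset.univ.filter fun j => χ j ≠ 1).card : ℤ) + 2 * i = n + 1 := by
    linarith
  exact_mod_cast this

/-- The contribution of the torus belonging to a proper subset `J`. -/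
theorem torusSum_div_of_ne_univ (hθ : θ ≠ 1) (hdet : (A.map (Nat.cast : ℕ → ℚ)).det ≠ 0)
    (hdiv : ElementaryDivisorsDvd (extMatrix A Finset.univ) (Fintype.card F - 1))
    {J : Finset (Fin (n + 1))} (hJ : J ≠ Finset.univ) (hcard : (monomialsIn A J).card ≤ J.card)
    (hcard' : 2 * J.card ≤ n + 1 + (monomialsIn A J).card) (lam : F) :
    torusSum K θ c A lam J / ((Fintype.card K : Qbar) * ((Fintype.card K : Qbar) - 1)) =
      mainPart K θ c A J + errorPart θ c A J (Module.finrank F K) := by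
  classical
  have hQ : (Fintype.card K : Qbar) ≠ 0 := Nat.cast_ne_zero.2 Fintype.card_ne_zero
  have hQ1 := card_sub_one_ne_zero K
  have h1 := torusSum_of_ne_univ (c := c) (A := A) (lam := lam) K θ hJ
  rw [sum_kerPhi_extMatrix K hdet hdiv] at h1
  obtain ⟨e, he⟩ := Nat.exists_eq_add_of_le hcard
  have he' : J.card - (monomialsIn A J).card = e := by omega
  set g : (monomialsIn A J → MulChar F Qbar) → Qbar := fun χ =>
    gaussTerm K θ (fun i : monomialsIn A J => unitLift K (c i)) (fun i => normLift K (χ i)) with hg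
  have h2 : torusSum K θ c A lam J / ((Fintype.card K : Qbar) * ((Fintype.card K : Qbar) - 1)) =
      (Fintype.card K : Qbar)⁻¹ * ((Fintype.card K : Qbar) - 1) ^ e *
        ∑ χ : monomialsIn A J → MulChar F Qbar,
          if χ ∈ kerPhi (extMatrix A J) then g χ else 0 := by
    rw [he, add_assoc, pow_add, mul_assoc] at h1
    have h3 := mul_left_cancel₀ (pow_ne_zero _ hQ1) h1
    rw [h3, pow_succ]
    field_simp
    rfl
  have h4 : (Fintype.card K : Qbar)⁻¹ * ((Fintype.card K : Qbar) - 1) ^ e =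
      ∑ i ∈ Finset.range (e + 1), (-1 : Qbar) ^ (e - i) *
        ((e.choose i : ℕ) * (Fintype.card K : Qbar) ^ ((i : ℤ) - 1)) := by
    rw [sub_eq_add_neg, add_pow, Finset.mul_sum]
    refine Finset.sum_congr rfl fun i _ => ?_
    rw [zpow_sub₀ hQ, zpow_natCast, zpow_one]
    field_simp
  have hK : (Fintype.card K : Qbar) = (Fintype.card F : Qbar) ^ Module.finrank F K := by
    rw [← Nat.cast_pow, ← Module.card_eq_pow_finrank]
  rw [h2, h4, Finset.sum_mul, mainPart, errorPart, he', ← Finset.sum_add_distrib]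
  refine Finset.sum_congr rfl fun i hi => ?_
  rw [Finset.sum_filter, Finset.mul_sum, Finset.mul_sum, ← Finset.sum_add_distrib]
  refine Finset.sum_congr rfl fun χ _ => ?_
  by_cases hχ : χ ∈ kerPhi (extMatrix A J)
  · rw [if_pos hχ]
    by_cases hk : (Finset.univ.filter fun j => χ j ≠ 1).card + 2 * i = n + 1
    · have hle : (Finset.univ.filter fun j => χ j ≠ 1).card ≤ (monomialsIn A J).card := by
        refine (Finset.card_le_univ _).trans ?_
        rw [Fintype.card_coe]
      -- With k ≤ s_J non-trivial characters and i ≤ e = #J - s_J, one has k + 2i ≤ 2 #J - s_J ≤ n +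
      -- 1, and equality forces i = e. So the binomial coefficient, absent from `mainPart`, is 1.
      have hie : i = e := by
        rw [Finset.mem_range] at hi
        omega
      rw [if_pos ⟨hχ, hk⟩, if_neg fun h => h.2 hk, hie, Nat.choose_self]
      push_cast
      ring
    · rw [if_neg fun h => hk h.2, if_pos ⟨hχ, hk⟩, hg]
      beta_reduce
      rw [gaussTerm_normLift K hθ (fun i : monomialsIn A J => c i), Fintype.card_coe, hK]
      ring
  · rw [if_neg hχ, if_neg fun h => hχ h.1, if_neg fun h => hχ h.1]
    ring

theorem valU_eq_sum_mainPart : valU K θ c A =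
    ∑ J ∈ Finset.univ.filter (fun J : Finset (Fin (n + 1)) =>
      J ≠ Finset.univ ∧ n + 1 ≤ 2 * J.card ∧ (monomialsIn A J).Nonempty), mainPart K θ c A J := by
  classical
  rw [valU]
  refine Finset.sum_congr (by congr) fun J _ => Finset.sum_congr rfl fun i _ => ?_
  congr 1
  rw [finsum_eq_sum_of_fintype]
  refine Finset.sum_congr rfl fun χ _ => ?_
  rw [finsum_eq_if]
  congr

/-- The weight condition would require n + 1 ≤ s_J + 2 (#J - s_J) ≤ 2 #J. -/
theorem mainPart_eq_zero {J : Finset (Fin (n + 1))} (hcard : (monomialsIn A J).card ≤ J.card)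
    (hJ : 2 * J.card < n + 1) : mainPart K θ c A J = 0 := by
  classical
  refine Finset.sum_eq_zero fun i hi => ?_
  rw [Finset.sum_eq_zero fun χ _ => if_neg fun h => ?_, mul_zero]
  have hle : (Finset.univ.filter fun j => χ j ≠ 1).card ≤ (monomialsIn A J).card := by
    refine (Finset.card_le_univ _).trans ?_
    rw [Fintype.card_coe]
  have := h.2
  rw [Finset.mem_range] at hi
  omega

/-- The only family is the empty one, and the weight condition forces i = #J = (n + 1)/2, giving
Q^(i-1). -/
theorem mainPart_of_empty {J : Finset (Fin (n + 1))} (hJ : 2 * J.card = n + 1)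
    (hempty : monomialsIn A J = ∅) :
    mainPart K θ c A J = (Fintype.card K : Qbar) ^ ((n - 1) / 2) := by
  classical
  have hE : IsEmpty (monomialsIn A J) := by rw [hempty]; infer_instance
  have h0 : (monomialsIn A J).card = 0 := by rw [hempty, Finset.card_empty]
  rw [mainPart, h0, Nat.sub_zero, Finset.sum_range_succ, Finset.sum_eq_zero, zero_add, Nat.sub_self,
    pow_zero, one_mul, Fintype.sum_unique, if_pos, gaussTerm, Finset.univ_eq_empty,
    Finset.prod_empty, mul_one]
  · have h1 : ((J.card : ℕ) : ℤ) - 1 = ((n - 1) / 2 : ℕ) := by omega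
    rw [h1, zpow_natCast]
  · refine ⟨fun j => by rw [Finset.univ_eq_empty, Finset.prod_empty], ?_⟩
    rw [Finset.univ_eq_empty, Finset.filter_empty, Finset.card_empty, zero_add, hJ]
  · intro i hi
    rw [Finset.sum_eq_zero fun χ _ => if_neg fun h => ?_, mul_zero]
    have := h.2
    rw [Finset.univ_eq_empty, Finset.filter_empty, Finset.card_empty] at this
    rw [Finset.mem_range] at hi
    omega

/-- Subsets with 2 #J < n + 1 contribute nothing. Among the others, s_J = 0 forces 2 #J = n + 1, and
these subsets are the ones counted by D. -/
theorem sum_mainPart (hcard : ∀ J, (monomialsIn A J).card ≤ J.card)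
    (hcard' : ∀ J, 2 * J.card ≤ n + 1 + (monomialsIn A J).card) :
    ∑ J ∈ (Finset.univ.erase ∅).erase Finset.univ, mainPart K θ c A J =
      valU K θ c A + (numD A : Qbar) * (Fintype.card K : Qbar) ^ ((n - 1) / 2) := by
  classical
  have hD : (numD A : Qbar) * (Fintype.card K : Qbar) ^ ((n - 1) / 2) =
      ∑ J ∈ Finset.univ.filter (fun J : Finset (Fin (n + 1)) =>
        2 * J.card = n + 1 ∧ monomialsIn A J = ∅), mainPart K θ c A J := by
    rw [Finset.sum_congr rfl fun J hJ => mainPart_of_empty K (Finset.mem_filter.1 hJ).2.1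
      (Finset.mem_filter.1 hJ).2.2, Finset.sum_const, nsmul_eq_mul, numD]
    congr 3
    refine Finset.filter_congr fun J _ => and_congr_right fun _ => ?_
    rw [Finset.eq_empty_iff_forall_notMem]
    refine forall_congr' fun i => ?_
    rw [mem_monomialsIn]
    push Not
    exact exists_congr fun j => and_congr_right fun _ => Nat.one_le_iff_ne_zero
  rw [valU_eq_sum_mainPart, hD, ← Finset.sum_union]
  · symm
    refine Finset.sum_subset (fun J hJ => ?_) (fun J hJ hJ' => ?_)
    · rw [Finset.mem_erase, Finset.mem_erase]
      rw [Finset.mem_union, Finset.mem_filter, Finset.mem_filter] at hJ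
      have hne : ∀ J : Finset (Fin (n + 1)), n + 1 ≤ 2 * J.card → J ≠ ∅ := by
        rintro J h rfl
        simp at h
      rcases hJ with ⟨-, h1, h2, -⟩ | ⟨-, h1, -⟩
      · exact ⟨h1, hne J h2, Finset.mem_univ _⟩
      · refine ⟨?_, hne J h1.ge, Finset.mem_univ _⟩
        rintro rfl
        rw [Finset.card_univ, Fintype.card_fin] at h1
        omega
    · refine mainPart_eq_zero K (hcard J) ?_
      rw [Finset.mem_erase] at hJ
      rw [Finset.mem_union, Finset.mem_filter, Finset.mem_filter, not_or] at hJ'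
      by_contra hlt
      rcases (monomialsIn A J).eq_empty_or_nonempty with h | h
      · refine hJ'.2 ⟨Finset.mem_univ _, ?_, h⟩
        have := hcard' J
        rw [h, Finset.card_empty] at this
        omega
      · exact hJ'.1 ⟨Finset.mem_univ _, hJ.1, by omega, h⟩
  · rw [Finset.disjoint_left]
    intro J h1 h2
    rw [Finset.mem_filter] at h1 h2
    exact h1.2.2.2.ne_empty h2.2.2

end Splitting

open Classical in
/-- The difference between the point count and its part of weight `n - 1`. -/
def errorFunction {F : Type u} [Field F] [Fintype F] {n : ℕ} (θ : AddChar F Qbar)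
    (c : Fin (n + 1) → Fˣ) (A : Matrix (Fin (n + 1)) (Fin (n + 1)) ℕ) (r : ℕ) : Qbar :=
  ((Fintype.card F : Qbar) ^ (-1 : ℤ)) ^ r +
    (∑ χ ∈ Finset.univ.filter (fun χ : Fin (n + 1) → MulChar F Qbar =>
      χ ∈ kerPhi (shiftedMatrix A) ∧ ∏ i, χ i = 1 ∧ ∃ i, χ i = 1),
        (-1) ^ (n + 1) * (((Fintype.card F : Qbar) ^ r) ^ (-1 : ℤ) * gaussNumber θ c χ ^ r)) +
    ∑ J ∈ (Finset.univ.erase ∅).erase Finset.univ, errorPart θ c A J r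

/-- Q⁻¹ has weight -2, and a family with a trivial member has at most n non-trivial ones, so
together with Q⁻¹ its weight is at most n - 2. -/
theorem isWeilFunctionOfWeightNe_errorFunction {F : Type u} [Field F] [Fintype F] {n : ℕ}
    {θ : AddChar F Qbar} (hθ : θ ≠ 1) (c : Fin (n + 1) → Fˣ)
    (A : Matrix (Fin (n + 1)) (Fin (n + 1)) ℕ) :
    IsWeilFunctionOfWeightNe (Fintype.card F) ((n : ℤ) - 1) (errorFunction θ c A) := by
  classical
  refine .add (.add (isWeilFunctionOfWeightNe_pow (by omega) (isWeilNumber_natCast_zpow (-1)))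
    (.sum _ fun χ hχ => ?_)) (.sum _ fun J _ => isWeilFunctionOfWeightNe_errorPart hθ J)
  refine .neg_one_pow_mul (isWeilFunctionOfWeightNe_gaussNumber hθ c χ _ _ ?_) _
  obtain ⟨i, hi⟩ := (Finset.mem_filter.1 hχ).2.2.2
  have hle : (Finset.univ.filter fun j => χ j ≠ 1).card < n + 1 := by
    refine (Finset.card_lt_univ_of_notMem (x := i) (by simp [hi])).trans_eq ?_
    rw [Fintype.card_fin]
  omega

end MonomialDeformation
end

theorem mainTheorem4 {F : Type u} [Field F] [Fintype F] {n : ℕ} (hn : 2 ≤ n)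
    (c : Fin (n + 1) → Fˣ) (A : Matrix (Fin (n + 1)) (Fin (n + 1)) ℕ)
    (hdeg : ∀ i, ∑ j, A j i = n + 1) (hne : ∀ i, ∃ j, A j i ≠ 1)
    (hX₀ : IsSmoothHypersurface (deformedPoly c A 0))
    (hαi : ∀ i, alphaVec A i ∣ Fintype.card F - 1) (hα : alphaSum A ∣ Fintype.card F - 1)
    (hdiv : ∀ J : Finset (Fin (n + 1)), n + 1 ≤ 2 * J.card →
      ElementaryDivisorsDvd (extMatrix A J) (Fintype.card F - 1))
    {d : ℕ} [NeZero d] (s : Fin d → Fin (n + 1) → ℕ)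
    (hs : IsKernelReps A (Fintype.card F - 1) s) (hs₀ : s 0 = 0)
    (hsi : ∀ j i, alphaVec A i ∣ s j i) (hsum : ∀ j, alphaSum A ∣ ∑ i, s j i)
    (θ : AddChar F Qbar) (hθ : θ ≠ 1)
    (ρ : MulChar F Qbar) (hρ : ∀ χ : MulChar F Qbar, χ ∈ Subgroup.zpowers ρ)
    (lam : Fˣ) (hX : IsSmoothHypersurface (deformedPoly c A (lam : F)))
    (hC : constC c A ≠ (lam : F) ^ alphaSum A) :
    ∃ w : ℕ → Qbar, IsWeilFunctionOfWeightNe (Fintype.card F) ((n : ℤ) - 1) w ∧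
      ∀ r : ℕ, 1 ≤ r → ∀ (K : Type u) [Field K] [Fintype K] [Algebra F K],
        Module.finrank F K = r →
        (pointCount (deformedPoly c A (lam : F)) K : Qbar) =
          (∑ i ∈ Finset.range n, ((Fintype.card F : Qbar) ^ r) ^ i) + valU K θ c A +
            (numD A : Qbar) * ((Fintype.card F : Qbar) ^ r) ^ ((n - 1) / 2) +
            (∑ j, valGamma K θ ρ c A lam (s j) * valF K θ ρ c A lam (s j)) + w r := by
  classical
  obtain ⟨σ, f, hloop⟩ := exists_isChainLoop hn hdeg hX₀
  have hdet := hloop.det_ne_zero hn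
  have hgen : IsPosGenerator A (alphaVec A) :=
    Classical.epsilon_spec (exists_isPosGenerator hdeg hdet fun _ hx => hloop.pos_of_mulVec_eq_one hn hx)
  have hdivu := hdiv Finset.univ (by rw [Finset.card_univ, Fintype.card_fin]; omega)
  -- The three parts of the error come from the constant Q⁻¹ of the point count, from cancelling
  -- common parameters on the full torus, and from the proper tori.
  refine ⟨errorFunction θ c A, isWeilFunctionOfWeightNe_errorFunction hθ c A, ?_⟩
  rintro r - K _ _ _ rfl
  have hK : (Fintype.card F : Qbar) ^ Module.finrank F K = Fintype.card K := by
    rw [← Nat.cast_pow, ← Module.card_eq_pow_finrank]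
  have huniv : Finset.univ ∈ (Finset.univ : Finset (Finset (Fin (n + 1)))).erase ∅ := by
    rw [Finset.mem_erase]
    exact ⟨Finset.univ_nonempty.ne_empty, Finset.mem_univ _⟩
  have hbad : (Fintype.card K : Qbar)⁻¹ * (∑ χ : Fin (n + 1) → MulChar F Qbar,
        if χ ∈ kerPhi (shiftedMatrix A) ∧ ∏ i, χ i = 1 ∧ ∃ i, χ i = 1 then
          gaussTerm K θ (fun i => unitLift K (c i)) (fun i => normLift K (χ i)) else 0) =
      ∑ χ ∈ Finset.univ.filter (fun χ : Fin (n + 1) → MulChar F Qbar =>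
        χ ∈ kerPhi (shiftedMatrix A) ∧ ∏ i, χ i = 1 ∧ ∃ i, χ i = 1),
          (-1) ^ (n + 1) * (((Fintype.card F : Qbar) ^ Module.finrank F K) ^ (-1 : ℤ) *
            gaussNumber θ c χ ^ Module.finrank F K) := by
    rw [← Finset.sum_filter, Finset.mul_sum]
    refine Finset.sum_congr rfl fun χ _ => ?_
    rw [gaussTerm_normLift K hθ, Fintype.card_fin, hK, zpow_neg_one]
    ring
  rw [pointCount_eq_sum_torusSum K hdeg hθ, ← Finset.add_sum_erase _ _ huniv,
    torusSum_univ_div K hθ hρ hgen hdet hdivu hαi hα hs hsi hsum lam, hbad,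
    Finset.sum_congr rfl fun J hJ => torusSum_div_of_ne_univ K hθ hdet hdivu
      (Finset.ne_of_mem_erase hJ) (hloop.card_monomialsIn_le hn J) (hloop.two_mul_card_le hn J)
      (lam : F), Finset.sum_add_distrib, sum_mainPart K (hloop.card_monomialsIn_le hn)
      (hloop.two_mul_card_le hn), errorFunction, hK]
  simp only [zpow_neg_one, inv_pow, hK]
  ring
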